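/- **Setting.** Fix integers $d\ge 0$, $\tau\ge 1$, a period $T>0$ and $a:\mathbb R\to\mathbb C$, square integrable on each $[jT,(j+1)T)$, $j\ge0$. Put $$\beta(\lambda)=\frac{(1-e^{-i\lambda\tau})^d}{(i\lambda)^d},\qquad w(\lambda)=|\beta(\lambda)|^2=\frac{|1-e^{i\lambda\tau}|^{2d}}{\lambda^{2d}},\qquad \lambda\in[-\pi,\pi).$$ For $j\ge 0$, $k\ge1$ let $a_{kj}=T^{-1/2}\int_0^T a(v+jT)e^{-2\pi i(-1)^k[k/2]v/T}dv$, $\vec a_j=(a_{1j},a_{3j},a_{2j},a_{5j},a_{4j},\dots)^\top$, $\vec b_j=\sum_{m=0}^j d_\tau(j-m)\vec a_m$, where $\sum_k d_\tau(k)x^k=(\sum_j x^{\tau j})^d$. Assume $\vec b_j\in\ell^2$, $\sum_j (j+1)\|\vec b_j\|<\infty$, and let $\mathbf b=D^\tau\mathbf a=(\vec b_j)_{j\ge0}$, $B(\lambda)=\sum_j\vec b_je^{-ij\lambda}$. A *spectral density* $f=\{f_{kn}\}_{k,n\ge1}$ is a measurable function on $[-\pi,\pi)$ whose values are positive (bounded)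 operators on $\ell^2$ with $\int w\,\mathrm{Tr} f\,d\lambda<\infty$. For densities $f$ (signal) and $g$ (noise), $L_2(f+g)$ is the space of measurable $\ell^2$-valued functions $h$ with $\int h^\top(f+g)\bar h\,d\lambda<\infty$, $L_2^0(f+g)$ is the set of those that are limits in it of finite combinations of $e^{-ij\lambda}\beta(\lambda)\vec\delta_k$ ($j\ge 0,k\ge1$), and $$\Delta(h;f,g)=\frac1{2\pi}\int_{-\pi}^{\pi}\big[(\beta B-h)^\top f\,\overline{(\beta B-h)}+h^\top g\,\bar h\big]d\lambda,\qquad \Delta(f,g)=\inf_{h\in L_2^0(f+g)}\Delta(h;f,g).$$ An $h\in L_2^0(f+g)$ attaining the infimum is *optimal* for $(f,g)$, written $h(f,g)$. Let $\mathcal D=\mathcal D_f\times\mathcal D_g$ be a product of two sets of spectral densities, $f^0\in\mathcal D_f$, $g^0\in\mathcal D_g$. The pair $(f^0,g^0)$ is *least favourable* in $\mathcal D$ if $\Delta(f^0,g^0)=\max_{\mathcal D}\Delta(f,g)$. Put $H_{\mathcal D}=\bigcap_{\mathcal D}L_2^0(f+g)$; $h^0\in H_{\mathcal D}$ is *minimax*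 if $\sup_{\mathcal D}\Delta(h^0;f,g)=\min_{h\in H_{\mathcal D}}\sup_{\mathcal D}\Delta(h;f,g)$. **(0) Stochastic meaning.** Let $\xi,\eta$ be uncorrelated mean-square continuous processes with centred periodically correlated $d$-th increments of period $T$, whose generated vector increment sequences $\vec\xi_j,\vec\eta_j$ (step $\tau$) have spectral densities $(f,g)\in\mathcal D$, and let $A\xi$ be represented as $\sum_{j\ge0}\vec b_j^{\top}\vec\xi_{-j}$. Then $\Delta(h;f,g)$ is the mean square error of the estimate of $A\xi$ with spectral characteristic $h\in L^0_2(f+g)$, and $\Delta(f,g)$ is that of the projection of $A\xi$ on the closed span of the components of $\vec\xi_j+\vec\eta_j$, $j\le 0$. **(1) Operators.** Let $\mathbf P,\mathbf R,\mathbf Q$ be the (possibly unbounded) operators with block entries, for $l,j\ge 0$, $$P_{l,j}=\tfrac1{2\pi}\!\int e^{-i\lambda(l-j)}w^{-1}\big((f+g)^{-1}\big)^{\top}d\lambda,\quad R_{l+1,j}=\tfrac1{2\pi}\!\int e^{-i\lambda(l+1+j)}\big(f(f+g)^{-1}\big)^{\top}d\lambda,$$ $$Q_{l,j}=\tfrac1{2\pi}\!\int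 e^{i\lambda(l-j)}w\,\big(f(f+g)^{-1}g\big)^{\top}d\lambda,$$ that is, an operator multiplies the series $\sum_jc_je^{i(j+1)\lambda}$ (for $\mathbf P$), $\sum_jx_je^{-ij\lambda}$ (for $\mathbf R,\mathbf Q$) by its operator function and takes Fourier coefficients, where applying the inverse $w^{-1}((f+g)^{-1})^\top$ means solving with an integrable $\ell^2$-valued function $u$; for $\mathbf P$ it is also required that $\int w\,u^\top(f+g)\bar u\,d\lambda<\infty$, and the values of $\mathbf P,\mathbf R$ lie in $\ell^2$. Suppose $(f^0,g^0)$ satisfies the minimality condition: $w^{-1}((f^0+g^0)^{-1})^\top\vec\delta_k$ exists a.e. and is integrable, for every $k$. Suppose the number $$J(f,g)=\langle\mathbf R\mathbf b,\mathbf P^{-1}\mathbf R\mathbf b\rangle+\langle\mathbf Q\mathbf b,\mathbf b\rangle$$ is defined for all $(f,g)\in\mathcal D$. Then $(f^0,g^0)$ is least favourable in $\mathcal D$ if and only if $\max_{\mathcal D}J(f,g)=J(f^0,g^0)$. The same is true with $g(f+g)^{-1}$ instead of $f(f+g)^{-1}$ in the definition of $\mathbf R$. **(2) Factorizations.** A canonical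 factorization $wF=\Phi\Phi^*$, $\Phi(\lambda)=\sum_{k\ge0}\phi(k)e^{-ik\lambda}$, has $\infty\times M$ coefficients ($M\le\infty$) with $\sum_k\|\phi(k)\|_{HS}^2<\infty$, and the functions $e^{-ij\lambda}\Phi^\top\vec\delta_i$, $j\ge0$, $i\ge1$, span the square-summable series $\sum_{n\ge0}v_ne^{-in\lambda}$, $v_n\in\ell^2(M)$. For $w(f+g)=\Theta\Theta^*$ canonical let $\Psi\Theta=E_M$, $\Psi=\sum_{k\ge0}\psi(k)e^{-ik\lambda}$ with each row square integrable. Put $(\widetilde\Phi\mathbf b)_l=\sum_{j\le l}\phi^\top(l-j)\vec b_j$, $c^f(m)=\sum_l\bar\phi(l)(\widetilde\Phi\mathbf b)_{l+m}$, $(\bar\psi\mathbf C^f)_m=\sum_j\bar\psi(j)c^f(j+m)$, and let $\widetilde\Omega\mathbf b$, $c^g$, $\bar\psi\mathbf C^g$ be the same expressions formed from a canonical factorization $wg=\Omega\Omega^*$, $\Omega=\sum_{k\ge0}\omega(k)e^{-ik\lambda}$. Saying that $wf=\Phi\Phi^*$ (or $wg=\Omega\Omega^*$) is admitted includes $c^f\in\ell^2$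 (resp. $c^g\in\ell^2$); saying that $w(f+g)=\Theta\Theta^*$ is admitted includes the existence of $\Psi$. (a) Suppose every $(f,g)\in\mathcal D$ admits the factorizations of $w(f+g)$ and $wf$. Then $(f^0,g^0)$ is least favourable in $\mathcal D$ if and only if its coefficients $(\psi^0,\phi^0)$ maximize $\|\widetilde\Phi\mathbf b\|^2-\|\bar\psi\mathbf C^f\|^2$ over all coefficients of such factorizations of pairs $(f,g)\in\mathcal D$. (b) The same with $wg=\Omega\Omega^*$ in place of $wf=\Phi\Phi^*$ and $\|\widetilde\Omega\mathbf b\|^2-\|\bar\psi\mathbf C^g\|^2$. **(3) One density known.** (a) Let $g$ be a known density admitting $wg=\Omega\Omega^*$, and let $w(f+g)$ admit a factorization for all $f\in\mathcal D_f$. Then $f^0$ is least favourable in $\mathcal D_f\times\{g\}$ if and only if $\psi^0$ minimizes $\|\bar\psi\mathbf C^g\|^2$ over the coefficients $\psi$ belonging to $f+g$, $f\in\mathcal D_f$. (b) Let $f$ be known, admitting $wf=\Phi\Phi^*$, and let $w(f+g)$ admit a factorization for all $g\in\mathcal D_g$. Then $g^0$ is least favourable in $\{f\}\times\mathcal D_g$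 if and only if $\psi^0$ minimizes $\|\bar\psi\mathbf C^f\|^2$ over the coefficients $\psi$ belonging to $f+g$, $g\in\mathcal D_g$. **(4) Minimax characteristic.** If $(f^0,g^0)$ admits the factorizations of $w(f+g)$ and $wf$, the function $$h=\beta\,\Psi^\top\sum_{m\ge0}(\bar\psi\mathbf C^f)_me^{-im\lambda}$$ is optimal for $(f^0,g^0)$; if it admits those of $w(f+g)$ and $wg$, so is $h=\beta\big(B-\Psi^\top\sum_{m\ge0}(\bar\psi\mathbf C^g)_me^{-im\lambda}\big)$ (if $M=\infty$: whenever the sum over the $M$ components converges in $\ell^2$ almost everywhere). Suppose that $\mathcal D_f,\mathcal D_g$ are convex and that, for all $f\in\mathcal D_f$, $g\in\mathcal D_g$ and almost every $\lambda$, the quadratic forms of $f(\lambda)$ and $g(\lambda)$ are lower semicontinuous with respect to the seminorm defined by the form of $f^0(\lambda)+g^0(\lambda)$ (automatic if $f^0(\lambda)+g^0(\lambda)$ has a bounded inverse). If $(f^0,g^0)$ is least favourable and $h^0$ is optimal for it, in particular if $h^0$ is given by one of these formulas, and $h^0\in H_{\mathcal D}$, then $h^0$ is minimax. This holds in particular for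 $\mathcal D=\mathcal D_f\times\{g\}$ and $\mathcal D=\{f\}\times\mathcal D_g$. -/

import Mathlib

open MeasureTheory Filter Topology
open scoped ENNReal

namespace PCFilter

noncomputable section

/-! ### Spectral densities and the weight of the `d`-th increment -/

/-- The space `ℓ²` in which the components `k = 1, 2, …` live (the component `k` has index
`k - 1` here). The inner product `⟨x, y⟩ = ∑ xₖ ȳₖ` is `inner ℂ y x`. -/
abbrev Vec : Type := lp (fun _ : ℕ => ℂ) 2

/-- An operator-valued function on the frequency band. -/
abbrev Density : Type := ℝ → Vec →L[ℂ] Vec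

/-- Lebesgue measure on `[-π, π)`. -/
def band : Measure ℝ := volume.restrict (Set.Ico (-Real.pi) Real.pi)

/-- The coordinate vectors `δₖ`. -/
def unitVec (k : ℕ) : Vec := lp.single 2 k 1

/-- `(1 - e^{-iτlam})^d / (i lam)^d`. -/
def beta (d τ : ℕ) (lam : ℝ) : ℂ :=
  (1 - Complex.exp (-(Complex.I * τ * lam))) ^ d / (Complex.I * lam) ^ d

/-- `|1 - e^{iτlam}|^{2d} / lam^{2d}`. -/
def weight (d τ : ℕ) (lam : ℝ) : ℝ :=
  ‖1 - Complex.exp (Complex.I * τ * lam)‖ ^ (2 * d) / lam ^ (2 * d)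

/-- The quadratic form `⟨A x, x⟩`. -/
def quad (A : Vec →L[ℂ] Vec) (x : Vec) : ℝ := (inner ℂ x (A x)).re

/-- The entry `f_{kn} = ⟨f δₖ, δₙ⟩` of the spectral density matrix of the operator `f`.
With this convention `x^⊤ {f_{kn}} ȳ = ⟨f x, y⟩`, so the transposed matrices
`{f_{kn}}^⊤`, `({f_{kn}} {g_{kn}})^⊤` act on column vectors as the operators `f`, `g f`. -/
def entry (A : Vec →L[ℂ] Vec) (k n : ℕ) : ℂ := inner ℂ (unitVec n) (A (unitVec k))

/-- Spectral densities: measurable, positive-operator-valued, with integrable weighted kernel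
(trace) norm. -/
structure IsSpectralDensity (d τ : ℕ) (f : Density) : Prop where
  measurable : ∀ x : Vec, AEStronglyMeasurable (fun lam => f lam x) band
  positive : ∀ᵐ lam ∂band, (f lam).IsPositive
  trace : ∫⁻ lam, ∑' k, ENNReal.ofReal (weight d τ lam * (entry (f lam) k k).re) ∂band < ∞

/-- The weighted operator `|1 - e^{iτlam}|^{2d} lam^{-2d} f(lam)`. -/
def weighted (d τ : ℕ) (f : Density) : Density := fun lam => (weight d τ lam : ℂ) • f lam

/-! ### Fourier coefficients and series -/

/-- The Fourier coefficient `(2π)⁻¹ ∫ e^{-in lam} u(lam) dlam`. -/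
def fourierCo {E : Type} [NormedAddCommGroup E] [NormedSpace ℂ E] (u : ℝ → E) (n : ℤ) : E :=
  (1 / (2 * Real.pi) : ℂ) • ∫ lam, Complex.exp (-(Complex.I * n * lam)) • u lam ∂band

/-- `u(lam) = ∑ₙ aₙ e^{in lam}` in the mean square. -/
def HasSeries {E : Type} [NormedAddCommGroup E] [NormedSpace ℂ E] (u : ℝ → E) (a : ℤ → E) :
    Prop :=
  MemLp u 2 band ∧ ∀ n, fourierCo u n = a n

/-- The coefficients of `∑_{j ≥ 0} x_j e^{-ij lam}`. -/
def causal {E : Type} [Zero E] (x : ℕ → E) (n : ℤ) : E := if n ≤ 0 then x (-n).toNat else 0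

/-- The coefficients of `∑_{j ≥ 0} c_j e^{i(j+1) lam}`. -/
def anticausal {E : Type} [Zero E] (c : ℕ → E) (n : ℤ) : E :=
  if 1 ≤ n then c (n - 1).toNat else 0

/-! ### The functional `A ξ = ∑_j b_j^⊤ ξ_{-j}`, `b = D^τ a` -/

/-- The frequency `(-1)^k [k/2]` of the basis function `ẽ_k` (0-based: index `k - 1`). -/
def freq (k : ℕ) : ℤ := (-1) ^ (k + 1) * ((k + 1) / 2 : ℕ)

/-- The permutation `1, 3, 2, 5, 4, …` of the components (0-based). -/
def swapIdx (k : ℕ) : ℕ := if k = 0 then 0 else if k % 2 = 1 then k + 1 else k - 1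

/-- `a_{kj} = T^{-1/2} ∫_0^T a(v + jT) e^{-2πi (-1)^k [k/2] v/T} dv`. -/
def aCoeff (T : ℝ) (a : ℝ → ℂ) (j k : ℕ) : ℂ :=
  (1 / Real.sqrt T : ℂ) * ∫ v in (0 : ℝ)..T,
    Complex.exp (-(2 * Real.pi * Complex.I * freq k * v / T)) * a (v + j * T)

/-- The coefficients of `(∑_j x^{τ j})^d`. -/
def dCoeff (d τ n : ℕ) : ℂ :=
  PowerSeries.coeff n ((PowerSeries.mk fun m => if τ ∣ m then (1 : ℂ) else 0) ^ d)

/-- The `k`-th component of `b_j = ∑_{m ≤ j} d_τ(j - m) a_m`. -/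
def bCoeff (T : ℝ) (d τ : ℕ) (a : ℝ → ℂ) (j k : ℕ) : ℂ :=
  ∑ m ∈ Finset.range (j + 1), dCoeff d τ (j - m) * aCoeff T a m (swapIdx k)

/-- `B_τ(e^{-i lam}) = ∑_j b_j e^{-ij lam}`. -/
def bFun (b : ℕ → Vec) (lam : ℝ) : Vec := ∑' j : ℕ, Complex.exp (-(Complex.I * j * lam)) • b j

/-! ### Spectral characteristics, mean square errors, least favourable densities -/

/-- `(2π)⁻¹ ∫ ⟨S h, h⟩ dlam`, the squared norm of `L₂(S)`. -/
def sqNorm (S : Density) (h : ℝ → Vec) : ℝ≥0∞ :=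
  ENNReal.ofReal (1 / (2 * Real.pi)) * ∫⁻ lam, ENNReal.ofReal (quad (S lam) (h lam)) ∂band

/-- The finite combinations of `e^{-ij lam} (1 - e^{-iτlam})^d (i lam)^{-d} δₖ`, `j ≥ 0`;
the index of a coefficient is `(j, k)`. -/
def trigPoly (d τ : ℕ) (α : ℕ × ℕ →₀ ℂ) (lam : ℝ) : Vec :=
  α.sum fun p z => (z * Complex.exp (-(Complex.I * p.1 * lam)) * beta d τ lam) • unitVec p.2

/-- `L₂⁰(S)`: the functions of `L₂(S)` that are limits of the combinations above. -/
def L20 (d τ : ℕ) (S : Density) : Set (ℝ → Vec) :=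
  {h | AEStronglyMeasurable h band ∧ sqNorm S h < ∞ ∧
    ∀ ε : ℝ≥0∞, ε ≠ 0 → ∃ α : ℕ × ℕ →₀ ℂ, sqNorm S (h - trigPoly d τ α) < ε}

/-- `Δ(h; f, g)`: the mean square error of the estimate with spectral characteristic `h` when
the densities are `f` (signal) and `g` (noise). -/
def mse (d τ : ℕ) (b : ℕ → Vec) (h : ℝ → Vec) (f g : Density) : ℝ≥0∞ :=
  ENNReal.ofReal (1 / (2 * Real.pi)) * ∫⁻ lam, ENNReal.ofReal
    (quad (f lam) (beta d τ lam • bFun b lam - h lam) + quad (g lam) (h lam)) ∂band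

/-- `Δ(f, g)`: the mean square error of the optimal linear estimate. -/
def optMSE (d τ : ℕ) (b : ℕ → Vec) (f g : Density) : ℝ≥0∞ :=
  ⨅ h ∈ L20 d τ (f + g), mse d τ b h f g

/-- `h = h(f, g)` is the spectral characteristic of the optimal estimate. -/
def IsOptimal (d τ : ℕ) (b : ℕ → Vec) (f g : Density) (h : ℝ → Vec) : Prop :=
  h ∈ L20 d τ (f + g) ∧ ∀ h' ∈ L20 d τ (f + g), mse d τ b h f g ≤ mse d τ b h' f g

/-- `(f⁰, g⁰)` is least favourable in `D_f × D_g`. -/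
def LeastFavourable (d τ : ℕ) (b : ℕ → Vec) (Df Dg : Set Density) (f₀ g₀ : Density) : Prop :=
  f₀ ∈ Df ∧ g₀ ∈ Dg ∧ ∀ f ∈ Df, ∀ g ∈ Dg, optMSE d τ b f g ≤ optMSE d τ b f₀ g₀

/-- `H_D`, the intersection of the spaces `L₂⁰(f + g)`. -/
def HD (d τ : ℕ) (Df Dg : Set Density) : Set (ℝ → Vec) :=
  {h | ∀ f ∈ Df, ∀ g ∈ Dg, h ∈ L20 d τ (f + g)}

/-- `h⁰` is a minimax (robust) spectral characteristic. -/
def IsMinimax (d τ : ℕ) (b : ℕ → Vec) (Df Dg : Set Density) (h₀ : ℝ → Vec) : Prop :=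
  h₀ ∈ HD d τ Df Dg ∧ ∀ h ∈ HD d τ Df Dg,
    (⨆ f ∈ Df, ⨆ g ∈ Dg, mse d τ b h₀ f g) ≤ ⨆ f ∈ Df, ⨆ g ∈ Dg, mse d τ b h f g

/-! ### The stochastic meaning of the mean square errors -/

/-- The increment `∑_l (-1)^l (d choose l) X(t - l s)`. -/
def increment {H : Type} [AddCommGroup H] [Module ℂ H] (d : ℕ) (X : ℝ → H) (s t : ℝ) : H :=
  ∑ l ∈ Finset.range (d + 1), ((-1 : ℂ) ^ l * (d.choose l : ℂ)) • X (t - l * s)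

/-- The component `X_{kj}` of the generated increment sequence with step `τ`. -/
def genSeq {H : Type} [NormedAddCommGroup H] [NormedSpace ℂ H] (T : ℝ) (d τ : ℕ) (X : ℝ → H)
    (k : ℕ) (j : ℤ) : H :=
  (1 / Real.sqrt T : ℂ) • ∫ v in (0 : ℝ)..T,
    Complex.exp (-(2 * Real.pi * Complex.I * freq k * v / T)) •
      increment d X (τ * T) (v + j * T)

/-- A mean-square continuous process with centred periodically correlated `d`-th increments of
period `T` whose generated sequence with step `τ` has the spectral density `f`. -/
structure IsPCIncrement {Ω : Type} [MeasurableSpace Ω] (P : Measure Ω) (T : ℝ) (d τ : ℕ)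
    (f : Density) (X : ℝ → Lp ℂ 2 P) : Prop where
  cont : Continuous X
  mean : ∀ (s : ℤ) (t : ℝ), ∫ ω, increment d X (s * T) t ω ∂P = 0
  periodic : ∀ (s₁ s₂ : ℤ) (t₁ t₂ : ℝ),
    inner ℂ (increment d X (s₂ * T) (t₂ + T)) (increment d X (s₁ * T) (t₁ + T)) =
      inner ℂ (increment d X (s₂ * T) t₂) (increment d X (s₁ * T) t₁)
  density : ∀ (k n : ℕ) (l j : ℤ),
    inner ℂ (genSeq T d τ X n j) (genSeq T d τ X k l) =
      fourierCo (fun lam => (weight d τ lam : ℂ) * entry (f lam) k n) (j - l)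

/-- Signal and noise: uncorrelated processes with spectral densities `f` and `g`. -/
structure IsSignalNoise {Ω : Type} [MeasurableSpace Ω] (P : Measure Ω) (T : ℝ) (d τ : ℕ)
    (f g : Density) (ξ η : ℝ → Lp ℂ 2 P) : Prop where
  signal : IsPCIncrement P T d τ f ξ
  noise : IsPCIncrement P T d τ g η
  uncorrelated : ∀ (s₁ s₂ : ℤ) (t₁ t₂ : ℝ),
    inner ℂ (increment d η (s₂ * T) t₂) (increment d ξ (s₁ * T) t₁) = 0

/-- `B ξ = ∑_j b_j^⊤ ξ_{-j}`. -/
def functionalB {H : Type} [NormedAddCommGroup H] [NormedSpace ℂ H] (T : ℝ) (d τ : ℕ)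
    (b : ℕ → Vec) (ξ : ℝ → H) : H :=
  ∑' j : ℕ, ∑' k : ℕ, b j k • genSeq T d τ ξ k (-(j : ℤ))

/-- The finite linear combination of observations with spectral characteristic `trigPoly α`. -/
def obsPoly {H : Type} [NormedAddCommGroup H] [NormedSpace ℂ H] (T : ℝ) (d τ : ℕ)
    (ξ η : ℝ → H) (α : ℕ × ℕ →₀ ℂ) : H :=
  α.sum fun p z => z • (genSeq T d τ ξ p.2 (-(p.1 : ℤ)) + genSeq T d τ η p.2 (-(p.1 : ℤ)))

/-- `X = ∫ h^⊤ dZ_{ξ+η}`: the estimate with spectral characteristic `h ∈ L₂⁰(f + g)`. -/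
def IsEstimate {H : Type} [NormedAddCommGroup H] [NormedSpace ℂ H] (T : ℝ) (d τ : ℕ)
    (f g : Density) (ξ η : ℝ → H) (h : ℝ → Vec) (X : H) : Prop :=
  h ∈ L20 d τ (f + g) ∧ ∀ ε : ℝ, 0 < ε → ∃ α : ℕ × ℕ →₀ ℂ,
    sqNorm (f + g) (h - trigPoly d τ α) < ENNReal.ofReal ε ∧ ‖X - obsPoly T d τ ξ η α‖ < ε

/-- `X` is the projection of `B ξ` on the closed span of the observations. -/
def IsProjection {H : Type} [NormedAddCommGroup H] [InnerProductSpace ℂ H] (T : ℝ) (d τ : ℕ)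
    (b : ℕ → Vec) (ξ η : ℝ → H) (X : H) : Prop :=
  X ∈ closure (Set.range (obsPoly T d τ ξ η)) ∧
    ∀ Y ∈ Set.range (obsPoly T d τ ξ η), inner ℂ Y (functionalB T d τ b ξ - X) = 0

/-! ### The operators `P`, `R`, `Q` and the functional of the projection method

The inverse of a kernel operator on `ℓ²` is unbounded, so `P`, `R`, `Q` are given by their
graphs: multiply the series by the operator function and take the Fourier coefficients. A vector
`v` with `|1 - e^{iτlam}|^{2d} lam^{-2d} (f + g) v = x` plays the role of
`lam^{2d} |1 - e^{iτlam}|^{-2d} (f + g)⁻¹ x`. -/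

/-- The minimality condition: `lam^{2d} |1 - e^{iτlam}|^{-2d} (f + g)⁻¹` exists almost everywhere
on the coordinate vectors `δₖ` and its columns `V lam k` are integrable. -/
def Minimality (d τ : ℕ) (f g : Density) : Prop :=
  ∃ V : ℝ → ℕ → Vec, (∀ k, Integrable (fun lam => V lam k) band) ∧
    ∀ᵐ lam ∂band, ∀ k, weighted d τ (f + g) lam (V lam k) = unitVec k

/-- `y = P c`: `y_l = ∑_j P_{l,j} c_j`, where the `P_{l,j}` are the Fourier coefficients at
`l - j` of `lam^{2d} |1 - e^{iτlam}|^{-2d} ((f + g)⁻¹)^⊤`. -/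
def PGraph (d τ : ℕ) (f g : Density) (c y : ℕ → Vec) : Prop :=
  Summable (fun l => ‖y l‖ ^ 2) ∧ ∃ C u : ℝ → Vec,
    HasSeries C (anticausal c) ∧ Integrable u band ∧
    (∀ᵐ lam ∂band, weighted d τ (f + g) lam (u lam) = C lam) ∧
    Integrable (fun lam => quad (weighted d τ (f + g) lam) (u lam)) band ∧
    ∀ l : ℕ, y l = fourierCo u (l + 1)

/-- `y = R x`: `y_l = ∑_j R_{l+1,j} x_j`, where the `R_{l,j}` are the Fourier coefficients at
`l + j` of `(A (f + g)⁻¹)^⊤`. -/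
def RGraph (d τ : ℕ) (A f g : Density) (x y : ℕ → Vec) : Prop :=
  Summable (fun l => ‖y l‖ ^ 2) ∧ ∃ X v : ℝ → Vec,
    HasSeries X (causal x) ∧ Integrable v band ∧
    (∀ᵐ lam ∂band, weighted d τ (f + g) lam (v lam) = weighted d τ A lam (X lam)) ∧
    ∀ l : ℕ, y l = fourierCo v (l + 1)

/-- `y = Q x`: `y_l = ∑_j Q_{l,j} x_j`, where the `Q_{l,j}` are the Fourier coefficients at
`j - l` of `|1 - e^{iτlam}|^{2d} lam^{-2d} (f (f + g)⁻¹ g)^⊤`. -/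
def QGraph (d τ : ℕ) (f g : Density) (x y : ℕ → Vec) : Prop :=
  ∃ X v : ℝ → Vec,
    HasSeries X (causal x) ∧ Integrable v band ∧
    (∀ᵐ lam ∂band, weighted d τ (f + g) lam (v lam) = weighted d τ f lam (X lam)) ∧
    Integrable (fun lam => weighted d τ g lam (v lam)) band ∧
    ∀ l : ℕ, y l = fourierCo (fun lam => weighted d τ g lam (v lam)) (-(l : ℤ))

/-- `J = ⟨R b, P⁻¹ R b⟩ + ⟨Q b, b⟩`. The operator `R` may be built from `f (f + g)⁻¹`
(`fromNoise = false`) or from `g (f + g)⁻¹` (`fromNoise = true`). -/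
def IsFilterValue (d τ : ℕ) (b : ℕ → Vec) (fromNoise : Bool) (f g : Density) (J : ℝ) : Prop :=
  ∃ y c q : ℕ → Vec, RGraph d τ (if fromNoise then g else f) f g b y ∧ PGraph d τ f g c y ∧
    QGraph d τ f g b q ∧
    J = (∑' l, inner ℂ (c l) (y l)).re + (∑' l, inner ℂ (b l) (q l)).re

/-! ### Canonical factorizations and the functionals built from their coefficients -/

/-- `|1 - e^{iτlam}|^{2d} lam^{-2d} F = Φ Φ*`, `Φ = ∑_k φ(k) e^{-ik lam}`, is a canonical
factorization with `M ≤ ∞` columns. `Φ lam m` and `φ k m` are the `m`-th columns of `Φ` and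
`φ(k)`; columns with index `≥ M` are zero. The factorization is canonical (the innovations
generate the same past as the sequence) when the functions `e^{-ij lam} Φ^⊤ δ_i`, `j ≥ 0`, span
the square-summable series `∑_{n ≥ 0} v_n e^{-in lam}` with values in `ℂ^M`. -/
structure IsCanonicalFactor (d τ : ℕ) (M : ℕ∞) (F : Density) (φ : ℕ → ℕ → Vec)
    (Φ : ℝ → ℕ → Vec) : Prop where
  summable : Summable fun p : ℕ × ℕ => ‖φ p.1 p.2‖ ^ 2
  support : ∀ (k m : ℕ), M ≤ (m : ℕ∞) → φ k m = 0
  series : ∀ m, HasSeries (fun lam => Φ lam m) (causal fun k => φ k m)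
  factor : ∀ᵐ lam ∂band, ∀ k n,
    HasSum (fun m => Φ lam m k * star (Φ lam m n)) (entry (weighted d τ F lam) k n)
  canonical : ∀ v : ℕ → ℕ → ℂ, Summable (fun p : ℕ × ℕ => ‖v p.1 p.2‖ ^ 2) →
    (∀ (n m : ℕ), M ≤ (m : ℕ∞) → v n m = 0) →
    (∀ j i, ∑' p : ℕ × ℕ, φ p.1 p.2 i * star (v (p.1 + j) p.2) = 0) → v = 0

/-- `Ψ Θ = E_M`, `Ψ = ∑_k ψ(k) e^{-ik lam}`. `Ψ lam m` and `ψ k m` are the `m`-th rows. -/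
structure IsLeftInverse (M : ℕ∞) (Θ : ℝ → ℕ → Vec) (ψ : ℕ → ℕ → Vec) (Ψ : ℝ → ℕ → Vec) :
    Prop where
  support : ∀ (k m : ℕ), M ≤ (m : ℕ∞) → ψ k m = 0
  series : ∀ m, HasSeries (fun lam => Ψ lam m) (causal fun k => ψ k m)
  leftInv : ∀ᵐ lam ∂band, ∀ m n : ℕ,
    HasSum (fun i => Ψ lam m i * Θ lam n i) (if m = n ∧ (m : ℕ∞) < M then 1 else 0)

/-- `ψ` are the coefficients of `Ψ`, `Ψ Θ = E_M`, for a canonical factorization `Θ Θ*` of the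
weighted density `F`. -/
def InverseFactor (d τ : ℕ) (F : Density) (ψ : ℕ → ℕ → Vec) : Prop :=
  ∃ (M : ℕ∞) (θ : ℕ → ℕ → Vec) (Θ Ψ : ℝ → ℕ → Vec),
    IsCanonicalFactor d τ M F θ Θ ∧ IsLeftInverse M Θ ψ Ψ

/-- `(Φ̃ b)_l = ∑_{j ≤ l} φ^⊤(l - j) b_j`. -/
def tildeB (φ : ℕ → ℕ → Vec) (b : ℕ → Vec) (l m : ℕ) : ℂ :=
  ∑ j ∈ Finset.range (l + 1), ∑' i, φ (l - j) m i * b j i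

/-- `c(n) = (Φ̃* Φ̃ b)_n = ∑_l φ̄(l) (Φ̃ b)_{l+n}`. -/
def gramB (φ : ℕ → ℕ → Vec) (b : ℕ → Vec) (n i : ℕ) : ℂ :=
  ∑' p : ℕ × ℕ, star (φ p.1 p.2 i) * tildeB φ b (p.1 + n) p.2

/-- `(ψ̄ C)_n = ∑_j ψ̄(j) c(j + n)`. -/
def psiC (ψ : ℕ → ℕ → Vec) (c : ℕ → ℕ → ℂ) (n m : ℕ) : ℂ :=
  ∑' p : ℕ × ℕ, star (ψ p.1 m p.2) * c (p.1 + n) p.2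

/-- The squared `ℓ²` norm of a double sequence. -/
def sqSum (x : ℕ → ℕ → ℂ) : ℝ := ∑' p : ℕ × ℕ, ‖x p.1 p.2‖ ^ 2

/-- `φ` are the coefficients of a canonical factorization of the weighted density `F`, and
`Φ̃* Φ̃ b` belongs to `ℓ²`. -/
def CanonicalCoeffs (d τ : ℕ) (b : ℕ → Vec) (F : Density) (φ : ℕ → ℕ → Vec) : Prop :=
  (∃ (M : ℕ∞) (Φ : ℝ → ℕ → Vec), IsCanonicalFactor d τ M F φ Φ) ∧
    Summable fun p : ℕ × ℕ => ‖gramB φ b p.1 p.2‖ ^ 2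

/-- `h = (1 - e^{-iτlam})^d (i lam)^{-d} Ψ^⊤ ∑_m (ψ̄ C)_m e^{-im lam}`, where `C = Φ̃* Φ̃ b`. -/
def IsSignalChar (d τ : ℕ) (b : ℕ → Vec) (ψ φ : ℕ → ℕ → Vec) (h : ℝ → Vec) : Prop :=
  ∃ (Ψ : ℝ → ℕ → Vec) (e : ℝ → ℕ → ℂ),
    (∀ m, HasSeries (fun lam => Ψ lam m) (causal fun k => ψ k m)) ∧
    (∀ m, HasSeries (fun lam => e lam m) (causal fun n => psiC ψ (gramB φ b) n m)) ∧
    ∀ᵐ lam ∂band, HasSum (fun m => (beta d τ lam * e lam m) • Ψ lam m) (h lam)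

/-- `h = (1 - e^{-iτlam})^d (i lam)^{-d} (B_τ(e^{-i lam}) - Ψ^⊤ ∑_m (ψ̄ C)_m e^{-im lam})`,
where `C = Ω̃* Ω̃ b`. -/
def IsNoiseChar (d τ : ℕ) (b : ℕ → Vec) (ψ ω : ℕ → ℕ → Vec) (h : ℝ → Vec) : Prop :=
  ∃ x : ℝ → Vec, IsSignalChar d τ b ψ ω x ∧
    ∀ᵐ lam ∂band, h lam = beta d τ lam • bFun b lam - x lam

/-- The quadratic form of `A` is lower semicontinuous with respect to the one of `S`. This holds
for every bounded `A` when `S` is positive with bounded inverse. -/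
def FormLSC (A S : Vec →L[ℂ] Vec) : Prop :=
  ∀ (x : ℕ → Vec) (y : Vec) (r : ℝ), Tendsto (fun n => quad S (x n - y)) atTop (𝓝 0) →
    (∀ n, quad A (x n) ≤ r) → quad A y ≤ r

/-- Convex classes whose forms are lower semicontinuous with respect to `f⁰ + g⁰`. -/
def MinimaxRegular (Df Dg : Set Density) (f₀ g₀ : Density) : Prop :=
  Convex ℝ Df ∧ Convex ℝ Dg ∧
    (∀ f ∈ Df, ∀ᵐ lam ∂band, FormLSC (f lam) (f₀ lam + g₀ lam)) ∧
    ∀ g ∈ Dg, ∀ᵐ lam ∂band, FormLSC (g lam) (f₀ lam + g₀ lam)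

end

end PCFilter

open PCFilter

open MeasureTheory Filter Topology
open scoped ENNReal

namespace PCFilter

noncomputable section

/-! ### Vectors of `ℓ²` -/

/-! Everything reduces to the value of Δ(f, g) for one pair. The error Δ(h; f, g) is continuous in
the norm of L₂(f + g) (`mse_tendsto`), so the infimum may be taken over h = βp with p a causal
polynomial. Completing the square then gives Δ(βp; f, g) = V + r(p), where r(p) ≥ 0 is a squared
distance from p to a fixed target that causal polynomials approach; hence Δ(f, g) = V
(`optMSE_eq_ofReal`). Once V is recognized as the functional in the statement, being least
favourable and maximizing that functional are the same thing.

Operators (`optMSE_of_solution`, `filterValue_eq`). Put S = w(f + g), let S v = w f B and S u = C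
with C strictly anticausal. The equation P c = R b says that v - u has no positive frequencies. The
target is v - u, and the cross term left after completing the square is the integral of ⟨C, v - u -
p⟩, an anticausal function against a causal one. Since u and v are only integrable, neither the
vanishing of this integral nor the approximation of v - u by polynomials follows from Parseval's
identity. Both are obtained by damping with bounded causal multipliers that tend to one and make
|ω|²(1 + ρ) bounded for a given integrable ρ (`exists_multipliers`). The multipliers come from
Szegő's extremal problem: its extremal function, times the root of the weight, has constant modulus
(`exists_szego`).

Factorizations (`optMSE_of_factorization`). With S = w(f + g) = ΘΘ*, the form of S at x is ‖Θ^⊤ x‖².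
The vector w f B is represented through Θ^⊤ by a square-integrable Z, and if E is the causal part of
Z then Δ(βp; f, g) = ‖Φ̃ b‖² - ‖E‖² + ‖Θ^⊤ p - E‖². Canonicity of Θ makes the last term arbitrarily
small, and the coefficients of E are ψ̄ C. The versions with the noise density follow from the
substitution h ↦ βB - h, which exchanges f and g (`optMSE_swap`). If one density is known, the first
term is a constant.

Minimax (`mse_le_of_leastFavourable`). For (f, g) in a convex class, take polynomials nearly optimal
for (1 - ε)(f⁰, g⁰) + ε(f, g). Since (f⁰, g⁰) is least favourable, their error for (f, g) is at most
Δ(f⁰, g⁰) + ε, and by the parallelogram identity they converge to h⁰ in L₂(f⁰ + g⁰). Lower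
semicontinuity of the forms and Fatou's lemma give Δ(h⁰; f, g) ≤ Δ(f⁰, g⁰), so that h⁰ and (f⁰, g⁰)
form a saddle point.

Stochastic meaning. The covariances make the map from causal polynomials to finite combinations of
observations isometric (`inner_seqPoly`); truncating b and passing to the limit gives the errors of
all estimates. -/

lemma unitVec_apply (k n : ℕ) : unitVec k n = if n = k then 1 else 0 := by
  classical
  simp [unitVec, lp.single_apply, Pi.single_apply]

lemma inner_unitVec (k : ℕ) (x : Vec) : inner ℂ (unitVec k) x = x k := by
  rw [unitVec, lp.inner_single_left]; simp

lemma norm_unitVec (k : ℕ) : ‖unitVec k‖ = 1 := by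
  rw [unitVec, lp.norm_single (by norm_num)]; simp

lemma hasSum_unitVec (x : Vec) : HasSum (fun k => x k • unitVec k) x := by
  have h := lp.hasSum_single (E := fun _ : ℕ => ℂ) (p := 2) (by norm_num) x
  convert h using 2 with k
  rw [unitVec, ← lp.single_smul]; simp

lemma hasSum_norm_sq (x : Vec) : HasSum (fun k => ‖x k‖ ^ 2) (‖x‖ ^ 2) := by
  have h := lp.hasSum_norm (E := fun _ : ℕ => ℂ) (p := 2) (by norm_num) x
  simpa using h

lemma hasSum_inner_vec (x y : Vec) : HasSum (fun k => inner ℂ (x k) (y k)) (inner ℂ x y) :=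
  lp.hasSum_inner x y

/-! ### Quadratic forms -/

lemma exists_eq_star_mul_self {H : Type*} [NormedAddCommGroup H] [InnerProductSpace ℂ H]
    [CompleteSpace H] {A : H →L[ℂ] H} (hA : A.IsPositive) : ∃ L : H →L[ℂ] H, A = star L * L :=
  CStarAlgebra.nonneg_iff_eq_star_mul_self.1
    ((ContinuousLinearMap.nonneg_iff_isPositive A).2 hA)

/-- With A = L*L the form of A becomes ‖L x‖², so every inequality for the form of a positive
operator is an inequality for a Hilbert norm. -/
lemma exists_sq_root {A : Vec →L[ℂ] Vec} (hA : A.IsPositive) :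
    ∃ L : Vec →L[ℂ] Vec, ∀ x y, inner ℂ x (A y) = inner ℂ (L x) (L y) := by
  obtain ⟨L, hL⟩ := exists_eq_star_mul_self hA
  refine ⟨L, fun x y => ?_⟩
  rw [hL, ContinuousLinearMap.star_eq_adjoint, mul_apply_eq_comp,
    ContinuousLinearMap.adjoint_inner_right]

lemma quad_eq_norm_sq {A L : Vec →L[ℂ] Vec} (hL : ∀ x y, inner ℂ x (A y) = inner ℂ (L x) (L y))
    (x : Vec) : quad A x = ‖L x‖ ^ 2 := by
  rw [quad, hL, inner_self_eq_norm_sq_to_K]; norm_cast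

lemma quad_add_left (A B : Vec →L[ℂ] Vec) (x : Vec) : quad (A + B) x = quad A x + quad B x := by
  simp [quad]

lemma quad_smul_left (r : ℝ) (A : Vec →L[ℂ] Vec) (x : Vec) :
    quad ((r : ℂ) • A) x = r * quad A x := by
  rw [quad, smul_apply, inner_smul_right, Complex.re_ofReal_mul, quad]

lemma quad_smul_right (A : Vec →L[ℂ] Vec) (z : ℂ) (x : Vec) :
    quad A (z • x) = ‖z‖ ^ 2 * quad A x := by
  have : z * (starRingEnd ℂ z) = ((‖z‖ ^ 2 : ℝ) : ℂ) := by
    rw [Complex.mul_conj, Complex.normSq_eq_norm_sq]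
  simp only [quad, map_smul, inner_smul_left, inner_smul_right]
  rw [← mul_assoc, this, Complex.re_ofReal_mul]

lemma quad_neg_right (A : Vec →L[ℂ] Vec) (x : Vec) : quad A (-x) = quad A x := by
  simp [quad]

lemma quad_zero_right (A : Vec →L[ℂ] Vec) : quad A 0 = 0 := by simp [quad]

lemma quad_sub_comm (A : Vec →L[ℂ] Vec) (x y : Vec) : quad A (x - y) = quad A (y - x) := by
  rw [← quad_neg_right, neg_sub]

lemma quad_nonneg {A : Vec →L[ℂ] Vec} (hA : A.IsPositive) (x : Vec) : 0 ≤ quad A x := by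
  obtain ⟨L, hL⟩ := exists_sq_root hA
  rw [quad_eq_norm_sq hL]; positivity

lemma norm_inner_sq_le {A : Vec →L[ℂ] Vec} (hA : A.IsPositive) (x y : Vec) :
    ‖inner ℂ x (A y)‖ ≤ √(quad A x) * √(quad A y) := by
  obtain ⟨L, hL⟩ := exists_sq_root hA
  rw [quad_eq_norm_sq hL, quad_eq_norm_sq hL, hL, Real.sqrt_sq (norm_nonneg _),
    Real.sqrt_sq (norm_nonneg _)]
  exact norm_inner_le_norm _ _

lemma norm_inner_le_quad {A : Vec →L[ℂ] Vec} (hA : A.IsPositive) (x y : Vec) :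
    ‖inner ℂ x (A y)‖ ≤ quad A x + quad A y := by
  obtain ⟨L, hL⟩ := exists_sq_root hA
  rw [quad_eq_norm_sq hL, quad_eq_norm_sq hL, hL]
  refine (norm_inner_le_norm _ _).trans ?_
  nlinarith [sq_nonneg (‖L x‖ - ‖L y‖), sq_nonneg (‖L x‖ + ‖L y‖)]

lemma quad_add_right {A : Vec →L[ℂ] Vec} (hA : A.IsPositive) (x y : Vec) :
    quad A (x + y) = quad A x + 2 * (inner ℂ x (A y)).re + quad A y := by
  obtain ⟨L, hL⟩ := exists_sq_root hA
  rw [quad_eq_norm_sq hL, quad_eq_norm_sq hL, quad_eq_norm_sq hL, hL, map_add,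
    norm_add_sq (𝕜 := ℂ)]
  rfl

lemma quad_sub_right {A : Vec →L[ℂ] Vec} (hA : A.IsPositive) (x y : Vec) :
    quad A (x - y) = quad A x - 2 * (inner ℂ x (A y)).re + quad A y := by
  rw [sub_eq_add_neg, quad_add_right hA, quad_neg_right]; simp; ring

/-- The free parameter matters: t = 1 serves for rough bounds, and t → 0 keeps the leading constant
close to one, which yields the continuity of the error in `mse_tendsto`. -/
lemma quad_add_le {A : Vec →L[ℂ] Vec} (hA : A.IsPositive) {t : ℝ} (ht : 0 < t) (x y : Vec) :
    quad A (x + y) ≤ (1 + t) * quad A x + (1 + t⁻¹) * quad A y := by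
  obtain ⟨L, hL⟩ := exists_sq_root hA
  rw [quad_eq_norm_sq hL, quad_eq_norm_sq hL, quad_eq_norm_sq hL, map_add]
  have h1 := norm_add_le (L x) (L y)
  have h2 : ‖L x + L y‖ ^ 2 ≤ (‖L x‖ + ‖L y‖) ^ 2 := by gcongr
  have h3 : 0 ≤ t⁻¹ * (t * ‖L x‖ - ‖L y‖) ^ 2 := by positivity
  have h4 : t⁻¹ * (t * ‖L x‖ - ‖L y‖) ^ 2 =
      t * ‖L x‖ ^ 2 - 2 * ‖L x‖ * ‖L y‖ + t⁻¹ * ‖L y‖ ^ 2 := by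
    field_simp; ring
  nlinarith

lemma quad_parallelogram {A : Vec →L[ℂ] Vec} (hA : A.IsPositive) (x y : Vec) :
    quad A ((2⁻¹ : ℂ) • (x + y)) + 4⁻¹ * quad A (x - y) = 2⁻¹ * quad A x + 2⁻¹ * quad A y := by
  rw [quad_smul_right, quad_add_right hA, quad_sub_right hA]
  norm_num; ring

lemma quad_le_of_add {A B : Vec →L[ℂ] Vec} (hB : B.IsPositive) (x : Vec) :
    quad A x ≤ quad (A + B) x := by
  rw [quad_add_left]; linarith [quad_nonneg hB x]

lemma isPositive_real_smul {A : Vec →L[ℂ] Vec} (hA : A.IsPositive) {r : ℝ} (hr : 0 ≤ r) :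
    ((r : ℂ) • A).IsPositive :=
  hA.smul_of_nonneg (by exact_mod_cast hr)

lemma entry_self_re (A : Vec →L[ℂ] Vec) (k : ℕ) : (entry A k k).re = quad A (unitVec k) := rfl

/-- L x is the limit of ∑ xₖ L δₖ, and Cauchy–Schwarz on each finite sum bounds it by ‖x‖² ∑ ‖L
δₖ‖², the second factor being the trace. It replaces the operator norm by the integrable majorant
`wtr`. -/
lemma quad_le_trace {A : Vec →L[ℂ] Vec} (hA : A.IsPositive)
    (hs : Summable fun k => (entry A k k).re) (x : Vec) :
    quad A x ≤ (∑' k, (entry A k k).re) * ‖x‖ ^ 2 := by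
  obtain ⟨L, hL⟩ := exists_sq_root hA
  simp only [entry_self_re, quad_eq_norm_sq hL] at hs ⊢
  have h1 : HasSum (fun k => x k • L (unitVec k)) (L x) := by
    simpa using (hasSum_unitVec x).mapL L
  refine le_of_tendsto ((h1.norm.pow 2)) (Eventually.of_forall fun F => ?_)
  have h2 : ‖∑ k ∈ F, x k • L (unitVec k)‖ ≤ ∑ k ∈ F, ‖x k‖ * ‖L (unitVec k)‖ :=
    (norm_sum_le _ _).trans (by simp [norm_smul])
  calc ‖∑ k ∈ F, x k • L (unitVec k)‖ ^ 2 ≤ (∑ k ∈ F, ‖x k‖ * ‖L (unitVec k)‖) ^ 2 := by gcongr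
    _ ≤ (∑ k ∈ F, ‖x k‖ ^ 2) * ∑ k ∈ F, ‖L (unitVec k)‖ ^ 2 := Finset.sum_mul_sq_le_sq_mul_sq _ _ _
    _ ≤ ‖x‖ ^ 2 * ∑' k, ‖L (unitVec k)‖ ^ 2 := by
        gcongr
        · exact sum_le_hasSum _ (fun _ _ => by positivity) (hasSum_norm_sq x)
        · exact hs.sum_le_tsum _ (fun _ _ => by positivity)
    _ = _ := mul_comm _ _

/-- Cauchy–Schwarz for the form of A at the pair (A x, x) gives ‖A x‖² ≤ t ‖A x‖ ‖x‖. -/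
lemma norm_apply_le_of_quad_le {A : Vec →L[ℂ] Vec} (hA : A.IsPositive) {t : ℝ} (ht : 0 ≤ t)
    (h : ∀ x, quad A x ≤ t * ‖x‖ ^ 2) (x : Vec) : ‖A x‖ ≤ t * ‖x‖ := by
  have h1 := norm_inner_sq_le hA (A x) x
  rw [inner_self_eq_norm_sq_to_K] at h1
  have h2 : ∀ y, √(quad A y) ≤ √t * ‖y‖ := fun y => by
    rw [← Real.sqrt_sq (norm_nonneg y), ← Real.sqrt_mul ht]
    exact Real.sqrt_le_sqrt (by simpa using h y)
  have h3 : ‖A x‖ ^ 2 ≤ t * (‖A x‖ * ‖x‖) := by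
    have h4 := h1.trans (mul_le_mul (h2 _) (h2 _) (Real.sqrt_nonneg _) (by positivity))
    have h5 : √t * √t = t := Real.mul_self_sqrt ht
    simp at h4
    calc ‖A x‖ ^ 2 ≤ √t * ‖A x‖ * (√t * ‖x‖) := h4
      _ = (√t * √t) * (‖A x‖ * ‖x‖) := by ring
      _ = _ := by rw [h5]
  rcases eq_or_ne (‖A x‖) 0 with h0 | h0
  · rw [h0]; positivity
  · have : 0 < ‖A x‖ := by positivity
    nlinarith

/-! ### Weights -/

lemma norm_sq_beta (d τ : ℕ) (lam : ℝ) : ‖beta d τ lam‖ ^ 2 = weight d τ lam := by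
  have h1 : ‖1 - Complex.exp (-(Complex.I * τ * lam))‖ = ‖1 - Complex.exp (Complex.I * τ * lam)‖ := by
    rw [← Complex.norm_conj (1 - Complex.exp (Complex.I * τ * lam)), map_sub, ← Complex.exp_conj]
    simp
  have h2 : |lam| ^ (2 * d) = lam ^ (2 * d) := by rw [pow_mul, pow_mul, sq_abs]
  rw [beta, weight, norm_div, norm_pow, norm_pow, norm_mul, h1, div_pow, ← pow_mul, ← pow_mul,
    Complex.norm_I, one_mul, Complex.norm_real, Real.norm_eq_abs, mul_comm d 2, h2]

lemma weight_nonneg (d τ : ℕ) (lam : ℝ) : 0 ≤ weight d τ lam := by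
  rw [← norm_sq_beta]; positivity

lemma measurable_beta (d τ : ℕ) : Measurable (beta d τ) := by
  unfold beta; fun_prop

lemma measurable_weight (d τ : ℕ) : Measurable (weight d τ) := by
  unfold weight; fun_prop

lemma quad_beta_smul (d τ : ℕ) (f : Density) (lam : ℝ) (x : Vec) :
    quad (f lam) (beta d τ lam • x) = quad (weighted d τ f lam) x := by
  rw [weighted, quad_smul_left, quad_smul_right, norm_sq_beta]

lemma weighted_add (d τ : ℕ) (f g : Density) (lam : ℝ) :
    weighted d τ (f + g) lam = weighted d τ f lam + weighted d τ g lam := by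
  simp [weighted]

/-- Zeros of the numerator need τ·lam ∈ 2πℤ; the origin is excluded separately because the quotient
by zero is zero there. These points are countably many. The lemma permits division by β in the
explicit formulas for h. -/
lemma ae_beta_ne_zero (d τ : ℕ) (hτ : 0 < τ) : ∀ᵐ lam ∂band, beta d τ lam ≠ 0 := by
  have hc : ((Set.range fun n : ℤ => -(2 * Real.pi * n / τ)) ∪ {0} : Set ℝ).Countable :=
    (Set.countable_range _).union (Set.countable_singleton _)
  have h : ∀ᵐ lam ∂band, lam ∉ (Set.range fun n : ℤ => -(2 * Real.pi * n / τ)) ∪ {(0 : ℝ)} :=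
    ae_restrict_of_ae (measure_eq_zero_iff_ae_notMem.1 (hc.measure_zero volume))
  filter_upwards [h] with lam hlam h0
  have h0 : (1 - Complex.exp (-(Complex.I * τ * lam))) = 0 ∨ (lam : ℂ) = 0 := by
    rcases div_eq_zero_iff.1 h0 with h0 | h0
    · exact Or.inl (eq_zero_of_pow_eq_zero h0)
    · exact Or.inr (by simpa using eq_zero_of_pow_eq_zero h0)
  rcases h0 with h0 | h0
  · apply hlam
    left
    obtain ⟨n, hn⟩ := Complex.exp_eq_one_iff.1 (sub_eq_zero.1 h0).symm
    refine ⟨n, ?_⟩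
    have hn' : -(τ * lam : ℝ) = n * (2 * Real.pi) := by
      have : -((τ * lam : ℝ) : ℂ) * Complex.I = ((n * (2 * Real.pi) : ℝ) : ℂ) * Complex.I := by
        push_cast; linear_combination hn
      exact_mod_cast mul_right_cancel₀ Complex.I_ne_zero this
    have hτ' : (τ : ℝ) ≠ 0 := by positivity
    field_simp
    linarith
  · exact hlam (Or.inr (by exact_mod_cast h0))

instance : IsFiniteMeasure band := by unfold band; infer_instance

/-! ### Spectral densities -/

lemma aesm_vec_of_coord {u : ℝ → Vec} {μ : Measure ℝ}
    (h : ∀ k, AEStronglyMeasurable (fun lam => u lam k) μ) : AEStronglyMeasurable u μ := by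
  refine aestronglyMeasurable_of_tendsto_ae atTop
    (f := fun (N : ℕ) lam => ∑ k ∈ Finset.range N, u lam k • unitVec k) (fun N => ?_) ?_
  · exact Finset.aestronglyMeasurable_fun_sum _ fun k _ => (h k).smul_const _
  · exact Eventually.of_forall fun lam => (hasSum_unitVec (u lam)).tendsto_sum_nat

lemma aesm_coord {u : ℝ → Vec} {μ : Measure ℝ} (h : AEStronglyMeasurable u μ) (k : ℕ) :
    AEStronglyMeasurable (fun lam => u lam k) μ := by
  simp_rw [← inner_unitVec]
  exact aestronglyMeasurable_const.inner h

/-- A density is assumed measurable only on fixed vectors, so a variable vector is expanded in the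
basis δₖ first. -/
lemma aesm_apply {f : Density} {u : ℝ → Vec}
    (hf : ∀ x : Vec, AEStronglyMeasurable (fun lam => f lam x) band)
    (hu : AEStronglyMeasurable u band) : AEStronglyMeasurable (fun lam => f lam (u lam)) band := by
  refine aestronglyMeasurable_of_tendsto_ae atTop
    (f := fun (N : ℕ) lam => ∑ k ∈ Finset.range N, u lam k • f lam (unitVec k)) (fun N => ?_) ?_
  · exact Finset.aestronglyMeasurable_fun_sum _ fun k _ => (aesm_coord hu k).smul (hf _)
  · refine Eventually.of_forall fun lam => ?_
    simpa using ((hasSum_unitVec (u lam)).mapL (f lam)).tendsto_sum_nat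

lemma aesm_quad {f : Density} {u : ℝ → Vec}
    (hf : ∀ x : Vec, AEStronglyMeasurable (fun lam => f lam x) band)
    (hu : AEStronglyMeasurable u band) :
    AEStronglyMeasurable (fun lam => quad (f lam) (u lam)) band :=
  (Complex.continuous_re.comp_aestronglyMeasurable (hu.inner (aesm_apply hf hu)))

lemma IsSpectralDensity.measurable_weighted {d τ : ℕ} {f : Density} (hf : IsSpectralDensity d τ f)
    (x : Vec) : AEStronglyMeasurable (fun lam => weighted d τ f lam x) band :=
  AEStronglyMeasurable.smul (f := fun lam => (weight d τ lam : ℂ))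
    (Complex.measurable_ofReal.comp (measurable_weight d τ)).aestronglyMeasurable (hf.measurable x)

lemma IsSpectralDensity.positive_weighted {d τ : ℕ} {f : Density} (hf : IsSpectralDensity d τ f) :
    ∀ᵐ lam ∂band, (weighted d τ f lam).IsPositive := by
  filter_upwards [hf.positive] with lam h using isPositive_real_smul h (weight_nonneg d τ lam)

/-- The trace of the weighted density. -/
def wtr (d τ : ℕ) (f : Density) (lam : ℝ) : ℝ :=
  (∑' k, ENNReal.ofReal (weight d τ lam * (entry (f lam) k k).re)).toReal

lemma wtr_nonneg (d τ : ℕ) (f : Density) (lam : ℝ) : 0 ≤ wtr d τ f lam := ENNReal.toReal_nonneg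

lemma IsSpectralDensity.aemeasurable_diag {d τ : ℕ} {f : Density} (hf : IsSpectralDensity d τ f)
    (k : ℕ) :
    AEMeasurable (fun lam => ENNReal.ofReal (weight d τ lam * (entry (f lam) k k).re)) band := by
  refine ENNReal.measurable_ofReal.comp_aemeasurable ?_
  refine (measurable_weight d τ).aemeasurable.mul ?_
  exact (aesm_quad hf.measurable (u := fun _ => unitVec k) aestronglyMeasurable_const).aemeasurable

lemma IsSpectralDensity.integrable_wtr {d τ : ℕ} {f : Density} (hf : IsSpectralDensity d τ f) :
    Integrable (wtr d τ f) band :=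
  integrable_toReal_of_lintegral_ne_top (AEMeasurable.tsum hf.aemeasurable_diag)
    hf.trace.ne

lemma IsSpectralDensity.hasSum_wtr {d τ : ℕ} {f : Density} (hf : IsSpectralDensity d τ f) :
    ∀ᵐ lam ∂band, HasSum (fun k => (entry (weighted d τ f lam) k k).re) (wtr d τ f lam) := by
  filter_upwards [hf.positive_weighted,
    ae_lt_top' (AEMeasurable.tsum hf.aemeasurable_diag) hf.trace.ne] with lam h1 h2
  have h3 : ∀ k, (entry (weighted d τ f lam) k k).re = weight d τ lam * (entry (f lam) k k).re :=
    fun k => quad_smul_left _ _ _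
  have h4 : ∀ k, 0 ≤ weight d τ lam * (entry (f lam) k k).re := fun k => by
    rw [← h3]; exact quad_nonneg h1 _
  have h5 := ENNReal.hasSum_toReal h2.ne
  simp only [ENNReal.toReal_ofReal (h4 _)] at h5
  simpa only [h3, wtr, ENNReal.tsum_toReal_eq (fun _ => ENNReal.ofReal_ne_top),
    ENNReal.toReal_ofReal (h4 _)] using h5

lemma IsSpectralDensity.quad_le {d τ : ℕ} {f : Density} (hf : IsSpectralDensity d τ f) :
    ∀ᵐ lam ∂band, ∀ x, quad (weighted d τ f lam) x ≤ wtr d τ f lam * ‖x‖ ^ 2 := by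
  filter_upwards [hf.positive_weighted, hf.hasSum_wtr] with lam h1 h2 x
  rw [← h2.tsum_eq]
  exact quad_le_trace h1 h2.summable x

lemma IsSpectralDensity.norm_apply_le {d τ : ℕ} {f : Density} (hf : IsSpectralDensity d τ f) :
    ∀ᵐ lam ∂band, ∀ x, ‖weighted d τ f lam x‖ ≤ wtr d τ f lam * ‖x‖ := by
  filter_upwards [hf.positive_weighted, hf.quad_le] with lam h1 h2 x
  exact norm_apply_le_of_quad_le h1 (wtr_nonneg _ _ _ _) h2 x

lemma IsSpectralDensity.add {d τ : ℕ} {f g : Density} (hf : IsSpectralDensity d τ f)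
    (hg : IsSpectralDensity d τ g) : IsSpectralDensity d τ (f + g) where
  measurable x := (hf.measurable x).add (hg.measurable x)
  positive := by
    filter_upwards [hf.positive, hg.positive] with lam h1 h2 using h1.add h2
  trace := by
    have h : ∫⁻ lam, ((∑' k, ENNReal.ofReal (weight d τ lam * (entry (f lam) k k).re)) +
        ∑' k, ENNReal.ofReal (weight d τ lam * (entry (g lam) k k).re)) ∂band < ∞ := by
      rw [lintegral_add_left' (AEMeasurable.tsum hf.aemeasurable_diag)]
      exact ENNReal.add_lt_top.2 ⟨hf.trace, hg.trace⟩
    refine (lintegral_mono fun lam => ?_).trans_lt h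
    rw [← ENNReal.tsum_add]
    refine ENNReal.tsum_le_tsum fun k => ?_
    have : (entry ((f + g) lam) k k).re = (entry (f lam) k k).re + (entry (g lam) k k).re :=
      quad_add_left _ _ _
    rw [this, mul_add]
    exact ENNReal.ofReal_add_le

/-! ### Fourier series on the frequency band -/

/-- The exponential `e^{-in lam}`. -/
def ee (n : ℤ) (lam : ℝ) : ℂ := Complex.exp (-(Complex.I * n * lam))

lemma norm_ee (n : ℤ) (lam : ℝ) : ‖ee n lam‖ = 1 := by
  have : -(Complex.I * n * lam) = ((-(n * lam) : ℝ) : ℂ) * Complex.I := by push_cast; ring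
  rw [ee, this, Complex.norm_exp_ofReal_mul_I]

lemma ee_add (m n : ℤ) (lam : ℝ) : ee (m + n) lam = ee m lam * ee n lam := by
  rw [ee, ee, ee, ← Complex.exp_add]; congr 1; push_cast; ring

lemma ee_zero (lam : ℝ) : ee 0 lam = 1 := by simp [ee]

lemma conj_ee (n : ℤ) (lam : ℝ) : starRingEnd ℂ (ee n lam) = ee (-n) lam := by
  rw [ee, ee, ← Complex.exp_conj]; congr 1; simp

lemma continuous_ee (n : ℤ) : Continuous (ee n) := by unfold ee; fun_prop

lemma integral_ee (n : ℤ) : ∫ lam, ee n lam ∂band = if n = 0 then (2 * Real.pi : ℂ) else 0 := by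
  rw [band, restrict_Ico_eq_restrict_Ioc,
    ← intervalIntegral.integral_of_le (by linarith [Real.pi_pos])]
  split_ifs with hn
  · subst hn
    simp [ee_zero]; ring
  · have h : ∀ lam : ℝ, ee n lam = Complex.exp ((-(Complex.I * n)) * lam) := fun lam => by
      rw [ee]; congr 1; ring
    simp_rw [h]
    rw [integral_exp_mul_complex (by simp [hn])]
    have : Complex.exp (-(Complex.I * n) * (Real.pi : ℝ)) =
        Complex.exp (-(Complex.I * n) * ((-Real.pi : ℝ) : ℂ)) := by
      rw [Complex.exp_eq_exp_iff_exists_int]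
      exact ⟨-n, by push_cast; ring⟩
    rw [this, sub_self, zero_div]

section Banach

variable {E : Type} [NormedAddCommGroup E] [NormedSpace ℂ E]

lemma integrable_ee_smul {u : ℝ → E} (hu : Integrable u band) (n : ℤ) :
    Integrable (fun lam => ee n lam • u lam) band := by
  refine Integrable.mono hu ((continuous_ee n).aestronglyMeasurable.smul hu.1) ?_
  exact Eventually.of_forall fun lam => by simp [norm_smul, norm_ee]

lemma fourierCo_eq (u : ℝ → E) (n : ℤ) :
    fourierCo u n = (1 / (2 * Real.pi) : ℂ) • ∫ lam, ee n lam • u lam ∂band := rfl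

lemma fourierCo_congr {u v : ℝ → E} (h : u =ᵐ[band] v) (n : ℤ) :
    fourierCo u n = fourierCo v n := by
  rw [fourierCo_eq, fourierCo_eq]
  congr 1
  refine integral_congr_ae ?_
  filter_upwards [h] with lam h
  rw [h]

lemma fourierCo_add {u v : ℝ → E} (hu : Integrable u band) (hv : Integrable v band) (n : ℤ) :
    fourierCo (fun lam => u lam + v lam) n = fourierCo u n + fourierCo v n := by
  simp_rw [fourierCo_eq, smul_add]
  rw [integral_add (integrable_ee_smul hu n) (integrable_ee_smul hv n), smul_add]

lemma fourierCo_sub {u v : ℝ → E} (hu : Integrable u band) (hv : Integrable v band) (n : ℤ) :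
    fourierCo (fun lam => u lam - v lam) n = fourierCo u n - fourierCo v n := by
  simp_rw [fourierCo_eq, smul_sub]
  rw [integral_sub (integrable_ee_smul hu n) (integrable_ee_smul hv n), smul_sub]

lemma fourierCo_smul (z : ℂ) (u : ℝ → E) (n : ℤ) :
    fourierCo (fun lam => z • u lam) n = z • fourierCo u n := by
  simp_rw [fourierCo_eq, smul_comm _ z]
  rw [integral_smul, smul_comm]

lemma fourierCo_ee_smul (u : ℝ → E) (k n : ℤ) :
    fourierCo (fun lam => ee k lam • u lam) n = fourierCo u (n + k) := by
  simp_rw [fourierCo_eq, smul_smul, ← ee_add]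

lemma fourierCo_ee_smul_const [CompleteSpace E] (k n : ℤ) (x : E) :
    fourierCo (fun lam => ee k lam • x) n = if n = -k then x else 0 := by
  simp_rw [fourierCo_eq, smul_smul, ← ee_add]
  rw [integral_smul_const, integral_ee]
  have : n + k = 0 ↔ n = -k := by omega
  simp only [this]
  split_ifs
  · rw [smul_smul, one_div, inv_mul_cancel₀ (by simp [Real.pi_ne_zero]), one_smul]
  · simp

lemma fourierCo_map [CompleteSpace E] {F : Type} [NormedAddCommGroup F] [NormedSpace ℂ F]
    [CompleteSpace F]
    (L : E →L[ℂ] F) {u : ℝ → E} (hu : Integrable u band) (n : ℤ) :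
    fourierCo (fun lam => L (u lam)) n = L (fourierCo u n) := by
  rw [fourierCo_eq, fourierCo_eq, map_smul, ← L.integral_comp_comm (integrable_ee_smul hu n)]
  simp

/-- Uniqueness of Fourier coefficients for functions that are merely integrable and Banach-valued.
The functional G ↦ ∫ G u is continuous on C(circle) and kills the exponentials, hence it vanishes by
density of their span. Test functions supported in (-π, π) extend periodically, so u = 0 almost
everywhere. -/
lemma ae_eq_zero_of_fourierCo [CompleteSpace E] {u : ℝ → E} (hu : Integrable u band)
    (h : ∀ n, fourierCo u n = 0) : u =ᵐ[band] 0 := by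
  have hp : Fact (0 < 2 * Real.pi) := ⟨by positivity⟩
  have h0 : ∀ n, ∫ lam, ee n lam • u lam ∂band = 0 := fun n => by
    have := h n
    rw [fourierCo_eq, smul_eq_zero] at this
    exact this.resolve_left (by simp [Real.pi_ne_zero])
  have hint : ∀ G : C(AddCircle (2 * Real.pi), ℂ),
      Integrable (fun lam : ℝ => G (lam : AddCircle (2 * Real.pi)) • u lam) band := fun G => by
    refine Integrable.bdd_smul hu ‖G‖ ?_ (Eventually.of_forall fun lam => G.norm_coe_le_norm _)
    exact (G.continuous.comp (AddCircle.continuous_mk' _)).aestronglyMeasurable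
  let Λ : C(AddCircle (2 * Real.pi), ℂ) →L[ℂ] E := LinearMap.mkContinuous
    { toFun := fun G => ∫ lam : ℝ, G (lam : AddCircle (2 * Real.pi)) • u lam ∂band
      map_add' := fun G G' => by
        simp_rw [ContinuousMap.add_apply, add_smul]
        exact integral_add (hint G) (hint G')
      map_smul' := fun c G => by
        simp_rw [ContinuousMap.smul_apply, smul_assoc]
        exact integral_smul c _ } (∫ lam, ‖u lam‖ ∂band) fun G => by
      refine (norm_integral_le_integral_norm _).trans ?_
      rw [mul_comm (∫ lam, ‖u lam‖ ∂band) ‖G‖, ← integral_const_mul]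
      refine integral_mono (hint G).norm (hu.norm.const_mul _) fun lam => ?_
      simp only [norm_smul]
      gcongr
      exact G.norm_coe_le_norm _
  have hΛ : ∀ G, Λ G = ∫ lam : ℝ, G (lam : AddCircle (2 * Real.pi)) • u lam ∂band := fun G => rfl
  have hker : (⊤ : Submodule ℂ C(AddCircle (2 * Real.pi), ℂ)) ≤ Λ.ker := by
    rw [← span_fourier_closure_eq_top]
    refine Submodule.topologicalClosure_minimal _ ?_ Λ.isClosed_ker
    rw [Submodule.span_le]
    rintro _ ⟨n, rfl⟩
    rw [SetLike.mem_coe, LinearMap.mem_ker]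
    change Λ _ = 0
    -- On the circle of length 2π the monomial `fourier n` is e^{in lam} = `ee (-n)`; hence the
    -- change of sign.
    rw [hΛ, ← h0 (-n)]
    refine integral_congr_ae (Eventually.of_forall fun lam => ?_)
    simp only [fourier_coe_apply, ee]
    congr 2
    push_cast
    field_simp
    try ring
  have hz : ∀ᵐ lam ∂band, lam ∈ Set.Ioo (-Real.pi) Real.pi → u lam = 0 := by
    refine isOpen_Ioo.ae_eq_zero_of_integral_contDiff_smul_eq_zero
      (hu.locallyIntegrable.locallyIntegrableOn _) fun g hg _ hgs => ?_
    have hg1 : ∀ x, x ∉ Set.Ioo (-Real.pi) Real.pi → g x = 0 := fun x hx =>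
      image_eq_zero_of_notMem_tsupport fun h => hx (hgs h)
    -- Periodic extension keeps g continuous because g vanishes at both ends of the interval.
    have hgc : Continuous (AddCircle.liftIco (2 * Real.pi) (-Real.pi) fun x => (g x : ℂ)) := by
      refine AddCircle.liftIco_continuous ?_
        (Complex.continuous_ofReal.comp hg.continuous).continuousOn
      rw [hg1 _ (by simp), hg1 _ (by simp [show -Real.pi + 2 * Real.pi = Real.pi by ring])]
    have h1 : Λ ⟨_, hgc⟩ = 0 := hker (Submodule.mem_top)
    rw [hΛ] at h1
    rw [← h1, band]
    refine setIntegral_congr_fun measurableSet_Ico fun lam hlam => ?_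
    simp only [ContinuousMap.coe_mk]
    rw [AddCircle.liftIco_coe_apply (by
      constructor
      · exact hlam.1
      · linarith [hlam.2]), Complex.coe_smul]
  have hmem : ∀ᵐ lam ∂band, lam ∈ Set.Ioo (-Real.pi) Real.pi := by
    rw [band, ← restrict_Ioo_eq_restrict_Ico]
    exact ae_restrict_mem measurableSet_Ioo
  filter_upwards [hz, hmem] with lam h1 h2 using h1 h2

lemma HasSeries.integrable {u : ℝ → E} {a : ℤ → E} (h : HasSeries u a) : Integrable u band :=
  h.1.integrable (by norm_num)

lemma HasSeries.ae_eq [CompleteSpace E] {u v : ℝ → E} {a : ℤ → E} (hu : HasSeries u a)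
    (hv : HasSeries v a) : u =ᵐ[band] v := by
  have := ae_eq_zero_of_fourierCo (hu.integrable.sub hv.integrable) fun n => by
    have := fourierCo_sub hu.integrable hv.integrable n
    rw [hu.2, hv.2, sub_self] at this
    exact this
  filter_upwards [this] with lam h using sub_eq_zero.1 h

lemma HasSeries.congr {u v : ℝ → E} {a : ℤ → E} (hu : HasSeries u a) (h : u =ᵐ[band] v) :
    HasSeries v a :=
  ⟨(memLp_congr_ae h).1 hu.1, fun n => by rw [← fourierCo_congr h, hu.2]⟩

lemma HasSeries.add {u v : ℝ → E} {a c : ℤ → E} (hu : HasSeries u a) (hv : HasSeries v c) :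
    HasSeries (fun lam => u lam + v lam) (fun n => a n + c n) :=
  ⟨hu.1.add hv.1, fun n => by rw [fourierCo_add hu.integrable hv.integrable, hu.2, hv.2]⟩

lemma HasSeries.sub {u v : ℝ → E} {a c : ℤ → E} (hu : HasSeries u a) (hv : HasSeries v c) :
    HasSeries (fun lam => u lam - v lam) (fun n => a n - c n) :=
  ⟨hu.1.sub hv.1, fun n => by rw [fourierCo_sub hu.integrable hv.integrable, hu.2, hv.2]⟩

lemma HasSeries.smul {u : ℝ → E} {a : ℤ → E} (hu : HasSeries u a) (z : ℂ) :
    HasSeries (fun lam => z • u lam) (fun n => z • a n) :=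
  ⟨hu.1.const_smul z, fun n => by rw [fourierCo_smul, hu.2]⟩

lemma HasSeries.ee_smul {u : ℝ → E} {a : ℤ → E} (hu : HasSeries u a) (k : ℤ) :
    HasSeries (fun lam => ee k lam • u lam) (fun n => a (n + k)) := by
  refine ⟨?_, fun n => by rw [fourierCo_ee_smul, hu.2]⟩
  refine hu.1.of_le ((continuous_ee k).aestronglyMeasurable.smul hu.1.1) ?_
  exact Eventually.of_forall fun lam => by simp [norm_smul, norm_ee]

lemma HasSeries.map [CompleteSpace E] {F : Type} [NormedAddCommGroup F] [NormedSpace ℂ F]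
    [CompleteSpace F] {u : ℝ → E} {a : ℤ → E} (hu : HasSeries u a) (L : E →L[ℂ] F) :
    HasSeries (fun lam => L (u lam)) (fun n => L (a n)) :=
  ⟨L.comp_memLp' hu.1, fun n => by rw [fourierCo_map L hu.integrable, hu.2]⟩

lemma hasSeries_ee_smul_const [CompleteSpace E] (k : ℤ) (x : E) :
    HasSeries (fun lam => ee k lam • x) (fun n => if n = -k then x else 0) := by
  refine ⟨?_, fun n => fourierCo_ee_smul_const k n x⟩
  refine MemLp.of_bound ((continuous_ee k).aestronglyMeasurable.smul_const x) ‖x‖ ?_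
  exact Eventually.of_forall fun lam => by simp [norm_smul, norm_ee]

end Banach

/-! ### Fourier series in L²: Parseval's identity and the Riesz–Fischer theorem. -/

section Hilbert

variable {E : Type} [NormedAddCommGroup E] [InnerProductSpace ℂ E] [CompleteSpace E]

lemma memLp_ee (n : ℤ) (x : E) :
    MemLp (fun lam => ((1 / √(2 * Real.pi) : ℝ) : ℂ) • ee (-n) lam • x) 2 band :=
  (hasSeries_ee_smul_const (-n) x).1.const_smul _

lemma inner_toLp_ee (n : ℤ) (x : E) (U : Lp E 2 band) :
    inner ℂ ((memLp_ee n x).toLp _) U = inner ℂ x ((√(2 * Real.pi) : ℂ) • fourierCo U n) := by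
  have hU : Integrable U band := (Lp.memLp U).integrable (by norm_num)
  rw [L2.inner_def]
  have h1 : ∫ lam, inner ℂ ((memLp_ee n x).toLp _ lam) (U lam) ∂band =
      ∫ lam, ((1 / √(2 * Real.pi) : ℝ) : ℂ) * inner ℂ x (ee n lam • U lam) ∂band := by
    refine integral_congr_ae ?_
    filter_upwards [(memLp_ee n x).coeFn_toLp] with lam h
    rw [h, inner_smul_left, inner_smul_left, inner_smul_right, Complex.conj_ofReal, conj_ee,
      neg_neg]
  rw [h1, integral_const_mul, integral_inner (integrable_ee_smul hU n), fourierCo_eq,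
    inner_smul_right, inner_smul_right, ← mul_assoc]
  congr 1
  have h2 : ((√(2 * Real.pi) : ℝ) : ℂ) * ((√(2 * Real.pi) : ℝ) : ℂ) = 2 * Real.pi := by
    rw [← Complex.ofReal_mul, Real.mul_self_sqrt (by positivity)]; push_cast; rfl
  have h3 : ((√(2 * Real.pi) : ℝ) : ℂ) ≠ 0 := by
    rw [Complex.ofReal_ne_zero]; positivity
  rw [← h2]
  push_cast
  field_simp

lemma inner_toLp_ee_ee (m n : ℤ) (x y : E) :
    inner ℂ ((memLp_ee m x).toLp _) ((memLp_ee n y).toLp _) = if m = n then inner ℂ x y else 0 := by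
  rw [inner_toLp_ee, fourierCo_congr (memLp_ee n y).coeFn_toLp, fourierCo_smul,
    fourierCo_ee_smul_const, neg_neg, smul_smul]
  have h3 : √(2 * Real.pi) ≠ 0 := by positivity
  rw [← Complex.ofReal_mul, mul_one_div_cancel h3, Complex.ofReal_one, one_smul]
  split_ifs <;> simp

/-- The isometry `x ↦ (2π)^{-1/2} e^{in lam} x`. -/
def eeIsometry (E : Type) [NormedAddCommGroup E] [InnerProductSpace ℂ E] [CompleteSpace E] (n : ℤ) :
    E →ₗᵢ[ℂ] Lp E 2 band :=
  LinearMap.isometryOfInner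
    { toFun := fun x => (memLp_ee n x).toLp _
      map_add' := fun x y => by
        rw [← MemLp.toLp_add]
        congr 1
        ext lam
        simp
      map_smul' := fun z x => by
        rw [RingHom.id_apply, ← MemLp.toLp_const_smul]
        congr 1
        ext lam
        simp only [Pi.smul_apply]
        rw [smul_comm (ee (-n) lam) z, smul_comm _ z] }
    fun x y => by simpa using inner_toLp_ee_ee n n x y

/-- Completeness is the uniqueness theorem again: a function orthogonal to every e^{in lam} x has
zero Fourier coefficients. -/
lemma isHilbertSum_ee (E : Type) [NormedAddCommGroup E] [InnerProductSpace ℂ E] [CompleteSpace E] :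
    IsHilbertSum ℂ (fun _ : ℤ => E) (eeIsometry E) := by
  refine IsHilbertSum.mk (fun m n hmn x y => ?_) ?_
  · rw [show inner ℂ (eeIsometry E m x) (eeIsometry E n y) = _ from inner_toLp_ee_ee m n x y,
      if_neg hmn]
  · rw [top_le_iff, Submodule.topologicalClosure_eq_top_iff, Submodule.eq_bot_iff]
    intro U hU
    rw [Submodule.mem_orthogonal] at hU
    have h0 : ∀ n, fourierCo U n = 0 := fun n => by
      have h1 := hU _ (Submodule.mem_iSup_of_mem n ⟨fourierCo U n, rfl⟩)
      have h2 : inner ℂ (fourierCo U n) ((√(2 * Real.pi) : ℂ) • fourierCo U n) = 0 := by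
        rw [← inner_toLp_ee]; exact h1
      rw [inner_smul_right, mul_eq_zero] at h2
      exact inner_self_eq_zero.1 (h2.resolve_left (by
        rw [← ne_eq, Complex.ofReal_ne_zero]; positivity))
    rw [Lp.eq_zero_iff_ae_eq_zero]
    exact ae_eq_zero_of_fourierCo ((Lp.memLp U).integrable (by norm_num)) h0

/-- The isomorphism between square-integrable functions and their Fourier coefficients. -/
def fourierEquiv (E : Type) [NormedAddCommGroup E] [InnerProductSpace ℂ E] [CompleteSpace E] :
    Lp E 2 band ≃ₗᵢ[ℂ] lp (fun _ : ℤ => E) 2 :=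
  (isHilbertSum_ee E).linearIsometryEquiv

/-- The Hilbert sum uses the unit functions (2π)^{-1/2} e^{in lam}, whereas `fourierCo` divides by
2π; the factor √(2π) reconciles the two normalizations. -/
lemma fourierEquiv_apply (U : Lp E 2 band) (n : ℤ) :
    fourierEquiv E U n = (√(2 * Real.pi) : ℂ) • fourierCo U n := by
  classical
  refine ext_inner_left ℂ fun x => ?_
  have h1 : inner ℂ x (fourierEquiv E U n) = inner ℂ (lp.single 2 n x) (fourierEquiv E U) :=
    (lp.inner_single_left (G := fun _ : ℤ => E) n x _).symm
  rw [← inner_toLp_ee, h1]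
  have h : (fourierEquiv E).symm (lp.single 2 n x) = (memLp_ee n x).toLp _ :=
    (isHilbertSum_ee E).linearIsometryEquiv_symm_apply_single x
  rw [← h, ← LinearIsometryEquiv.inner_map_map (fourierEquiv E),
    LinearIsometryEquiv.apply_symm_apply]

/-- Parseval's identity. -/
lemma HasSeries.hasSum_inner {u v : ℝ → E} {a c : ℤ → E} (hu : HasSeries u a)
    (hv : HasSeries v c) : HasSum (fun n => inner ℂ (a n) (c n))
      ((1 / (2 * Real.pi) : ℂ) * ∫ lam, inner ℂ (u lam) (v lam) ∂band) := by
  have h1 := lp.hasSum_inner (𝕜 := ℂ) (fourierEquiv E (hu.1.toLp u)) (fourierEquiv E (hv.1.toLp v))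
  simp only [fourierEquiv_apply, fourierCo_congr hu.1.coeFn_toLp, fourierCo_congr hv.1.coeFn_toLp,
    hu.2, hv.2, inner_smul_left, inner_smul_right, Complex.conj_ofReal, ← mul_assoc,
    LinearIsometryEquiv.inner_map_map, L2.inner_def] at h1
  have h2 : ((√(2 * Real.pi) : ℝ) : ℂ) * ((√(2 * Real.pi) : ℝ) : ℂ) = 2 * Real.pi := by
    rw [← Complex.ofReal_mul, Real.mul_self_sqrt (by positivity)]; push_cast; rfl
  rw [h2] at h1
  have h3 : ∫ lam, inner ℂ (hu.1.toLp u lam) (hv.1.toLp v lam) ∂band =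
      ∫ lam, inner ℂ (u lam) (v lam) ∂band := by
    refine integral_congr_ae ?_
    filter_upwards [hu.1.coeFn_toLp, hv.1.coeFn_toLp] with lam h h'
    rw [h, h']
  rw [h3] at h1
  have h4 := h1.mul_left (1 / (2 * Real.pi) : ℂ)
  have h5 : (1 / (2 * Real.pi) : ℂ) * (2 * Real.pi) = 1 :=
    one_div_mul_cancel (by simp [Real.pi_ne_zero])
  simpa only [← mul_assoc, h5, one_mul] using h4

lemma HasSeries.hasSum_norm_sq {u : ℝ → E} {a : ℤ → E} (hu : HasSeries u a) :
    HasSum (fun n => ‖a n‖ ^ 2) (1 / (2 * Real.pi) * ∫ lam, ‖u lam‖ ^ 2 ∂band) := by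
  have h := hu.hasSum_inner hu
  simp only [inner_self_eq_norm_sq_to_K] at h
  have h2 := Complex.hasSum_re h
  convert h2 using 1
  · ext n; norm_cast
  · have : ∫ lam, ((‖u lam‖ : ℂ)) ^ 2 ∂band = ((∫ lam, ‖u lam‖ ^ 2 ∂band : ℝ) : ℂ) := by
      rw [← integral_complex_ofReal]; push_cast; rfl
    change _ = (_ * ∫ lam, ((‖u lam‖ : ℂ)) ^ 2 ∂band).re
    rw [this]
    norm_cast

/-- The Riesz–Fischer theorem. -/
lemma exists_hasSeries {a : ℤ → E} (ha : Summable fun n => ‖a n‖ ^ 2) :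
    ∃ u : ℝ → E, HasSeries u a := by
  have hm : Memℓp (fun n => (√(2 * Real.pi) : ℂ) • a n) 2 := by
    refine (memℓp_gen ?_).const_smul _
    simpa using ha
  let U := (fourierEquiv E).symm ⟨_, hm⟩
  refine ⟨U, Lp.memLp U, fun n => ?_⟩
  have h1 : fourierEquiv E U n = (√(2 * Real.pi) : ℂ) • a n := by
    simp only [U, LinearIsometryEquiv.apply_symm_apply]
  rw [fourierEquiv_apply] at h1
  exact smul_right_injective _ (by rw [Complex.ofReal_ne_zero]; positivity) h1

end Hilbert

/-! ### Causal multipliers with a prescribed modulus -/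

lemma norm_sq_Lp {E : Type} [NormedAddCommGroup E] [InnerProductSpace ℂ E] (U : Lp E 2 band) :
    ‖U‖ ^ 2 = ∫ lam, ‖U lam‖ ^ 2 ∂band := by
  have h : inner ℂ U U = ((∫ lam, ‖U lam‖ ^ 2 ∂band : ℝ) : ℂ) := by
    rw [L2.inner_def, ← integral_complex_ofReal]
    refine integral_congr_ae (Eventually.of_forall fun lam => ?_)
    simp only [inner_self_eq_norm_sq_to_K]
    norm_cast
  rw [inner_self_eq_norm_sq_to_K] at h
  exact Complex.ofReal_injective (by simpa using h)

lemma integral_norm_mul_norm_le {E F : Type} [NormedAddCommGroup E] [NormedAddCommGroup F]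
    {u : ℝ → E} {v : ℝ → F} (hu : MemLp u 2 band) (hv : MemLp v 2 band) :
    ∫ lam, ‖u lam‖ * ‖v lam‖ ∂band ≤
      √(∫ lam, ‖u lam‖ ^ 2 ∂band) * √(∫ lam, ‖v lam‖ ^ 2 ∂band) := by
  have h := integral_mul_norm_le_Lp_mul_Lq (μ := band) (f := fun lam => ‖u lam‖)
    (g := fun lam => ‖v lam‖) (p := 2) (q := 2) ⟨by norm_num, by norm_num, by norm_num⟩
    (by simpa using hu.norm) (by simpa using hv.norm)
  simpa [Real.sqrt_eq_rpow] using h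

lemma integrable_norm_mul_norm {E F : Type} [NormedAddCommGroup E] [NormedAddCommGroup F]
    {u : ℝ → E} {v : ℝ → F} (hu : MemLp u 2 band) (hv : MemLp v 2 band) :
    Integrable (fun lam => ‖u lam‖ * ‖v lam‖) band :=
  MemLp.integrable_mul hu.norm hv.norm

lemma integrable_inner_of_memLp {E : Type} [NormedAddCommGroup E] [InnerProductSpace ℂ E]
    {u v : ℝ → E} (hu : MemLp u 2 band) (hv : MemLp v 2 band) :
    Integrable (fun lam => inner ℂ (u lam) (v lam)) band :=
  (integrable_norm_mul_norm hu hv).mono' (hu.1.inner hv.1)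
    (Eventually.of_forall fun _ => norm_inner_le_norm _ _)

/-- Along a subsequence the integrals are below 2⁻ⁱ, so the sum of the functions has a finite
integral, is finite almost everywhere, and its terms tend to zero there. -/
lemma exists_subseq_tendsto_zero_ae {μ : Measure ℝ} {F : ℕ → ℝ → ℝ≥0∞}
    (hF : ∀ n, AEMeasurable (F n) μ) (h : Tendsto (fun n => ∫⁻ lam, F n lam ∂μ) atTop (𝓝 0)) :
    ∃ ns : ℕ → ℕ, StrictMono ns ∧
      ∀ᵐ lam ∂μ, Tendsto (fun i => F (ns i) lam) atTop (𝓝 0) := by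
  have h1 : ∀ i : ℕ, ∀ᶠ n in atTop, ∫⁻ lam, F n lam ∂μ < 2⁻¹ ^ i := fun i =>
    h.eventually_lt_const (ENNReal.pow_pos (by simp) i)
  obtain ⟨ns, hns, hlt⟩ := extraction_forall_of_eventually h1
  refine ⟨ns, hns, ?_⟩
  have h2 : ∫⁻ lam, ∑' i, F (ns i) lam ∂μ ≠ ∞ := by
    rw [lintegral_tsum fun i => hF _]
    refine ((ENNReal.tsum_le_tsum fun i => (hlt i).le).trans_lt ?_).ne
    rw [ENNReal.tsum_geometric, ENNReal.one_sub_inv_two, inv_inv]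
    exact ENNReal.ofNat_lt_top
  filter_upwards [ae_lt_top' (AEMeasurable.tsum fun i => hF _) h2] with lam hlam
  exact ENNReal.tendsto_atTop_zero_of_tsum_ne_top hlam.ne

/-- The finite combinations of `e^{-ij lam}`, `j ≥ m`. -/
def causalPoly (m : ℕ) : Submodule ℂ (ℝ → ℂ) := Submodule.span ℂ (Set.range fun j : ℕ => ee (j + m))

lemma causalPoly_continuous_bdd {m : ℕ} {p : ℝ → ℂ} (hp : p ∈ causalPoly m) :
    Continuous p ∧ ∃ C, ∀ lam, ‖p lam‖ ≤ C := by
  induction hp using Submodule.span_induction with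
  | mem p hp =>
    obtain ⟨j, rfl⟩ := hp
    exact ⟨continuous_ee _, 1, fun lam => (norm_ee _ _).le⟩
  | zero => exact ⟨continuous_const, 0, fun lam => by simp⟩
  | add p q _ _ hp hq =>
    obtain ⟨C, hC⟩ := hp.2
    obtain ⟨D, hD⟩ := hq.2
    exact ⟨hp.1.add hq.1, C + D, fun lam => (norm_add_le _ _).trans (add_le_add (hC _) (hD _))⟩
  | smul z p _ hp =>
    obtain ⟨C, hC⟩ := hp.2
    refine ⟨hp.1.const_smul z, ‖z‖ * C, fun lam => ?_⟩
    simp only [Pi.smul_apply, norm_smul]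
    gcongr
    exact hC _

lemma ee_mem_causalPoly {m : ℕ} {n : ℤ} (h : m ≤ n) : ee n ∈ causalPoly m :=
  Submodule.subset_span ⟨(n - m).toNat, by
    simp only
    congr 1
    omega⟩

lemma ee_mul_mem_causalPoly {m : ℕ} {p : ℝ → ℂ} (hp : p ∈ causalPoly m) (k : ℕ) :
    (fun lam => ee k lam * p lam) ∈ causalPoly (m + k) := by
  induction hp using Submodule.span_induction with
  | mem p hp =>
    obtain ⟨j, rfl⟩ := hp
    simp_rw [← ee_add]
    exact ee_mem_causalPoly (by push_cast; omega)
  | zero =>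
    simp only [Pi.zero_apply, mul_zero]
    exact Submodule.zero_mem _
  | add p q _ _ hp hq =>
    simp_rw [Pi.add_apply, mul_add]
    exact Submodule.add_mem _ hp hq
  | smul z p _ hp =>
    simp_rw [Pi.smul_apply, smul_eq_mul, mul_left_comm]
    exact Submodule.smul_mem _ z hp

lemma causalPoly_mono {m k : ℕ} (h : k ≤ m) : causalPoly m ≤ causalPoly k := by
  refine Submodule.span_le.2 ?_
  rintro _ ⟨j, rfl⟩
  exact ee_mem_causalPoly (by omega)

lemma integral_causalPoly {p : ℝ → ℂ} (hp : p ∈ causalPoly 1) : ∫ lam, p lam ∂band = 0 := by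
  have hi : ∀ {p : ℝ → ℂ}, p ∈ causalPoly 1 → Integrable p band := fun hp => by
    obtain ⟨h1, C, hC⟩ := causalPoly_continuous_bdd hp
    exact Integrable.of_bound h1.aestronglyMeasurable C (Eventually.of_forall hC)
  induction hp using Submodule.span_induction with
  | mem p hp =>
    obtain ⟨j, rfl⟩ := hp
    rw [integral_ee, if_neg (by omega)]
  | zero => simp
  | add p q h h' hp hq =>
    simp only [Pi.add_apply]
    rw [integral_add (hi h) (hi h'), hp, hq, add_zero]
  | smul z p _ hp =>
    simp only [Pi.smul_apply]
    rw [integral_smul, hp, smul_zero]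

lemma memLp_causalPoly_mul {r : ℝ → ℝ} (hr : MemLp r 2 band) {m : ℕ} {p : ℝ → ℂ}
    (hp : p ∈ causalPoly m) : MemLp (fun lam => p lam * r lam) 2 band := by
  obtain ⟨h1, C, hC⟩ := causalPoly_continuous_bdd hp
  refine MemLp.of_le_mul (c := C) hr (h1.aestronglyMeasurable.mul
    (Complex.continuous_ofReal.comp_aestronglyMeasurable hr.1)) (Eventually.of_forall fun lam => ?_)
  rw [norm_mul, Complex.norm_real]
  gcongr
  exact hC _

/-- Together with `mem_span_of_causalPoly` this translates between the span taken inside L² and the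
pointwise products p·r, where p has only the frequencies e^{-ij lam}, j ≥ 1. -/
lemma causalPoly_of_mem_span {r : ℝ → ℝ} (hr : MemLp r 2 band) {U : Lp ℂ 2 band}
    (hU : U ∈ Submodule.span ℂ (Set.range fun j : ℕ => (memLp_causalPoly_mul hr
      (ee_mem_causalPoly (n := j + (1 : ℕ)) (Int.le_add_of_nonneg_left (Int.natCast_nonneg j)))).toLp _)) :
    ∃ p ∈ causalPoly 1, U =ᵐ[band] fun lam => p lam * r lam := by
  induction hU using Submodule.span_induction with
  | mem U hU =>
    obtain ⟨j, rfl⟩ := hU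
    exact ⟨_, ee_mem_causalPoly (by omega), MemLp.coeFn_toLp _⟩
  | zero =>
    refine ⟨0, Submodule.zero_mem _, ?_⟩
    filter_upwards [Lp.coeFn_zero ℂ 2 band] with lam h
    rw [h]; simp
  | add U V _ _ hU hV =>
    obtain ⟨p, hp, h1⟩ := hU
    obtain ⟨q, hq, h2⟩ := hV
    refine ⟨p + q, Submodule.add_mem _ hp hq, ?_⟩
    filter_upwards [Lp.coeFn_add U V, h1, h2] with lam h h1 h2
    rw [h, Pi.add_apply, h1, h2, Pi.add_apply, add_mul]
  | smul z U _ hU =>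
    obtain ⟨p, hp, h1⟩ := hU
    refine ⟨z • p, Submodule.smul_mem _ z hp, ?_⟩
    filter_upwards [Lp.coeFn_smul z U, h1] with lam h h1
    rw [h, Pi.smul_apply, h1, Pi.smul_apply, smul_mul_assoc]

lemma mem_span_of_causalPoly {r : ℝ → ℝ} (hr : MemLp r 2 band) {p : ℝ → ℂ}
    (hp : p ∈ causalPoly 1) : ∃ U ∈ Submodule.span ℂ (Set.range fun j : ℕ =>
      (memLp_causalPoly_mul hr (ee_mem_causalPoly (n := j + (1 : ℕ))
        (Int.le_add_of_nonneg_left (Int.natCast_nonneg j)))).toLp _),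
      U =ᵐ[band] fun lam => p lam * r lam := by
  induction hp using Submodule.span_induction with
  | mem p hp =>
    obtain ⟨j, rfl⟩ := hp
    exact ⟨_, Submodule.subset_span ⟨j, rfl⟩, MemLp.coeFn_toLp _⟩
  | zero =>
    refine ⟨0, Submodule.zero_mem _, ?_⟩
    filter_upwards [Lp.coeFn_zero ℂ 2 band] with lam h
    rw [h]; simp
  | add p q _ _ hU hV =>
    obtain ⟨U, hU, h1⟩ := hU
    obtain ⟨V, hV, h2⟩ := hV
    refine ⟨U + V, Submodule.add_mem _ hU hV, ?_⟩
    filter_upwards [Lp.coeFn_add U V, h1, h2] with lam h h1 h2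
    rw [h, Pi.add_apply, h1, h2, Pi.add_apply, add_mul]
  | smul z p _ hU =>
    obtain ⟨U, hU, h1⟩ := hU
    refine ⟨z • U, Submodule.smul_mem _ z hU, ?_⟩
    filter_upwards [Lp.coeFn_smul z U, h1] with lam h h1
    rw [h, Pi.smul_apply, h1, Pi.smul_apply, smul_mul_assoc]

/-- The extremal function of Szegő's problem for the weight `r²`, multiplied by `r`. -/
lemma exists_szego {r : ℝ → ℝ} (hr : MemLp r 2 band) :
    ∃ X : Lp ℂ 2 band, ‖X‖ ^ 2 ≤ ∫ lam, r lam ^ 2 ∂band ∧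
      (∀ δ > 0, ∃ p ∈ causalPoly 1, ∫ lam, ‖X lam - (1 - p lam) * r lam‖ ^ 2 ∂band < δ) ∧
      ∀ᵐ lam ∂band, ‖X lam‖ ^ 2 = 1 / (2 * Real.pi) * ‖X‖ ^ 2 := by
  set K0 := Submodule.span ℂ (Set.range fun j : ℕ => (memLp_causalPoly_mul hr
      (ee_mem_causalPoly (n := j + (1 : ℕ))
        (Int.le_add_of_nonneg_left (Int.natCast_nonneg j)))).toLp _) with hK0
  set K := K0.topologicalClosure with hK
  have hKc : IsClosed (K : Set (Lp ℂ 2 band)) := K0.isClosed_topologicalClosure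
  have : CompleteSpace K := hKc.completeSpace_coe
  have h1m : MemLp (fun lam => (1 : ℂ) * r lam) 2 band := by simpa using hr.ofReal (K := ℂ)
  set M := h1m.toLp _ with hM
  -- X is r minus its projection on the closed span of e^{-ij lam} r, j ≥ 1: the best approximation
  -- of zero by (1 - p) r.
  set X := Kᗮ.starProjection M with hX
  have hXK : X ∈ Kᗮ := Submodule.starProjection_apply_mem _ _
  have hMX : M - X ∈ K := by
    have := Submodule.sub_starProjection_mem_orthogonal (K := Kᗮ) M
    rwa [Submodule.orthogonal_orthogonal] at this
  have hMae : M =ᵐ[band] fun lam => (1 : ℂ) * r lam := h1m.coeFn_toLp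
  have happ : ∀ δ > 0, ∃ p ∈ causalPoly 1,
      ∫ lam, ‖X lam - (1 - p lam) * r lam‖ ^ 2 ∂band < δ := by
    intro δ hδ
    obtain ⟨k, hk, hkd⟩ := Metric.mem_closure_iff.1 (show M - X ∈ closure (K0 : Set _) from hMX)
      (√δ) (Real.sqrt_pos.2 hδ)
    obtain ⟨p, hp, hkp⟩ := causalPoly_of_mem_span hr hk
    refine ⟨p, hp, ?_⟩
    have h2 : ∫ lam, ‖X lam - (1 - p lam) * r lam‖ ^ 2 ∂band = ‖M - X - k‖ ^ 2 := by
      rw [norm_sq_Lp]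
      refine integral_congr_ae ?_
      filter_upwards [Lp.coeFn_sub (M - X) k, Lp.coeFn_sub M X, hkp, hMae] with lam h1 h2 h3 h4
      rw [h1, Pi.sub_apply, h2, Pi.sub_apply, h3, h4, ← norm_neg]
      congr 2
      ring
    rw [h2, ← dist_eq_norm]
    calc dist (M - X) k ^ 2 < √δ ^ 2 := by gcongr
      _ = δ := Real.sq_sqrt hδ.le
  -- |X|² has no nonzero frequencies, hence is constant. X is a limit of (1 - p) r, and for j ≥ 1
  -- the function e^{-ij lam}(1 - p) r belongs to the span to which X is orthogonal.
  have horth : ∀ j : ℕ, 1 ≤ j → ∫ lam, ee (-j) lam * (‖X lam‖ ^ 2 : ℝ) ∂band = 0 := by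
    intro j hj
    have hXm : MemLp X 2 band := Lp.memLp X
    refine norm_le_zero_iff.1 (le_of_forall_pos_le_add fun δ hδ => ?_)
    rw [zero_add]
    obtain ⟨p, hp, hpd⟩ := happ ((δ / (‖X‖ + 1)) ^ 2) (by positivity)
    have hq : (fun lam => ee j lam * (1 - p lam)) ∈ causalPoly 1 := by
      have h1 : (fun lam => ee j lam * (ee 0 - p) lam) ∈ causalPoly (0 + j) :=
        ee_mul_mem_causalPoly (Submodule.sub_mem _ (ee_mem_causalPoly (by simp))
          (causalPoly_mono (by omega) hp)) j
      simp only [Pi.sub_apply, ee_zero] at h1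
      exact causalPoly_mono (by omega) h1
    obtain ⟨U, hU, hUq⟩ := mem_span_of_causalPoly hr hq
    have h0 : inner ℂ U X = 0 :=
      (Submodule.mem_orthogonal _ _).1 hXK U (Submodule.le_topologicalClosure _ hU)
    rw [L2.inner_def] at h0
    have hpm : MemLp (fun lam => (1 - p lam) * r lam) 2 band := by
      have := memLp_causalPoly_mul hr (m := 0) (p := ee 0 - p) (Submodule.sub_mem _
        (ee_mem_causalPoly (by simp)) (causalPoly_mono (by omega) hp))
      simpa [ee_zero] using this
    have hdm : MemLp (fun lam => X lam - (1 - p lam) * r lam) 2 band := hXm.sub hpm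
    have hint1 : Integrable (fun lam => inner ℂ (U lam) (X lam)) band :=
      L2.integrable_inner U X
    -- Subtracting the vanishing ⟨U, X⟩ replaces one factor X by the small difference X - (1 - p) r.
    have heq : ∫ lam, ee (-j) lam * (‖X lam‖ ^ 2 : ℝ) ∂band =
        ∫ lam, ee (-j) lam * inner ℂ (X lam - (1 - p lam) * r lam) (X lam) ∂band := by
      rw [← sub_eq_zero, ← h0, ← integral_sub]
      · refine integral_congr_ae ?_
        filter_upwards [hUq] with lam h
        rw [h]
        have h2 : ((‖X lam‖ ^ 2 : ℝ) : ℂ) = inner ℂ (X lam) (X lam) := by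
          rw [inner_self_eq_norm_sq_to_K]; norm_cast
        rw [h2, inner_sub_left]
        simp only [RCLike.inner_apply, map_mul, conj_ee, map_sub, map_one]
        ring
      · exact integrable_ee_smul (Integrable.ofReal
          ((memLp_two_iff_integrable_sq_norm hXm.1).1 hXm)) _
      · exact integrable_ee_smul (integrable_inner_of_memLp hdm hXm) _
    rw [heq]
    calc ‖∫ lam, ee (-j) lam * inner ℂ (X lam - (1 - p lam) * r lam) (X lam) ∂band‖
        ≤ ∫ lam, ‖ee (-j) lam * inner ℂ (X lam - (1 - p lam) * r lam) (X lam)‖ ∂band :=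
          norm_integral_le_integral_norm _
      _ ≤ ∫ lam, ‖X lam - (1 - p lam) * r lam‖ * ‖X lam‖ ∂band := by
          refine integral_mono_of_nonneg (Eventually.of_forall fun lam => by positivity)
            (integrable_norm_mul_norm hdm hXm) (Eventually.of_forall fun lam => ?_)
          simp only [norm_mul, norm_ee, one_mul]
          exact norm_inner_le_norm _ _
      _ ≤ _ := integral_norm_mul_norm_le hdm hXm
      _ ≤ δ / (‖X‖ + 1) * ‖X‖ := by
          rw [← norm_sq_Lp X, Real.sqrt_sq (norm_nonneg _)]
          gcongr
          rw [← Real.sqrt_sq (show 0 ≤ δ / (‖X‖ + 1) by positivity)]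
          exact Real.sqrt_le_sqrt hpd.le
      _ ≤ δ := by
          rw [div_mul_eq_mul_div, div_le_iff₀ (by positivity)]
          nlinarith [norm_nonneg X]
  refine ⟨X, ?_, happ, ?_⟩
  · have h1 : ‖X‖ ≤ ‖M‖ := Submodule.norm_starProjection_apply_le _ _
    have h2 : ‖M‖ ^ 2 = ∫ lam, r lam ^ 2 ∂band := by
      rw [norm_sq_Lp]
      refine integral_congr_ae ?_
      filter_upwards [hMae] with lam h
      rw [h]; simp
    rw [← h2]
    gcongr
  · have hXi : Integrable (fun lam => ((‖X lam‖ ^ 2 : ℝ) : ℂ)) band :=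
      Integrable.ofReal ((memLp_two_iff_integrable_sq_norm (Lp.memLp X).1).1 (Lp.memLp X))
    set c : ℝ := 1 / (2 * Real.pi) * ‖X‖ ^ 2 with hc
    have horth' : ∀ n : ℤ, n ≠ 0 → ∫ lam, ee n lam * (‖X lam‖ ^ 2 : ℝ) ∂band = 0 := by
      intro n hn
      rcases lt_or_gt_of_ne hn with h | h
      · obtain ⟨j, rfl⟩ : ∃ j : ℕ, n = -j := ⟨n.natAbs, by omega⟩
        exact horth j (by omega)
      · obtain ⟨j, rfl⟩ : ∃ j : ℕ, n = j := ⟨n.natAbs, by omega⟩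
        have h1 := congrArg (starRingEnd ℂ) (horth j (by omega))
        rw [← integral_conj] at h1
        simpa [conj_ee] using h1
    have h0 : (fun lam => ((‖X lam‖ ^ 2 : ℝ) : ℂ) - ee 0 lam • (c : ℂ)) =ᵐ[band] 0 := by
      have hci := (hasSeries_ee_smul_const 0 (c : ℂ)).integrable
      refine ae_eq_zero_of_fourierCo (hXi.sub hci) fun n => ?_
      rw [fourierCo_sub hXi hci, fourierCo_ee_smul_const, fourierCo_eq]
      simp only [smul_eq_mul]
      split_ifs with hn
      · obtain rfl : n = 0 := by simpa using hn
        simp only [ee_zero, one_mul]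
        rw [integral_complex_ofReal, ← norm_sq_Lp, hc]
        push_cast
        ring
      · rw [horth' n (by simpa using hn)]; simp
    filter_upwards [h0] with lam h
    simp only [ee_zero, one_smul, Pi.zero_apply, sub_eq_zero] at h
    exact_mod_cast h

/-- Szegő's problem is solved for the weight r² = 1 + ερ, and ω = X / r. Then |ω|²(1 + ερ) is a
constant c with 2πc ≤ 2π + ε∫ρ. The mean of ω equals one, so ∫|ω - 1|² = ∫|ω|² - 2π ≤ 2πc - 2π ≤
ε∫ρ. A small ε thus brings ω close to one, while |ω|²(1 + ρ) stays bounded by a constant that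
depends on ε. -/
lemma exists_multiplier {ρ : ℝ → ℝ} (hρ : Integrable ρ band) (hρ0 : ∀ lam, 0 ≤ ρ lam) {ε : ℝ}
    (hε : 0 < ε) (hε1 : ε ≤ 1) :
    ∃ ω : ℝ → ℂ, AEStronglyMeasurable ω band ∧
      (∀ᵐ lam ∂band, ‖ω lam‖ ^ 2 * (1 + ρ lam) ≤ (1 + ∫ lam, ρ lam ∂band) / ε) ∧
      (∀ᵐ lam ∂band, ‖ω lam‖ ^ 2 ≤ 1 + ∫ lam, ρ lam ∂band) ∧
      ∫ lam, ‖ω lam - 1‖ ^ 2 ∂band ≤ ε * ∫ lam, ρ lam ∂band ∧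
      ∀ δ > 0, ∃ p ∈ causalPoly 0,
        Integrable (fun lam => ‖ω lam - p lam‖ ^ 2 * (1 + ρ lam)) band ∧
        ∫ lam, ‖ω lam - p lam‖ ^ 2 * (1 + ρ lam) ∂band < δ := by
  set r : ℝ → ℝ := fun lam => √(1 + ε * ρ lam) with hr
  have hw : ∀ lam, 1 ≤ 1 + ε * ρ lam := fun lam => by nlinarith [hρ0 lam]
  have hr2 : ∀ lam, r lam ^ 2 = 1 + ε * ρ lam := fun lam =>
    Real.sq_sqrt (by linarith [hw lam])
  have hr0 : ∀ lam, 0 < r lam := fun lam => Real.sqrt_pos.2 (by linarith [hw lam])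
  have hr0' : ∀ lam, (r lam : ℂ) ≠ 0 := fun lam => by exact_mod_cast (hr0 lam).ne'
  have hWi : Integrable (fun lam => 1 + ε * ρ lam) band :=
    (integrable_const _).add (hρ.const_mul _)
  have hra : AEStronglyMeasurable r band :=
    Real.continuous_sqrt.comp_aestronglyMeasurable hWi.1
  have hrm : MemLp r 2 band := by
    rw [memLp_two_iff_integrable_sq_norm hra]
    simpa [hr2] using hWi
  obtain ⟨X, hX1, hX2, hX3⟩ := exists_szego hrm
  have hXm : MemLp X 2 band := Lp.memLp X
  have hband : band.real Set.univ = 2 * Real.pi := by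
    have := integral_ee 0
    simp only [ee_zero, integral_const, if_true] at this
    simpa using congrArg Complex.re this
  have hR0 : 0 ≤ ∫ lam, ρ lam ∂band := integral_nonneg hρ0
  have hrint : ∫ lam, r lam ^ 2 ∂band = 2 * Real.pi + ε * ∫ lam, ρ lam ∂band := by
    simp_rw [hr2]
    rw [integral_add (integrable_const _) (hρ.const_mul _), integral_const_mul, integral_const,
      hband]
    simp
  have hpi := Real.pi_gt_three
  set c := 1 / (2 * Real.pi) * ‖X‖ ^ 2 with hc
  have hcX : 2 * Real.pi * c = ‖X‖ ^ 2 := by rw [hc]; field_simp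
  have hc1 : 2 * Real.pi * c ≤ 2 * Real.pi + ε * ∫ lam, ρ lam ∂band := by
    rw [hcX, ← hrint]; exact hX1
  have hc2 : c ≤ 1 + ∫ lam, ρ lam ∂band := by nlinarith
  set ω : ℝ → ℂ := fun lam => X lam / r lam with hω
  have hωr : ∀ lam, ω lam * r lam = X lam := fun lam => div_mul_cancel₀ _ (hr0' lam)
  have hωa : AEStronglyMeasurable ω band :=
    (hXm.1.aemeasurable.div (Complex.measurable_ofReal.comp_aemeasurable
      hra.aemeasurable)).aestronglyMeasurable
  have hωc : ∀ᵐ lam ∂band, ‖ω lam‖ ^ 2 * (1 + ε * ρ lam) = c := by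
    filter_upwards [hX3] with lam h
    rw [← hr2, ← h, ← hωr, norm_mul, Complex.norm_real, mul_pow, Real.norm_eq_abs, sq_abs]
  have hωb : ∀ᵐ lam ∂band, ‖ω lam‖ ^ 2 ≤ c := by
    filter_upwards [hωc] with lam h
    nlinarith [sq_nonneg ‖ω lam‖, hw lam]
  have hωm : MemLp ω 2 band := by
    rw [memLp_two_iff_integrable_sq_norm hωa]
    refine Integrable.of_bound (hωa.norm.pow 2) c ?_
    filter_upwards [hωb] with lam h
    rwa [Real.norm_of_nonneg (by positivity)]
  have hcp : ∀ p ∈ causalPoly 1, ee 0 - p ∈ causalPoly 0 := fun p hp =>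
    Submodule.sub_mem _ (ee_mem_causalPoly (by simp)) (causalPoly_mono (by omega) hp)
  have hdiff : ∀ p : ℝ → ℂ, ∀ lam, ‖X lam - (1 - p lam) * r lam‖ ^ 2 =
      ‖ω lam - (1 - p lam)‖ ^ 2 * (1 + ε * ρ lam) := fun p lam => by
    rw [← hωr, ← sub_mul, norm_mul, mul_pow, Complex.norm_real, Real.norm_eq_abs, sq_abs, hr2]
  have hdi : ∀ p ∈ causalPoly 1,
      Integrable (fun lam => ‖X lam - (1 - p lam) * r lam‖ ^ 2) band := fun p hp => by
    have h1 : MemLp (fun lam => X lam - (1 - p lam) * r lam) 2 band := by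
      have := hXm.sub (memLp_causalPoly_mul hrm (hcp p hp))
      convert this using 2 with lam
      rw [Pi.sub_apply, Pi.sub_apply, ee_zero]
    exact (memLp_two_iff_integrable_sq_norm h1.1).1 h1
  -- ω is a limit in mean square of functions 1 - p whose p has zero mean.
  have hmean : ∫ lam, ω lam ∂band = 2 * Real.pi := by
    rw [← sub_eq_zero]
    refine norm_le_zero_iff.1 (le_of_forall_pos_le_add fun δ hδ => ?_)
    rw [zero_add]
    obtain ⟨p, hp, hpd⟩ := hX2 ((δ / √(2 * Real.pi)) ^ 2) (by positivity)
    obtain ⟨hpc, C, hC⟩ := causalPoly_continuous_bdd hp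
    have hpi' : Integrable p band :=
      Integrable.of_bound hpc.aestronglyMeasurable C (Eventually.of_forall hC)
    have hpm : MemLp (fun lam => 1 - p lam) 2 band := by
      refine MemLp.of_bound (continuous_const.sub hpc).aestronglyMeasurable (1 + C)
        (Eventually.of_forall fun lam => ?_)
      exact (norm_sub_le _ _).trans (by simpa using hC lam)
    have h1 : ∫ lam, ω lam ∂band - 2 * Real.pi = ∫ lam, (ω lam - (1 - p lam)) ∂band := by
      rw [integral_sub (hωm.integrable (by norm_num)) (hpm.integrable (by norm_num)),
        integral_sub (integrable_const _) hpi', integral_causalPoly hp, integral_const, hband]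
      simp
    have hdm : MemLp (fun lam => ω lam - (1 - p lam)) 2 band := hωm.sub hpm
    have h2 := integral_norm_mul_norm_le hdm (memLp_const (1 : ℝ))
    simp only [norm_one, mul_one, one_pow, integral_const, hband, smul_eq_mul] at h2
    rw [h1]
    refine (norm_integral_le_integral_norm _).trans (h2.trans ?_)
    have h3 : ∫ lam, ‖ω lam - (1 - p lam)‖ ^ 2 ∂band ≤ (δ / √(2 * Real.pi)) ^ 2 := by
      refine le_trans (integral_mono ((memLp_two_iff_integrable_sq_norm hdm.1).1 hdm)
        (hdi p hp) fun lam => ?_) hpd.le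
      simp only [hdiff]
      nlinarith [sq_nonneg ‖ω lam - (1 - p lam)‖, hw lam]
    calc _ ≤ √((δ / √(2 * Real.pi)) ^ 2) * √(2 * Real.pi) := by gcongr
      _ = δ := by
        rw [Real.sqrt_sq (by positivity), div_mul_cancel₀ _ (by positivity)]
  refine ⟨ω, hωa, ?_, ?_, ?_, fun δ hδ => ?_⟩
  · filter_upwards [hωc] with lam h
    rw [le_div_iff₀ hε]
    have : ‖ω lam‖ ^ 2 * (1 + ρ lam) * ε ≤ ‖ω lam‖ ^ 2 * (1 + ε * ρ lam) := by
      nlinarith [sq_nonneg ‖ω lam‖]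
    linarith
  · filter_upwards [hωb] with lam h using h.trans hc2
  · have h1 : ∀ lam, ‖ω lam - 1‖ ^ 2 = ‖ω lam‖ ^ 2 - 2 * (ω lam).re + 1 := fun lam => by
      rw [← Complex.normSq_eq_norm_sq, ← Complex.normSq_eq_norm_sq, Complex.normSq_apply,
        Complex.normSq_apply]
      simp; ring
    have hω1 : Integrable ω band := hωm.integrable (by norm_num)
    have hω2 : Integrable (fun lam => ‖ω lam‖ ^ 2) band :=
      (memLp_two_iff_integrable_sq_norm hωa).1 hωm
    have hre : ∫ lam, (ω lam).re ∂band = 2 * Real.pi := by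
      have := integral_re hω1
      simp only [RCLike.re_eq_complex_re] at this
      rw [this, hmean]
      simp
    simp_rw [h1]
    have hω3 : Integrable (fun lam => 2 * (ω lam).re) band := hω1.re.const_mul 2
    have hω4 : Integrable (fun lam => ‖ω lam‖ ^ 2 - 2 * (ω lam).re) band := hω2.sub hω3
    rw [integral_add hω4 (integrable_const _), integral_sub hω2 hω3, integral_const_mul, hre, integral_const, hband]
    have h2 : ∫ lam, ‖ω lam‖ ^ 2 ∂band ≤ 2 * Real.pi * c := by
      refine (integral_mono_ae hω2 (integrable_const c) hωb).trans ?_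
      rw [integral_const, hband, smul_eq_mul]
    simp only [smul_eq_mul, mul_one]
    linarith
  -- The factor ε compensates for 1 + ρ ≤ ε⁻¹(1 + ερ), which holds because ε ≤ 1.
  · obtain ⟨p, hp, hpd⟩ := hX2 (δ * ε) (by positivity)
    have hle : ∀ lam, ‖ω lam - (ee 0 - p) lam‖ ^ 2 * (1 + ρ lam) ≤
        ε⁻¹ * ‖X lam - (1 - p lam) * r lam‖ ^ 2 := fun lam => by
      rw [hdiff, Pi.sub_apply, ee_zero, ← div_eq_inv_mul, le_div_iff₀ hε]
      nlinarith [sq_nonneg ‖ω lam - (1 - p lam)‖]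
    obtain ⟨hpc, C, hC⟩ := causalPoly_continuous_bdd (hcp p hp)
    have hint : Integrable (fun lam => ‖ω lam - (ee 0 - p) lam‖ ^ 2 * (1 + ρ lam)) band := by
      refine ((hdi p hp).const_mul ε⁻¹).mono' ?_ (Eventually.of_forall fun lam => ?_)
      · exact ((hωa.sub hpc.aestronglyMeasurable).norm.pow 2).mul
          (aestronglyMeasurable_const.add hρ.1)
      · rw [Real.norm_of_nonneg (mul_nonneg (by positivity) (by linarith [hρ0 lam]))]
        exact hle lam
    refine ⟨_, hcp p hp, hint, ?_⟩
    refine (integral_mono hint ((hdi p hp).const_mul ε⁻¹) hle).trans_lt ?_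
    rw [integral_const_mul, inv_mul_lt_iff₀ hε]
    linarith

/-- Bounded causal functions that tend to one and damp a given integrable weight. -/
lemma exists_multipliers {ρ : ℝ → ℝ} (hρ : Integrable ρ band) (hρ0 : ∀ lam, 0 ≤ ρ lam) :
    ∃ ω : ℕ → ℝ → ℂ, (∀ n, AEStronglyMeasurable (ω n) band) ∧
      (∀ n, ∃ K, ∀ᵐ lam ∂band, ‖ω n lam‖ ^ 2 * (1 + ρ lam) ≤ K) ∧
      (∃ K, ∀ n, ∀ᵐ lam ∂band, ‖ω n lam‖ ≤ K) ∧
      (∀ᵐ lam ∂band, Tendsto (fun n => ω n lam) atTop (𝓝 1)) ∧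
      ∀ n, ∀ δ > 0, ∃ p ∈ causalPoly 0,
        Integrable (fun lam => ‖ω n lam - p lam‖ ^ 2 * (1 + ρ lam)) band ∧
        ∫ lam, ‖ω n lam - p lam‖ ^ 2 * (1 + ρ lam) ∂band < δ := by
  have hε : ∀ n : ℕ, (0 : ℝ) < 1 / (n + 1) := fun n => by positivity
  have hε1 : ∀ n : ℕ, (1 : ℝ) / (n + 1) ≤ 1 := fun n => by
    rw [div_le_one (by positivity)]; linarith [n.cast_nonneg (α := ℝ)]
  choose ω h1 h2 h3 h4 h5 using fun n : ℕ => exists_multiplier hρ hρ0 (hε n) (hε1 n)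
  have hi : ∀ n, Integrable (fun lam => ‖ω n lam - 1‖ ^ 2) band := fun n => by
    have h : MemLp (fun lam => ω n lam - 1) 2 band := by
      refine MemLp.of_bound ((h1 n).sub aestronglyMeasurable_const)
        (√(1 + ∫ lam, ρ lam ∂band) + 1) ?_
      filter_upwards [h3 n] with lam h
      refine (norm_sub_le _ _).trans ?_
      rw [norm_one]
      gcongr
      exact Real.le_sqrt_of_sq_le h
    exact (memLp_two_iff_integrable_sq_norm h.1).1 h
  have hlim : Tendsto (fun n => ∫⁻ lam, ENNReal.ofReal (‖ω n lam - 1‖ ^ 2) ∂band) atTop (𝓝 0) := by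
    have h6 : ∀ n, ∫⁻ lam, ENNReal.ofReal (‖ω n lam - 1‖ ^ 2) ∂band ≤
        ENNReal.ofReal (1 / (n + 1 : ℝ) * ∫ lam, ρ lam ∂band) := fun n => by
      rw [← ofReal_integral_eq_lintegral_ofReal (hi n)
        (Eventually.of_forall fun lam => by positivity)]
      exact ENNReal.ofReal_le_ofReal (h4 n)
    refine tendsto_of_tendsto_of_tendsto_of_le_of_le tendsto_const_nhds ?_
      (fun _ => bot_le) h6
    rw [← ENNReal.ofReal_zero]
    refine ENNReal.tendsto_ofReal ?_
    simpa using tendsto_one_div_add_atTop_nhds_zero_nat.mul_const (∫ lam, ρ lam ∂band)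
  -- With ε = 1/(n + 1) the multipliers tend to one only in mean square; a subsequence gives
  -- convergence almost everywhere.
  obtain ⟨ns, -, hns⟩ := exists_subseq_tendsto_zero_ae
    (fun n => (hi n).1.aemeasurable.ennreal_ofReal) hlim
  refine ⟨fun n => ω (ns n), fun n => h1 _, fun n => ⟨_, h2 _⟩,
    ⟨√(1 + ∫ lam, ρ lam ∂band), fun n => ?_⟩, ?_, fun n => h5 _⟩
  · filter_upwards [h3 (ns n)] with lam h using Real.le_sqrt_of_sq_le h
  · filter_upwards [hns] with lam h
    rw [tendsto_iff_norm_sub_tendsto_zero]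
    have h7 := (ENNReal.tendsto_toReal ENNReal.zero_ne_top).comp h
    have h8 := h7.sqrt
    simpa [Function.comp_def, ENNReal.toReal_ofReal] using h8

/-! ### Products of causal functions -/

set_option linter.unusedSectionVars false

section Smirnov

variable {E : Type} [NormedAddCommGroup E] [InnerProductSpace ℂ E] [CompleteSpace E]

lemma integrable_causalPoly_smul {m : ℕ} {p : ℝ → ℂ} (hp : p ∈ causalPoly m) {x : ℝ → E}
    (hx : Integrable x band) : Integrable (fun lam => p lam • x lam) band := by
  obtain ⟨hpc, C, hC⟩ := causalPoly_continuous_bdd hp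
  exact Integrable.bdd_smul hx C hpc.aestronglyMeasurable (Eventually.of_forall hC)

lemma fourierCo_causalPoly_smul {p : ℝ → ℂ} (hp : p ∈ causalPoly 0) {x : ℝ → E}
    (hx : Integrable x band) (hx0 : ∀ n : ℤ, 1 ≤ n → fourierCo x n = 0) {n : ℤ} (hn : 1 ≤ n) :
    fourierCo (fun lam => p lam • x lam) n = 0 := by
  induction hp using Submodule.span_induction with
  | mem p hp =>
    obtain ⟨j, rfl⟩ := hp
    rw [fourierCo_ee_smul, hx0 _ (by omega)]
  | zero => simp [fourierCo]
  | add p q h h' hp hq =>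
    simp_rw [Pi.add_apply, add_smul]
    rw [fourierCo_add (integrable_causalPoly_smul h hx) (integrable_causalPoly_smul h' hx), hp, hq,
      add_zero]
  | smul z p _ hp =>
    simp_rw [Pi.smul_apply, smul_assoc]
    rw [fourierCo_smul, hp, smul_zero]

/-- `ω` is a limit of causal polynomials in `L²((1 + ρ) dlam)`. -/
def IsCausalLimit (ρ : ℝ → ℝ) (ω : ℝ → ℂ) : Prop :=
  ∀ δ > 0, ∃ p ∈ causalPoly 0, Integrable (fun lam => ‖ω lam - p lam‖ ^ 2 * (1 + ρ lam)) band ∧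
    ∫ lam, ‖ω lam - p lam‖ ^ 2 * (1 + ρ lam) ∂band < δ

/-- A causal polynomial times a causal x is causal. Since ‖x‖ ≤ ρ, the L¹ error |ω - p|‖x‖ is at
most s⁻¹|ω - p|²(1 + ρ) + sρ, so approximation in L²((1 + ρ) dlam) passes the property to the limit.
-/
lemma fourierCo_causalLimit_smul {ρ : ℝ → ℝ} (hρ : Integrable ρ band) (hρ0 : ∀ lam, 0 ≤ ρ lam)
    {ω : ℝ → ℂ} (hω : IsCausalLimit ρ ω) {x : ℝ → E} (hx : Integrable x band)
    (hxρ : ∀ lam, ‖x lam‖ ≤ ρ lam) (hx0 : ∀ n : ℤ, 1 ≤ n → fourierCo x n = 0)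
    (hωx : Integrable (fun lam => ω lam • x lam) band) {n : ℤ} (hn : 1 ≤ n) :
    fourierCo (fun lam => ω lam • x lam) n = 0 := by
  rw [fourierCo_eq, smul_eq_zero]
  right
  refine norm_le_zero_iff.1 (le_of_forall_pos_le_add fun δ hδ => ?_)
  rw [zero_add]
  have hR0 : 0 ≤ ∫ lam, ρ lam ∂band := integral_nonneg hρ0
  -- With this s the term s∫ρ is at most δ/2, and the tolerance sδ/2 for p makes the other term at
  -- most δ/2.
  set s := δ / (2 * (∫ lam, ρ lam ∂band + 1)) with hs
  have hs0 : 0 < s := by positivity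
  obtain ⟨p, hp, hpi, hpd⟩ := hω (s * δ / 2) (by positivity)
  have h0 : ∫ lam, ee n lam • p lam • x lam ∂band = 0 := by
    have := fourierCo_causalPoly_smul hp hx hx0 hn
    rw [fourierCo_eq, smul_eq_zero] at this
    exact this.resolve_left (by simp [Real.pi_ne_zero])
  have h1 : ∫ lam, ee n lam • ω lam • x lam ∂band =
      ∫ lam, ee n lam • (ω lam - p lam) • x lam ∂band := by
    rw [← sub_zero (∫ lam, ee n lam • ω lam • x lam ∂band), ← h0,
      ← integral_sub (integrable_ee_smul hωx n)
      (integrable_ee_smul (integrable_causalPoly_smul hp hx) n)]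
    simp_rw [sub_smul, smul_sub]
  rw [h1]
  have hb : ∀ lam, ‖ee n lam • (ω lam - p lam) • x lam‖ ≤
      s⁻¹ * (‖ω lam - p lam‖ ^ 2 * (1 + ρ lam)) + s * ρ lam := fun lam => by
    rw [norm_smul, norm_ee, one_mul, norm_smul]
    have h2 : ‖ω lam - p lam‖ * ‖x lam‖ ≤ ‖ω lam - p lam‖ * ρ lam :=
      mul_le_mul_of_nonneg_left (hxρ lam) (norm_nonneg _)
    have h3 : 0 ≤ s⁻¹ * (‖ω lam - p lam‖ - s) ^ 2 * ρ lam :=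
      mul_nonneg (by positivity) (hρ0 lam)
    have h4 : s⁻¹ * (‖ω lam - p lam‖ - s) ^ 2 * ρ lam = s⁻¹ * ‖ω lam - p lam‖ ^ 2 * ρ lam
      - 2 * ‖ω lam - p lam‖ * ρ lam + s * ρ lam := by field_simp; ring
    have h5 : 0 ≤ s⁻¹ * ‖ω lam - p lam‖ ^ 2 := by positivity
    have h6 : 0 ≤ ‖ω lam - p lam‖ * ρ lam := mul_nonneg (norm_nonneg _) (hρ0 lam)
    nlinarith
  refine (norm_integral_le_of_norm_le ((hpi.const_mul _).add (hρ.const_mul _))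
    (Eventually.of_forall hb)).trans ?_
  simp only [Pi.add_apply]
  rw [integral_add (hpi.const_mul _) (hρ.const_mul _), integral_const_mul, integral_const_mul]
  have h7 : s⁻¹ * ∫ lam, ‖ω lam - p lam‖ ^ 2 * (1 + ρ lam) ∂band ≤ δ / 2 := by
    rw [inv_mul_le_iff₀ hs0]; linarith
  have h8 : s * ∫ lam, ρ lam ∂band ≤ δ / 2 := by
    rw [hs, div_mul_eq_mul_div, div_le_div_iff₀ (by positivity) (by positivity)]
    nlinarith
  linarith

/-- Damping turns an integrable function into a square-integrable one: |ω|²‖x‖² ≤ (|ω|²(1 + ρ)) ρ ≤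
Kρ. -/
lemma memLp_damped {ρ : ℝ → ℝ} (hρ : Integrable ρ band)
    {ω : ℝ → ℂ} (hω : AEStronglyMeasurable ω band) {K : ℝ}
    (hK : ∀ᵐ lam ∂band, ‖ω lam‖ ^ 2 * (1 + ρ lam) ≤ K) {x : ℝ → E}
    (hx : AEStronglyMeasurable x band) (hxρ : ∀ lam, ‖x lam‖ ≤ ρ lam) :
    MemLp (fun lam => ω lam • x lam) 2 band := by
  have hm : AEStronglyMeasurable (fun lam => ω lam • x lam) band := hω.smul hx
  rw [memLp_two_iff_integrable_sq_norm hm]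
  refine (hρ.const_mul K).mono' (hm.norm.pow 2) ?_
  filter_upwards [hK] with lam h
  have h0 : 0 ≤ ρ lam := (norm_nonneg _).trans (hxρ lam)
  rw [Real.norm_of_nonneg (by positivity), norm_smul, mul_pow]
  calc ‖ω lam‖ ^ 2 * ‖x lam‖ ^ 2 ≤ ‖ω lam‖ ^ 2 * ρ lam ^ 2 := by
        gcongr; exact hxρ lam
    _ ≤ (‖ω lam‖ ^ 2 * (1 + ρ lam)) * ρ lam := by nlinarith [sq_nonneg ‖ω lam‖]
    _ ≤ K * ρ lam := by gcongr

lemma integral_inner_eq_zero_of_memLp {C y : ℝ → E} {c : ℤ → E} (hC : HasSeries C c)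
    (hc : ∀ n : ℤ, n ≤ 0 → c n = 0) (hy : MemLp y 2 band)
    (hy0 : ∀ n : ℤ, 1 ≤ n → fourierCo y n = 0) : ∫ lam, inner ℂ (C lam) (y lam) ∂band = 0 := by
  have h := hC.hasSum_inner (v := y) ⟨hy, fun n => rfl⟩
  have h0 : ∀ n, inner ℂ (c n) (fourierCo y n) = 0 := fun n => by
    rcases le_or_gt n 0 with hn | hn
    · rw [hc n hn, inner_zero_left]
    · rw [hy0 n hn, inner_zero_right]
  simp only [h0] at h
  have := h.unique hasSum_zero
  rw [mul_eq_zero] at this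
  exact this.resolve_left (by simp [Real.pi_ne_zero])

/-- A square-integrable anticausal function is orthogonal to an integrable causal one as soon as
the product is integrable. -/
lemma integral_inner_anticausal_causal {C x : ℝ → E} {c : ℤ → E} (hC : HasSeries C c)
    (hc : ∀ n : ℤ, n ≤ 0 → c n = 0) (hx : Integrable x band)
    (hx0 : ∀ n : ℤ, 1 ≤ n → fourierCo x n = 0)
    (hCx : Integrable (fun lam => inner ℂ (C lam) (x lam)) band) :
    ∫ lam, inner ℂ (C lam) (x lam) ∂band = 0 := by
  obtain ⟨ω, h1, h2, ⟨K, h3⟩, h4, h5⟩ := exists_multipliers hx.norm (fun lam => norm_nonneg _)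
  -- The product ω x is square-integrable and still causal, so Parseval's identity applies to it.
  -- Afterwards ω → 1 under the majorant K|⟨C, x⟩|.
  have h6 : ∀ n, ∫ lam, ω n lam * inner ℂ (C lam) (x lam) ∂band = 0 := fun n => by
    obtain ⟨K', hK'⟩ := h2 n
    have hm := memLp_damped hx.norm (h1 n) hK' hx.1 (fun lam => le_rfl)
    have := integral_inner_eq_zero_of_memLp hC hc hm fun k hk =>
      fourierCo_causalLimit_smul hx.norm (fun lam => norm_nonneg _) (h5 n) hx (fun lam => le_rfl)
        hx0 (hm.integrable (by norm_num)) hk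
    simpa only [inner_smul_right] using this
  have h7 : Tendsto (fun n => ∫ lam, ω n lam * inner ℂ (C lam) (x lam) ∂band) atTop
      (𝓝 (∫ lam, inner ℂ (C lam) (x lam) ∂band)) := by
    refine tendsto_integral_of_dominated_convergence (fun lam => K * ‖inner ℂ (C lam) (x lam)‖)
      (fun n => (h1 n).mul hCx.1) (hCx.norm.const_mul K) (fun n => ?_) ?_
    · filter_upwards [h3 n] with lam h
      rw [norm_mul]
      gcongr
    · filter_upwards [h4] with lam h
      simpa using h.mul_const (inner ℂ (C lam) (x lam))
  simp only [h6] at h7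
  exact (tendsto_nhds_unique h7 tendsto_const_nhds)

end Smirnov

/-! ### Causal polynomials with values in `ℓ²` -/

/-- The finite combinations of `e^{-ij lam} δₖ`, `j ≥ 0`. -/
def cpoly : (ℕ × ℕ →₀ ℂ) →ₗ[ℂ] (ℝ → Vec) :=
  Finsupp.linearCombination ℂ fun p lam => ee p.1 lam • unitVec p.2

lemma cpoly_apply (α : ℕ × ℕ →₀ ℂ) (lam : ℝ) :
    cpoly α lam = α.sum fun p z => z • ee p.1 lam • unitVec p.2 := by
  simp [cpoly, Finsupp.linearCombination_apply, Finsupp.sum, Finset.sum_apply]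

lemma trigPoly_eq (d τ : ℕ) (α : ℕ × ℕ →₀ ℂ) (lam : ℝ) :
    trigPoly d τ α lam = beta d τ lam • cpoly α lam := by
  rw [trigPoly, cpoly_apply, Finsupp.sum, Finsupp.sum, Finset.smul_sum]
  refine Finset.sum_congr rfl fun p _ => ?_
  rw [smul_smul, smul_smul, ee]
  congr 1
  push_cast
  ring

lemma cpoly_continuous_bdd (α : ℕ × ℕ →₀ ℂ) :
    Continuous (cpoly α) ∧ ∃ C, ∀ lam, ‖cpoly α lam‖ ≤ C := by
  refine ⟨?_, α.sum fun p z => ‖z‖, fun lam => ?_⟩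
  · simp_rw [funext (cpoly_apply α)]
    refine continuous_finsetSum _ fun p _ => ?_
    have := continuous_ee p.1
    fun_prop
  · rw [cpoly_apply]
    refine (norm_sum_le _ _).trans (Finset.sum_le_sum fun p _ => ?_)
    rw [norm_smul, norm_smul, norm_ee, norm_unitVec, one_mul, mul_one]

/-- `x` is a limit of causal polynomials in the space with the weighted density `S`. -/
def Approx (d τ : ℕ) (S : Density) (x : ℝ → Vec) : Prop :=
  ∀ ε : ℝ≥0∞, ε ≠ 0 → ∃ α, ∫⁻ lam, ENNReal.ofReal
    (quad (weighted d τ S lam) (x lam - cpoly α lam)) ∂band < ε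

section Approx

variable {d τ : ℕ} {S : Density}

lemma lintegral_quad_add_le (hS : IsSpectralDensity d τ S) {x y : ℝ → Vec}
    (hx : AEStronglyMeasurable x band) :
    ∫⁻ lam, ENNReal.ofReal (quad (weighted d τ S lam) (x lam + y lam)) ∂band ≤
      2 * ∫⁻ lam, ENNReal.ofReal (quad (weighted d τ S lam) (x lam)) ∂band +
      2 * ∫⁻ lam, ENNReal.ofReal (quad (weighted d τ S lam) (y lam)) ∂band := by
  rw [← lintegral_const_mul' _ _ (by simp), ← lintegral_const_mul' _ _ (by simp),
    ← lintegral_add_left' ((aesm_quad hS.measurable_weighted hx).aemeasurable.ennreal_ofReal.const_mul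
      _)]
  refine lintegral_mono_ae ?_
  filter_upwards [hS.positive_weighted] with lam h
  have h1 := quad_nonneg h (x lam)
  have h2 := quad_nonneg h (y lam)
  have h3 : quad (weighted d τ S lam) (x lam + y lam) ≤
      2 * quad (weighted d τ S lam) (x lam) + 2 * quad (weighted d τ S lam) (y lam) :=
    (quad_add_le h one_pos _ _).trans (le_of_eq (by norm_num))
  refine (ENNReal.ofReal_le_ofReal h3).trans (le_of_eq ?_)
  rw [ENNReal.ofReal_add (by positivity) (by positivity), ENNReal.ofReal_mul (by norm_num),
    ENNReal.ofReal_mul (by norm_num), ENNReal.ofReal_ofNat]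

lemma Approx.of_near (hS : IsSpectralDensity d τ S) {x : ℝ → Vec}
    (hx : AEStronglyMeasurable x band)
    (h : ∀ ε : ℝ≥0∞, ε ≠ 0 → ∃ y, AEStronglyMeasurable y band ∧ Approx d τ S y ∧
      ∫⁻ lam, ENNReal.ofReal (quad (weighted d τ S lam) (x lam - y lam)) ∂band < ε) :
    Approx d τ S x := by
  intro ε hε
  have hε4 : ε / 4 ≠ 0 := (ENNReal.div_pos hε (by simp)).ne'
  obtain ⟨y, hy, hyA, hxy⟩ := h (ε / 4) hε4
  obtain ⟨α, hα⟩ := hyA (ε / 4) hε4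
  refine ⟨α, ?_⟩
  have h1 := lintegral_quad_add_le hS (x := fun lam => x lam - y lam)
    (y := fun lam => y lam - cpoly α lam) (hx.sub hy)
  simp only [sub_add_sub_cancel] at h1
  refine h1.trans_lt ?_
  have h2 : ε = 2 * (ε / 4) + 2 * (ε / 4) := by
    rw [← two_mul, ← mul_assoc, show (2 : ℝ≥0∞) * 2 = 4 by norm_num,
      ENNReal.mul_div_cancel (by simp) (by simp)]
  calc _ < 2 * (ε / 4) + 2 * (ε / 4) := by
        refine ENNReal.add_lt_add ?_ ?_ <;>
        · rw [ENNReal.mul_lt_mul_iff_right (by simp) (by simp)]; assumption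
    _ = ε := h2.symm

lemma Approx.add (hS : IsSpectralDensity d τ S) {x y : ℝ → Vec}
    (hx : AEStronglyMeasurable x band)
    (hxA : Approx d τ S x) (hyA : Approx d τ S y) : Approx d τ S (fun lam => x lam + y lam) := by
  intro ε hε
  have hε4 : ε / 4 ≠ 0 := (ENNReal.div_pos hε (by simp)).ne'
  obtain ⟨α, hα⟩ := hxA (ε / 4) hε4
  obtain ⟨α', hα'⟩ := hyA (ε / 4) hε4
  refine ⟨α + α', ?_⟩
  have h1 := lintegral_quad_add_le hS (x := fun lam => x lam - cpoly α lam)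
    (y := fun lam => y lam - cpoly α' lam)
    (hx.sub (cpoly_continuous_bdd α).1.aestronglyMeasurable)
  simp only [map_add, Pi.add_apply, add_sub_add_comm]
  refine h1.trans_lt ?_
  have h2 : ε = 2 * (ε / 4) + 2 * (ε / 4) := by
    rw [← two_mul, ← mul_assoc, show (2 : ℝ≥0∞) * 2 = 4 by norm_num,
      ENNReal.mul_div_cancel (by simp) (by simp)]
  calc _ < 2 * (ε / 4) + 2 * (ε / 4) := by
        refine ENNReal.add_lt_add ?_ ?_ <;>
        · rw [ENNReal.mul_lt_mul_iff_right (by simp) (by simp)]; assumption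
    _ = ε := h2.symm

lemma Approx.smul {x : ℝ → Vec} (hxA : Approx d τ S x) (z : ℂ) :
    Approx d τ S (fun lam => z • x lam) := by
  intro ε hε
  obtain ⟨α, hα⟩ := hxA (ε / ENNReal.ofReal (‖z‖ ^ 2 + 1))
    (ENNReal.div_pos hε ENNReal.ofReal_ne_top).ne'
  refine ⟨z • α, ?_⟩
  rw [ENNReal.lt_div_iff_mul_lt (Or.inl (by simp; positivity))
    (Or.inl ENNReal.ofReal_ne_top), mul_comm, ← lintegral_const_mul' _ _ ENNReal.ofReal_ne_top] at hα
  refine (lintegral_mono fun lam => ?_).trans_lt hα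
  rw [map_smul, Pi.smul_apply, ← smul_sub, quad_smul_right, ENNReal.ofReal_mul (by positivity)]
  gcongr
  linarith

lemma approx_cpoly (α : ℕ × ℕ →₀ ℂ) : Approx d τ S (cpoly α) := fun ε hε =>
  ⟨α, by simpa [quad_zero_right] using pos_iff_ne_zero.2 hε⟩

lemma lintegral_quad_le (hS : IsSpectralDensity d τ S) {u : ℝ → Vec} {v : ℝ → ℝ}
    (hv : ∀ᵐ lam ∂band, wtr d τ S lam * ‖u lam‖ ^ 2 ≤ v lam) (hvi : Integrable v band) :
    ∫⁻ lam, ENNReal.ofReal (quad (weighted d τ S lam) (u lam)) ∂band ≤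
      ENNReal.ofReal (∫ lam, v lam ∂band) := by
  rw [ofReal_integral_eq_lintegral_ofReal hvi]
  · refine lintegral_mono_ae ?_
    filter_upwards [hS.quad_le, hv] with lam h1 h2
    exact ENNReal.ofReal_le_ofReal ((h1 _).trans h2)
  · filter_upwards [hv] with lam h
    exact (mul_nonneg (wtr_nonneg _ _ _ _) (by positivity)).trans h

lemma exists_finite_near (v : Vec) {δ : ℝ} (hδ : 0 < δ) :
    ∃ N : ℕ, ‖v - ∑ k ∈ Finset.range N, v k • unitVec k‖ < δ := by
  have h := (hasSum_unitVec v).tendsto_sum_nat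
  rw [Metric.tendsto_atTop] at h
  obtain ⟨N, hN⟩ := h δ hδ
  refine ⟨N, ?_⟩
  rw [← dist_eq_norm, dist_comm]
  exact hN N le_rfl

lemma approx_ee_smul_const (hS : IsSpectralDensity d τ S) (j : ℕ) (v : Vec) :
    Approx d τ S (fun lam => ee j lam • v) := by
  refine Approx.of_near hS ((continuous_ee j).smul continuous_const).aestronglyMeasurable
    fun ε hε => ?_
  obtain ⟨δ, hδ, hδε⟩ : ∃ δ : ℝ, 0 < δ ∧ ENNReal.ofReal δ < ε := by
    obtain ⟨δ, hδ, hδε⟩ := ENNReal.lt_iff_exists_real_btwn.1 (pos_iff_ne_zero.2 hε)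
    exact ⟨δ, by simpa using hδε.1, hδε.2⟩
  have hR : 0 ≤ ∫ lam, wtr d τ S lam ∂band := integral_nonneg (wtr_nonneg d τ S)
  obtain ⟨N, hN⟩ := exists_finite_near v (δ := √(δ / (∫ lam, wtr d τ S lam ∂band + 1)))
    (Real.sqrt_pos.2 (by positivity))
  have hN2 : ‖v - ∑ k ∈ Finset.range N, v k • unitVec k‖ ^ 2 ≤
      δ / (∫ lam, wtr d τ S lam ∂band + 1) := by
    rw [← Real.sq_sqrt (show 0 ≤ δ / (∫ lam, wtr d τ S lam ∂band + 1) by positivity)]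
    gcongr
  refine ⟨fun lam => ee j lam • ∑ k ∈ Finset.range N, v k • unitVec k,
    ((continuous_ee j).smul continuous_const).aestronglyMeasurable, ?_, ?_⟩
  · have : (fun lam => ee j lam • ∑ k ∈ Finset.range N, v k • unitVec k) =
        cpoly (∑ k ∈ Finset.range N, Finsupp.single (j, k) (v k)) := by
      ext1 lam
      rw [map_sum, Finset.smul_sum, Finset.sum_apply]
      refine Finset.sum_congr rfl fun k _ => ?_
      rw [cpoly_apply, Finsupp.sum_single_index (by simp), smul_comm]
    rw [this]
    exact approx_cpoly _
  · refine (lintegral_quad_le hS (v := fun lam => wtr d τ S lam *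
      ‖v - ∑ k ∈ Finset.range N, v k • unitVec k‖ ^ 2) (Eventually.of_forall fun lam => ?_)
      (hS.integrable_wtr.mul_const _)).trans_lt (lt_of_le_of_lt ?_ hδε)
    · rw [← smul_sub, norm_smul, norm_ee, one_mul]
    · refine ENNReal.ofReal_le_ofReal ?_
      rw [integral_mul_const]
      calc _ ≤ (∫ lam, wtr d τ S lam ∂band) * (δ / (∫ lam, wtr d τ S lam ∂band + 1)) := by gcongr
        _ ≤ δ := by
          rw [mul_div_assoc', div_le_iff₀ (by positivity)]
          nlinarith

lemma approx_causalPoly_smul (hS : IsSpectralDensity d τ S) {p : ℝ → ℂ} (hp : p ∈ causalPoly 0)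
    (v : Vec) : Approx d τ S (fun lam => p lam • v) := by
  induction hp using Submodule.span_induction with
  | mem p hp =>
    obtain ⟨j, rfl⟩ := hp
    simpa using approx_ee_smul_const hS j v
  | zero => exact fun ε hε => ⟨0, by simpa [quad_zero_right] using pos_iff_ne_zero.2 hε⟩
  | add p q h _ hp hq =>
    simp_rw [Pi.add_apply, add_smul]
    exact Approx.add hS ((causalPoly_continuous_bdd h).1.smul
      continuous_const).aestronglyMeasurable hp hq
  | smul z p _ hp =>
    simp_rw [Pi.smul_apply, smul_assoc]
    exact hp.smul z

end Approx

lemma causal_neg {E : Type} [Zero E] (a : ℕ → E) (j : ℕ) : causal a (-(j : ℤ)) = a j := by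
  simp [causal]

lemma causal_of_pos {E : Type} [Zero E] (a : ℕ → E) {n : ℤ} (hn : 1 ≤ n) : causal a n = 0 := by
  rw [causal, if_neg (by omega)]

/-- Parseval's identity is indexed by ℤ, the statements by ℕ; the positive frequencies contribute G
n 0 = 0. -/
lemma hasSum_causal_iff {E F : Type} [Zero E] [AddCommMonoid F] [TopologicalSpace F] {a : ℕ → E}
    {G : ℤ → E → F} (hG : ∀ n, G n 0 = 0) {s : F} :
    HasSum (fun n : ℤ => G n (causal a n)) s ↔ HasSum (fun j : ℕ => G (-(j : ℤ)) (a j)) s := by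
  have hinj : Function.Injective fun j : ℕ => -(j : ℤ) := fun i j h => by simpa using h
  rw [← hinj.hasSum_iff (f := fun n : ℤ => G n (causal a n))]
  · simp [Function.comp_def, causal_neg]
  · intro n hn
    have : 1 ≤ n := by
      by_contra h
      exact hn ⟨n.natAbs, by simp only; omega⟩
    simp only [causal_of_pos a this, hG]

/-! ### Mean-square convergence of causal Fourier series. -/

section CausalSeries

variable {E : Type} [NormedAddCommGroup E] [InnerProductSpace ℂ E] [CompleteSpace E]

lemma HasSeries.hasSum_norm_sq_causal {u : ℝ → E} {a : ℕ → E} (hu : HasSeries u (causal a)) :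
    HasSum (fun j => ‖a j‖ ^ 2) (1 / (2 * Real.pi) * ∫ lam, ‖u lam‖ ^ 2 ∂band) :=
  (hasSum_causal_iff (a := a) (G := fun _ x => ‖x‖ ^ 2) (by simp)).1 hu.hasSum_norm_sq

lemma hasSeries_partialSum (a : ℕ → E) (m : ℕ) :
    HasSeries (fun lam => ∑ j ∈ Finset.range m, ee j lam • a j)
      (causal fun j => if j < m then a j else 0) := by
  induction m with
  | zero =>
    refine ⟨by simp, fun n => ?_⟩
    simp [fourierCo, causal]
  | succ m ih =>
    simp_rw [Finset.sum_range_succ]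
    have h := ih.add (hasSeries_ee_smul_const m (a m))
    convert h using 1
    ext n
    rcases le_or_gt n 0 with hn | hn
    · obtain ⟨j, rfl⟩ : ∃ j : ℕ, n = -j := ⟨n.natAbs, by omega⟩
      simp only [causal_neg, neg_inj, Nat.cast_inj]
      rcases lt_trichotomy j m with hj | hj | hj
      · rw [if_pos (by omega), if_pos hj, if_neg (by omega), add_zero]
      · subst hj; simp
      · rw [if_neg (by omega), if_neg (by omega), if_neg (by omega), add_zero]
    · rw [causal_of_pos _ (by omega), causal_of_pos _ (by omega), if_neg (by omega), add_zero]

/-- By Parseval the squared error of a partial sum is the tail of the convergent series ∑ ‖a_j‖². -/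
lemma HasSeries.exists_partialSum_near {u : ℝ → E} {a : ℕ → E} (hu : HasSeries u (causal a))
    {δ : ℝ} (hδ : 0 < δ) :
    ∃ m : ℕ, ∫ lam, ‖u lam - ∑ j ∈ Finset.range m, ee j lam • a j‖ ^ 2 ∂band < δ := by
  have h1 : ∀ m : ℕ, 1 / (2 * Real.pi) *
      ∫ lam, ‖u lam - ∑ j ∈ Finset.range m, ee j lam • a j‖ ^ 2 ∂band =
      1 / (2 * Real.pi) * ∫ lam, ‖u lam‖ ^ 2 ∂band - ∑ j ∈ Finset.range m, ‖a j‖ ^ 2 := fun m => by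
    have h2 : HasSeries (fun lam => u lam - ∑ j ∈ Finset.range m, ee j lam • a j)
        (causal fun j => a j - if j < m then a j else 0) := by
      convert hu.sub (hasSeries_partialSum a m) using 1
      ext n
      simp only [causal]
      split_ifs <;> simp
    refine h2.hasSum_norm_sq_causal.unique ?_
    have h3 := hu.hasSum_norm_sq_causal.sub
      (hasSum_sum_of_ne_finset_zero (f := fun j => if j < m then ‖a j‖ ^ 2 else 0)
        (s := Finset.range m) (fun j hj => if_neg (by simpa using hj)))
    rw [Finset.sum_congr rfl (fun j hj => if_pos (Finset.mem_range.1 hj))] at h3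
    have h4 : (fun j => ‖a j - if j < m then a j else 0‖ ^ 2) =
        fun j => ‖a j‖ ^ 2 - if j < m then ‖a j‖ ^ 2 else 0 := by
      ext j; split_ifs <;> simp
    rw [h4]
    exact h3
  have h2 : Tendsto (fun m : ℕ => 1 / (2 * Real.pi) *
      ∫ lam, ‖u lam - ∑ j ∈ Finset.range m, ee j lam • a j‖ ^ 2 ∂band) atTop (𝓝 0) := by
    simp_rw [h1]
    rw [← sub_self (1 / (2 * Real.pi) * ∫ lam, ‖u lam‖ ^ 2 ∂band)]
    exact hu.hasSum_norm_sq_causal.tendsto_sum_nat.const_sub _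
  obtain ⟨m, hm⟩ := (h2.eventually_lt_const
    (show 0 < 1 / (2 * Real.pi) * δ by positivity)).exists
  exact ⟨m, lt_of_mul_lt_mul_left hm (by positivity)⟩

end CausalSeries

/-! ### Causal functions as limits of causal polynomials in a weighted space. -/

section Membership

variable {d τ : ℕ} {S : Density}

lemma Approx.sum (hS : IsSpectralDensity d τ S) {x : ℕ → ℝ → Vec}
    (hx : ∀ j, AEStronglyMeasurable (x j) band) (hxA : ∀ j, Approx d τ S (x j)) (m : ℕ) :
    Approx d τ S (fun lam => ∑ j ∈ Finset.range m, x j lam) := by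
  induction m with
  | zero => exact fun ε hε => ⟨0, by simpa [quad_zero_right] using pos_iff_ne_zero.2 hε⟩
  | succ m ih =>
    simp_rw [Finset.sum_range_succ]
    exact ih.add hS (Finset.aestronglyMeasurable_fun_sum _ fun j _ => hx j) (hxA m)

lemma exists_ofReal_lt {ε : ℝ≥0∞} (hε : ε ≠ 0) : ∃ δ : ℝ, 0 < δ ∧ ENNReal.ofReal δ < ε := by
  obtain ⟨δ, hδ, hδε⟩ := ENNReal.lt_iff_exists_real_btwn.1 (pos_iff_ne_zero.2 hε)
  exact ⟨δ, by simpa using hδε.1, hδε.2⟩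

/-- Two approximations are composed. Replacing y by a partial sum s costs at most |K| ∫‖y - s‖²,
because |ω|² times the trace is bounded by K. On the bounded s, replacing ω by a causal polynomial p
costs at most C² ∫|ω - p|²(1 + ρ). -/
lemma approx_damped (hS : IsSpectralDensity d τ S) {ρ : ℝ → ℝ}
    (hρ : ∀ lam, wtr d τ S lam ≤ ρ lam) {ω : ℝ → ℂ} (hω : AEStronglyMeasurable ω band) {K : ℝ}
    (hK : ∀ᵐ lam ∂band, ‖ω lam‖ ^ 2 * (1 + ρ lam) ≤ K) (hωc : IsCausalLimit ρ ω) {y : ℝ → Vec}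
    {a : ℕ → Vec} (hy : HasSeries y (causal a)) : Approx d τ S (fun lam => ω lam • y lam) := by
  have hsc : ∀ m, Continuous fun lam => ∑ j ∈ Finset.range m, ee j lam • a j := fun m =>
    continuous_finsetSum _ fun j _ => (continuous_ee j).smul continuous_const
  have h1 : ∀ m : ℕ, Approx d τ S (fun lam => ω lam • ∑ j ∈ Finset.range m, ee j lam • a j) := by
    intro m
    refine Approx.of_near hS (hω.smul (hsc m).aestronglyMeasurable) fun ε hε => ?_
    obtain ⟨δ, hδ, hδε⟩ := exists_ofReal_lt hε
    set C := ∑ j ∈ Finset.range m, ‖a j‖ with hC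
    have hCb : ∀ lam, ‖∑ j ∈ Finset.range m, ee j lam • a j‖ ≤ C := fun lam =>
      (norm_sum_le _ _).trans (Finset.sum_le_sum fun j _ => by rw [norm_smul, norm_ee, one_mul])
    have hC0 : 0 ≤ C := (norm_nonneg _).trans (hCb 0)
    obtain ⟨p, hp, hpi, hpd⟩ := hωc (δ / (C ^ 2 + 1)) (by positivity)
    have hpc := (causalPoly_continuous_bdd hp).1
    refine ⟨fun lam => p lam • ∑ j ∈ Finset.range m, ee j lam • a j,
      (hpc.smul (hsc m)).aestronglyMeasurable, ?_, ?_⟩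
    · have h2 : Approx d τ S fun lam => ∑ j ∈ Finset.range m, (ee j lam * p lam) • a j := by
        refine Approx.sum hS (fun j => ?_) (fun j => ?_) m
        · exact (((continuous_ee j).mul hpc).smul continuous_const).aestronglyMeasurable
        · exact approx_causalPoly_smul hS
            (causalPoly_mono (Nat.zero_le _) (ee_mul_mem_causalPoly hp j)) _
      simpa only [Finset.smul_sum, smul_smul, mul_comm] using h2
    · refine (lintegral_quad_le hS (v := fun lam => C ^ 2 * (‖ω lam - p lam‖ ^ 2 * (1 + ρ lam)))
        (Eventually.of_forall fun lam => ?_) (hpi.const_mul _)).trans_lt (lt_of_le_of_lt ?_ hδε)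
      · rw [← sub_smul, norm_smul, mul_pow]
        have h3 : wtr d τ S lam ≤ 1 + ρ lam := by linarith [hρ lam]
        calc _ ≤ (1 + ρ lam) * (‖ω lam - p lam‖ ^ 2 * C ^ 2) := by
              gcongr
              · exact (wtr_nonneg _ _ _ _).trans h3
              · exact hCb lam
          _ = _ := by ring
      · refine ENNReal.ofReal_le_ofReal ?_
        rw [integral_const_mul]
        calc _ ≤ C ^ 2 * (δ / (C ^ 2 + 1)) := by gcongr
          _ ≤ δ := by
            rw [mul_div_assoc', div_le_iff₀ (by positivity)]
            nlinarith
  refine Approx.of_near hS (hω.smul hy.1.1) fun ε hε => ?_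
  obtain ⟨δ, hδ, hδε⟩ := exists_ofReal_lt hε
  obtain ⟨m, hm⟩ := hy.exists_partialSum_near (δ := δ / (|K| + 1)) (by positivity)
  refine ⟨_, hω.smul (hsc m).aestronglyMeasurable, h1 m, ?_⟩
  have hd : MemLp (fun lam => y lam - ∑ j ∈ Finset.range m, ee j lam • a j) 2 band :=
    hy.1.sub (hasSeries_partialSum a m).1
  have hdi := (memLp_two_iff_integrable_sq_norm hd.1).1 hd
  refine (lintegral_quad_le hS (v := fun lam => |K| *
    ‖y lam - ∑ j ∈ Finset.range m, ee j lam • a j‖ ^ 2) ?_ (hdi.const_mul _)).trans_lt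
      (lt_of_le_of_lt ?_ hδε)
  · filter_upwards [hK] with lam h
    simp only [Pi.smul_apply']
    rw [← smul_sub, norm_smul, mul_pow, ← mul_assoc]
    gcongr
    calc _ ≤ ‖ω lam‖ ^ 2 * (1 + ρ lam) := by
          rw [mul_comm]; gcongr; linarith [hρ lam]
      _ ≤ |K| := h.trans (le_abs_self K)
  · refine ENNReal.ofReal_le_ofReal ?_
    rw [integral_const_mul]
    calc _ ≤ |K| * (δ / (|K| + 1)) := by gcongr
      _ ≤ δ := by
        rw [mul_div_assoc', div_le_iff₀ (by positivity)]
        nlinarith [abs_nonneg K]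

/-- Integrable causal functions are limits of causal polynomials in the space `L₂` of a density
in which they lie. -/
lemma approx_of_causal (hS : IsSpectralDensity d τ S) {x : ℝ → Vec} (hx : Integrable x band)
    (hx0 : ∀ n : ℤ, 1 ≤ n → fourierCo x n = 0)
    (hxS : Integrable (fun lam => quad (weighted d τ S lam) (x lam)) band) :
    Approx d τ S x := by
  obtain ⟨ω, h1, h2, ⟨K, h3⟩, h4, h5⟩ := exists_multipliers (ρ := fun lam => ‖x lam‖ + wtr d τ S lam)
    (hx.norm.add hS.integrable_wtr) (fun lam => add_nonneg (norm_nonneg _) (wtr_nonneg _ _ _ _))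
  have hxρ : ∀ lam, ‖x lam‖ ≤ ‖x lam‖ + wtr d τ S lam := fun lam => by
    linarith [wtr_nonneg d τ S lam]
  have hρi : Integrable (fun lam => ‖x lam‖ + wtr d τ S lam) band := hx.norm.add hS.integrable_wtr
  -- The multiplier is used twice, for ρ = ‖x‖ + `wtr`: one factor makes ω x square-integrable, the
  -- other controls the weight of the density in `approx_damped`.
  have h6 : ∀ n, Approx d τ S (fun lam => ω n lam • ω n lam • x lam) := fun n => by
    obtain ⟨K', hK'⟩ := h2 n
    have hm := memLp_damped hρi (h1 n) hK' hx.1 hxρ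
    have hs : HasSeries (fun lam => ω n lam • x lam)
        (causal fun j => fourierCo (fun lam => ω n lam • x lam) (-(j : ℤ))) := by
      refine ⟨hm, fun k => ?_⟩
      rcases le_or_gt k 0 with hk | hk
      · obtain ⟨j, rfl⟩ : ∃ j : ℕ, k = -j := ⟨k.natAbs, by omega⟩
        rw [causal_neg]
      · rw [causal_of_pos _ (by omega)]
        exact fourierCo_causalLimit_smul hρi
          (fun lam => add_nonneg (norm_nonneg _) (wtr_nonneg _ _ _ _)) (h5 n) hx hxρ hx0
          (hm.integrable (by norm_num)) (by omega)
    exact approx_damped hS (fun lam => by linarith [norm_nonneg (x lam)]) (h1 n) hK' (h5 n) hs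
  have h7 : Tendsto (fun n => ∫⁻ lam, ENNReal.ofReal
      (quad (weighted d τ S lam) (x lam - ω n lam • ω n lam • x lam)) ∂band) atTop (𝓝 0) := by
    have h8 : ∀ n lam, quad (weighted d τ S lam) (x lam - ω n lam • ω n lam • x lam) =
        ‖1 - ω n lam * ω n lam‖ ^ 2 * quad (weighted d τ S lam) (x lam) := fun n lam => by
      rw [← quad_smul_right, sub_smul, one_smul, mul_smul]
    simp_rw [h8]
    rw [← lintegral_zero (μ := band)]
    refine tendsto_lintegral_of_dominated_convergence' (fun lam =>
      ENNReal.ofReal ((1 + K * K) ^ 2 * quad (weighted d τ S lam) (x lam))) (fun n => ?_)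
      (fun n => ?_) ?_ ?_
    · exact (((aestronglyMeasurable_const.sub ((h1 n).mul (h1 n))).norm.pow 2).mul
        hxS.1).aemeasurable.ennreal_ofReal
    · filter_upwards [h3 n, hS.positive_weighted] with lam hK hp
      refine ENNReal.ofReal_le_ofReal ?_
      have := quad_nonneg hp (x lam)
      gcongr
      refine (norm_sub_le _ _).trans ?_
      rw [norm_one, norm_mul]
      gcongr
      exact (norm_nonneg _).trans hK
    · exact (hxS.const_mul _).lintegral_lt_top.ne
    · filter_upwards [h4] with lam h
      rw [← ENNReal.ofReal_zero]
      refine ENNReal.tendsto_ofReal ?_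
      have h9 := (((h.mul h).const_sub 1).norm.pow 2).mul_const
        (quad (weighted d τ S lam) (x lam))
      simpa using h9
  refine Approx.of_near hS hx.1 fun ε hε => ?_
  obtain ⟨n, hn⟩ := (h7.eventually_lt_const (pos_iff_ne_zero.2 hε)).exists
  exact ⟨_, (h1 n).smul ((h1 n).smul hx.1), h6 n, hn⟩

end Membership

/-! ### The function `B_τ` -/

lemma bFun_eq (b : ℕ → Vec) (lam : ℝ) : bFun b lam = ∑' j : ℕ, ee j lam • b j := by
  simp [bFun, ee]

section BFun

variable {b : ℕ → Vec} (hb : Summable fun j => ‖b j‖)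
include hb

lemma hasSum_bFun (lam : ℝ) : HasSum (fun j : ℕ => ee j lam • b j) (bFun b lam) := by
  rw [bFun_eq]
  refine (Summable.of_norm ?_).hasSum
  simpa [norm_smul, norm_ee] using hb

lemma norm_bFun_le (lam : ℝ) : ‖bFun b lam‖ ≤ ∑' j, ‖b j‖ := by
  rw [bFun_eq]
  refine tsum_of_norm_bounded hb.hasSum fun j => ?_
  rw [norm_smul, norm_ee, one_mul]

lemma aesm_bFun : AEStronglyMeasurable (bFun b) band := by
  refine Continuous.aestronglyMeasurable ?_
  simp_rw [funext (bFun_eq b)]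
  refine continuous_tsum (fun j => (continuous_ee j).smul continuous_const) hb fun j lam => ?_
  rw [norm_smul, norm_ee, one_mul]

/-- Y is only integrable, so this is not Parseval's identity: absolute summability of b allows
integration term by term. -/
lemma hasSum_inner_bFun {Y : ℝ → Vec} (hY : Integrable Y band) :
    HasSum (fun l : ℕ => inner ℂ (b l) (fourierCo Y (-(l : ℤ))))
      ((1 / (2 * Real.pi) : ℂ) * ∫ lam, inner ℂ (bFun b lam) (Y lam) ∂band) := by
  have h1 : ∀ (l : ℕ) lam, inner ℂ (ee l lam • b l) (Y lam) = inner ℂ (b l) (ee (-l) lam • Y lam) :=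
    fun l lam => by rw [inner_smul_left, inner_smul_right, conj_ee]
  have hi : ∀ l : ℕ, Integrable (fun lam => inner ℂ (ee l lam • b l) (Y lam)) band := fun l => by
    simp_rw [h1]
    exact (integrable_ee_smul hY _).const_inner _
  have h2 := hasSum_integral_of_summable_integral_norm hi (by
    refine Summable.of_nonneg_of_le (fun l => integral_nonneg fun lam => norm_nonneg _)
      (fun l => ?_) (hb.mul_right (∫ lam, ‖Y lam‖ ∂band))
    rw [← integral_const_mul]
    refine integral_mono (hi l).norm (hY.norm.const_mul _) fun lam => ?_
    refine (norm_inner_le_norm _ _).trans ?_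
    rw [norm_smul, norm_ee, one_mul])
  have h3 : ∀ lam, ∑' l : ℕ, inner ℂ (ee l lam • b l) (Y lam) = inner ℂ (bFun b lam) (Y lam) :=
    fun lam => by
      have h4 := ((hasSum_bFun hb lam).mapL (innerSL ℂ (Y lam))).star
      simp only [innerSL_apply_apply, RCLike.star_def, inner_conj_symm] at h4
      exact h4.tsum_eq
  simp only [h3] at h2
  have h5 := h2.mul_left (1 / (2 * Real.pi) : ℂ)
  have h6 : ∀ l : ℕ, inner ℂ (b l) (fourierCo Y (-(l : ℤ))) =
      (1 / (2 * Real.pi) : ℂ) * ∫ lam, inner ℂ (ee l lam • b l) (Y lam) ∂band := fun l => by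
    simp_rw [h1]
    rw [integral_inner (integrable_ee_smul hY _), fourierCo_eq, inner_smul_right]
    rfl
  simp_rw [h6]
  exact h5

lemma hasSeries_bFun : HasSeries (bFun b) (causal b) := by
  refine ⟨MemLp.of_bound (aesm_bFun hb) _ (Eventually.of_forall (norm_bFun_le hb)), fun n => ?_⟩
  have hi : ∀ j : ℕ, Integrable (fun lam => ee n lam • ee j lam • b j) band := fun j =>
    integrable_ee_smul (hasSeries_ee_smul_const j (b j)).integrable n
  have h2 := hasSum_integral_of_summable_integral_norm hi (by
    simp only [norm_smul, norm_ee, one_mul, integral_const, smul_eq_mul]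
    exact hb.mul_left _)
  have h3 : ∀ lam, ∑' j : ℕ, ee n lam • ee j lam • b j = ee n lam • bFun b lam :=
    fun lam => ((hasSum_bFun hb lam).const_smul _).tsum_eq
  simp only [h3] at h2
  have h4 := h2.const_smul (1 / (2 * Real.pi) : ℂ)
  have h5 : ∀ j : ℕ, (1 / (2 * Real.pi) : ℂ) • ∫ lam, ee n lam • ee j lam • b j ∂band =
      if n = -(j : ℤ) then b j else 0 := fun j => fourierCo_ee_smul_const _ _ _
  simp only [h5] at h4
  refine h4.unique ?_
  rcases le_or_gt n 0 with hn | hn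
  · obtain ⟨j, rfl⟩ : ∃ j : ℕ, n = -j := ⟨n.natAbs, by omega⟩
    rw [causal_neg]
    convert hasSum_ite_eq j (b j) using 2 with i
    simp only [neg_inj, Nat.cast_inj, eq_comm]
    split_ifs with h
    · rw [h]
    · rfl
  · rw [causal_of_pos _ (by omega)]
    convert hasSum_zero using 2 with j
    rw [if_neg (by omega)]

end BFun

/-! ### Mean square errors -/

section MSE

variable {d τ : ℕ} {b : ℕ → Vec} {f g : Density}

lemma mse_beta_smul (x : ℝ → Vec) :
    mse d τ b (fun lam => beta d τ lam • x lam) f g = ENNReal.ofReal (1 / (2 * Real.pi)) *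
      ∫⁻ lam, ENNReal.ofReal (quad (weighted d τ f lam) (bFun b lam - x lam) +
        quad (weighted d τ g lam) (x lam)) ∂band := by
  simp_rw [mse, ← smul_sub, quad_beta_smul]

lemma trigPoly_eq_fun (d τ : ℕ) (α : ℕ × ℕ →₀ ℂ) :
    trigPoly d τ α = fun lam => beta d τ lam • cpoly α lam := funext (trigPoly_eq d τ α)

lemma sqNorm_beta_smul (S : Density) (x : ℝ → Vec) :
    sqNorm S (fun lam => beta d τ lam • x lam) = ENNReal.ofReal (1 / (2 * Real.pi)) *
      ∫⁻ lam, ENNReal.ofReal (quad (weighted d τ S lam) (x lam)) ∂band := by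
  simp_rw [sqNorm, quad_beta_smul]

lemma aesm_beta_smul {x : ℝ → Vec} (hx : AEStronglyMeasurable x band) :
    AEStronglyMeasurable (fun lam => beta d τ lam • x lam) band :=
  (measurable_beta d τ).aestronglyMeasurable.smul hx

lemma aesm_trigPoly (α : ℕ × ℕ →₀ ℂ) : AEStronglyMeasurable (trigPoly d τ α) band := by
  rw [trigPoly_eq_fun]
  exact aesm_beta_smul (cpoly_continuous_bdd α).1.aestronglyMeasurable

lemma ofReal_two_pi_ne_zero : ENNReal.ofReal (1 / (2 * Real.pi)) ≠ 0 := by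
  simp [Real.pi_pos]

lemma IsSpectralDensity.integrable_quad_of_bound {S : Density} (hS : IsSpectralDensity d τ S)
    {x : ℝ → Vec} (hx : AEStronglyMeasurable x band) {C : ℝ} (hC : ∀ lam, ‖x lam‖ ≤ C) :
    Integrable (fun lam => quad (weighted d τ S lam) (x lam)) band := by
  refine (hS.integrable_wtr.mul_const (C ^ 2)).mono' (aesm_quad hS.measurable_weighted hx) ?_
  filter_upwards [hS.quad_le, hS.positive_weighted] with lam h1 h2
  rw [Real.norm_of_nonneg (quad_nonneg h2 _)]
  refine (h1 _).trans ?_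
  have := wtr_nonneg d τ S lam
  gcongr
  exact hC lam

lemma beta_smul_mem_L20 {S : Density} {x : ℝ → Vec}
    (hx : AEStronglyMeasurable x band)
    (hxi : Integrable (fun lam => quad (weighted d τ S lam) (x lam)) band)
    (hxA : Approx d τ S x) : (fun lam => beta d τ lam • x lam) ∈ L20 d τ S := by
  refine ⟨aesm_beta_smul hx, ?_, fun ε hε => ?_⟩
  · rw [sqNorm_beta_smul]
    exact ENNReal.mul_lt_top ENNReal.ofReal_lt_top hxi.lintegral_lt_top
  · obtain ⟨α, hα⟩ := hxA (ε / ENNReal.ofReal (1 / (2 * Real.pi)))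
      (ENNReal.div_pos hε ENNReal.ofReal_ne_top).ne'
    refine ⟨α, ?_⟩
    have : (fun lam => beta d τ lam • x lam) - trigPoly d τ α =
        fun lam => beta d τ lam • (x lam - cpoly α lam) := by
      ext1 lam
      rw [Pi.sub_apply, trigPoly_eq, smul_sub]
    rw [this, sqNorm_beta_smul]
    rwa [ENNReal.lt_div_iff_mul_lt (Or.inl ofReal_two_pi_ne_zero)
      (Or.inl ENNReal.ofReal_ne_top), mul_comm] at hα

lemma trigPoly_mem_L20 {S : Density} (hS : IsSpectralDensity d τ S) (α : ℕ × ℕ →₀ ℂ) :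
    trigPoly d τ α ∈ L20 d τ S := by
  rw [trigPoly_eq_fun]
  obtain ⟨h1, C, hC⟩ := cpoly_continuous_bdd α
  exact beta_smul_mem_L20 h1.aestronglyMeasurable
    (hS.integrable_quad_of_bound h1.aestronglyMeasurable hC) (approx_cpoly α)

/-- The error is the square of a seminorm of the pair (βB - h, h), so changing h to h' moves that
pair by h - h' in the seminorm of f + g; `quad_add_le` quantifies this. -/
lemma mse_le (hf : IsSpectralDensity d τ f) (hg : IsSpectralDensity d τ g)
    (hb : Summable fun j => ‖b j‖) {h h' : ℝ → Vec}
    (hh : AEStronglyMeasurable h band) {t : ℝ} (ht : 0 < t) :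
    mse d τ b h' f g ≤ ENNReal.ofReal (1 + t) * mse d τ b h f g +
      ENNReal.ofReal (1 + t⁻¹) * sqNorm (f + g) (h - h') := by
  simp only [mse, sqNorm]
  rw [mul_left_comm, mul_left_comm (ENNReal.ofReal (1 + t⁻¹)), ← mul_add]
  refine mul_le_mul_right ?_ _
  rw [← lintegral_const_mul' _ _ ENNReal.ofReal_ne_top,
    ← lintegral_const_mul' _ _ ENNReal.ofReal_ne_top, ← lintegral_add_left']
  swap
  · refine AEMeasurable.const_mul (AEStronglyMeasurable.aemeasurable ?_).ennreal_ofReal _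
    exact (aesm_quad hf.measurable ((aesm_beta_smul (aesm_bFun hb)).sub hh)).add
      (aesm_quad hg.measurable hh)
  refine lintegral_mono_ae ?_
  filter_upwards [hf.positive, hg.positive] with lam pf pg
  have h1 := quad_add_le pf ht (beta d τ lam • bFun b lam - h lam) (h lam - h' lam)
  have h2 := quad_add_le pg ht (h lam) (h' lam - h lam)
  rw [sub_add_sub_cancel] at h1
  rw [add_sub_cancel, quad_sub_comm] at h2
  have e1 := quad_nonneg pf (beta d τ lam • bFun b lam - h lam)
  have e2 := quad_nonneg pg (h lam)
  have e3 := quad_nonneg pf (h lam - h' lam)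
  have e4 := quad_nonneg pg (h lam - h' lam)
  have e5 : quad ((f + g) lam) ((h - h') lam) = quad (f lam) (h lam - h' lam) +
    quad (g lam) (h lam - h' lam) := quad_add_left _ _ _
  rw [e5, ← ENNReal.ofReal_mul (by positivity), ← ENNReal.ofReal_mul (by positivity),
    ← ENNReal.ofReal_add (by positivity) (by positivity)]
  refine ENNReal.ofReal_le_ofReal ?_
  linarith

lemma mse_lt_top (hf : IsSpectralDensity d τ f) (hg : IsSpectralDensity d τ g)
    (hb : Summable fun j => ‖b j‖) {h : ℝ → Vec} (hh : h ∈ L20 d τ (f + g)) :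
    mse d τ b h f g < ∞ := by
  have h0 : mse d τ b (fun lam => beta d τ lam • (0 : Vec)) f g < ∞ := by
    rw [mse_beta_smul]
    refine ENNReal.mul_lt_top ENNReal.ofReal_lt_top ?_
    simp only [sub_zero, quad_zero_right, add_zero]
    exact (hf.integrable_quad_of_bound (aesm_bFun hb) (norm_bFun_le hb)).lintegral_lt_top
  refine (mse_le hf hg hb (h := fun lam => beta d τ lam • (0 : Vec)) (h' := h)
    (aesm_beta_smul aestronglyMeasurable_const) one_pos).trans_lt ?_
  refine ENNReal.add_lt_top.2 ⟨ENNReal.mul_lt_top ENNReal.ofReal_lt_top h0,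
    ENNReal.mul_lt_top ENNReal.ofReal_lt_top ?_⟩
  refine lt_of_eq_of_lt ?_ hh.2.1
  simp [sqNorm, quad_neg_right]

lemma mse_tendsto (hf : IsSpectralDensity d τ f) (hg : IsSpectralDensity d τ g)
    (hb : Summable fun j => ‖b j‖) {h : ℝ → Vec} (hh : h ∈ L20 d τ (f + g)) {α : ℕ → ℕ × ℕ →₀ ℂ}
    (hα : Tendsto (fun n => sqNorm (f + g) (h - trigPoly d τ (α n))) atTop (𝓝 0)) :
    Tendsto (fun n => mse d τ b (trigPoly d τ (α n)) f g) atTop (𝓝 (mse d τ b h f g)) := by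
  have hsw : ∀ n, sqNorm (f + g) (trigPoly d τ (α n) - h) =
      sqNorm (f + g) (h - trigPoly d τ (α n)) := fun n => by
    simp only [sqNorm, Pi.sub_apply]
    simp_rw [quad_sub_comm _ (trigPoly d τ (α n) _)]
  have hfin := mse_lt_top hf hg hb hh
  refine tendsto_order.2 ⟨fun c hc => ?_, fun c hc => ?_⟩
  · by_contra hcon
    rw [not_eventually] at hcon
    -- If the errors fell below c infinitely often, the perturbation inequality would give Δ(h) ≤ (1
    -- + t)c for every t > 0, hence Δ(h) ≤ c, a contradiction.
    have key : ∀ t : ℝ, 0 < t → mse d τ b h f g ≤ ENNReal.ofReal (1 + t) * c := by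
      intro t ht
      have hl : Tendsto (fun n => ENNReal.ofReal (1 + t) * c + ENNReal.ofReal (1 + t⁻¹) *
          sqNorm (f + g) (h - trigPoly d τ (α n))) atTop (𝓝 (ENNReal.ofReal (1 + t) * c)) := by
        have := (ENNReal.Tendsto.const_mul (a := ENNReal.ofReal (1 + t⁻¹)) hα
          (Or.inr ENNReal.ofReal_ne_top)).const_add (ENNReal.ofReal (1 + t) * c)
        simpa using this
      refine ge_of_tendsto_of_frequently hl (hcon.mono fun n hn => ?_)
      refine (mse_le hf hg hb (h := trigPoly d τ (α n)) (aesm_trigPoly (α n)) ht).trans ?_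
      rw [hsw]
      gcongr
      exact not_lt.1 hn
    have hl : Tendsto (fun t : ℝ => ENNReal.ofReal (1 + t) * c) (𝓝[>] 0) (𝓝 c) := by
      have h1 : Tendsto (fun t : ℝ => ENNReal.ofReal (1 + t)) (𝓝[>] 0) (𝓝 1) := by
        rw [← ENNReal.ofReal_one]
        refine ENNReal.tendsto_ofReal (Tendsto.mono_left ?_ nhdsWithin_le_nhds)
        exact Continuous.tendsto' (by fun_prop) _ _ (by simp)
      simpa using ENNReal.Tendsto.mul_const h1 (Or.inl one_ne_zero) (b := c)
    have := ge_of_tendsto hl (eventually_nhdsWithin_of_forall fun t ht => key t ht)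
    exact absurd hc (not_lt.2 this)
  · have hl : Tendsto (fun t : ℝ => ENNReal.ofReal (1 + t) * mse d τ b h f g) (𝓝[>] 0)
        (𝓝 (mse d τ b h f g)) := by
      have h1 : Tendsto (fun t : ℝ => ENNReal.ofReal (1 + t)) (𝓝[>] 0) (𝓝 1) := by
        rw [← ENNReal.ofReal_one]
        refine ENNReal.tendsto_ofReal (Tendsto.mono_left ?_ nhdsWithin_le_nhds)
        exact Continuous.tendsto' (by fun_prop) _ _ (by simp)
      simpa using ENNReal.Tendsto.mul_const h1 (Or.inl one_ne_zero) (b := mse d τ b h f g)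
    obtain ⟨t, htc, ht⟩ := ((hl.eventually_lt_const hc).and self_mem_nhdsWithin).exists
    have hl2 : Tendsto (fun n => ENNReal.ofReal (1 + t) * mse d τ b h f g +
        ENNReal.ofReal (1 + t⁻¹) * sqNorm (f + g) (h - trigPoly d τ (α n))) atTop
        (𝓝 (ENNReal.ofReal (1 + t) * mse d τ b h f g)) := by
      have := (ENNReal.Tendsto.const_mul (a := ENNReal.ofReal (1 + t⁻¹)) hα
        (Or.inr ENNReal.ofReal_ne_top)).const_add (ENNReal.ofReal (1 + t) * mse d τ b h f g)
      simpa using this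
    filter_upwards [hl2.eventually_lt_const htc] with n hn
    exact (mse_le hf hg hb hh.1 ht).trans_lt hn

lemma exists_trigPoly_seq {S : Density} {h : ℝ → Vec} (hh : h ∈ L20 d τ S) :
    ∃ α : ℕ → ℕ × ℕ →₀ ℂ, Tendsto (fun n => sqNorm S (h - trigPoly d τ (α n))) atTop (𝓝 0) := by
  choose α hα using fun n : ℕ => hh.2.2 ((n + 1 : ℝ≥0∞)⁻¹) (by simp)
  refine ⟨α, tendsto_of_tendsto_of_tendsto_of_le_of_le tendsto_const_nhds
    ?_ (fun _ => bot_le) fun n => (hα n).le⟩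
  simpa [Function.comp_def] using (ENNReal.tendsto_inv_nat_nhds_zero.comp (tendsto_add_atTop_nat 1))

lemma optMSE_eq_iInf (hf : IsSpectralDensity d τ f) (hg : IsSpectralDensity d τ g)
    (hb : Summable fun j => ‖b j‖) :
    optMSE d τ b f g = ⨅ α, mse d τ b (trigPoly d τ α) f g := by
  refine le_antisymm (le_iInf fun α => iInf₂_le _ (trigPoly_mem_L20 (hf.add hg) α))
    (le_iInf₂ fun h hh => ?_)
  obtain ⟨α, hα⟩ := exists_trigPoly_seq hh
  exact ge_of_tendsto' (mse_tendsto hf hg hb hh hα) fun n => iInf_le _ _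

/-- The common last step of both evaluations of Δ(f, g): a constant plus a nonnegative remainder
with infimum zero. Nonnegativity of V is also recorded, because `ENNReal.ofReal` identifies all
negative numbers with zero. -/
lemma optMSE_eq_ofReal (hf : IsSpectralDensity d τ f) (hg : IsSpectralDensity d τ g)
    (hb : Summable fun j => ‖b j‖) {V : ℝ} {r : (ℕ × ℕ →₀ ℂ) → ℝ} (hr : ∀ α, 0 ≤ r α)
    (hr0 : ∀ ε > 0, ∃ α, r α < ε) (hV : ∀ α, 0 ≤ V + r α)
    (h : ∀ α, mse d τ b (trigPoly d τ α) f g = ENNReal.ofReal (V + r α)) :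
    optMSE d τ b f g = ENNReal.ofReal V ∧ 0 ≤ V := by
  have hV0 : 0 ≤ V := by
    refine le_of_forall_pos_le_add fun ε hε => ?_
    obtain ⟨α, hα⟩ := hr0 ε hε
    linarith [hV α]
  refine ⟨?_, hV0⟩
  rw [optMSE_eq_iInf hf hg hb]
  refine le_antisymm (ENNReal.le_of_forall_pos_le_add fun ε hε _ => ?_)
    (le_iInf fun α => ?_)
  · obtain ⟨α, hα⟩ := hr0 ε hε
    refine (iInf_le _ α).trans ?_
    rw [h, ENNReal.ofReal_add hV0 (hr α), ← ENNReal.ofReal_coe_nnreal]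
    gcongr
  · rw [h]
    exact ENNReal.ofReal_le_ofReal (by linarith [hr α])

lemma mse_beta_smul_eq_ofReal (hf : IsSpectralDensity d τ f) (hg : IsSpectralDensity d τ g)
    {x : ℝ → Vec}
    (h1 : Integrable (fun lam => quad (weighted d τ f lam) (bFun b lam - x lam)) band)
    (h2 : Integrable (fun lam => quad (weighted d τ g lam) (x lam)) band) :
    mse d τ b (fun lam => beta d τ lam • x lam) f g = ENNReal.ofReal (1 / (2 * Real.pi) *
      ∫ lam, (quad (weighted d τ f lam) (bFun b lam - x lam) +
        quad (weighted d τ g lam) (x lam)) ∂band) ∧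
    0 ≤ 1 / (2 * Real.pi) * ∫ lam, (quad (weighted d τ f lam) (bFun b lam - x lam) +
        quad (weighted d τ g lam) (x lam)) ∂band := by
  have h0 : 0 ≤ᵐ[band] fun lam => quad (weighted d τ f lam) (bFun b lam - x lam) +
        quad (weighted d τ g lam) (x lam) := by
    filter_upwards [hf.positive_weighted, hg.positive_weighted] with lam pf pg
    exact add_nonneg (quad_nonneg pf _) (quad_nonneg pg _)
  have hs : Integrable (fun lam => quad (weighted d τ f lam) (bFun b lam - x lam) +
      quad (weighted d τ g lam) (x lam)) band := h1.add h2
  refine ⟨?_, mul_nonneg (by positivity) (integral_nonneg_of_ae h0)⟩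
  rw [mse_beta_smul, ENNReal.ofReal_mul (by positivity),
    ofReal_integral_eq_lintegral_ofReal hs h0]

end MSE

/-! ### The functional of the projection method -/

section FilterValue

variable {d τ : ℕ} {b : ℕ → Vec} {f g : Density}

lemma exists_hasSeries_cpoly (α : ℕ × ℕ →₀ ℂ) : ∃ a, HasSeries (cpoly α) (causal a) := by
  induction α using Finsupp.induction_linear with
  | zero => exact ⟨0, by simp, fun n => by simp [fourierCo, causal]⟩
  | add α β h1 h2 =>
    obtain ⟨a, ha⟩ := h1
    obtain ⟨c, hc⟩ := h2
    refine ⟨a + c, ?_⟩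
    have h1 : (fun n : ℤ => causal a n + causal c n) = causal (a + c) := by
      ext1 n
      simp only [causal]
      split_ifs <;> simp
    rw [map_add, ← h1]
    exact ha.add hc
  | single p z =>
    refine ⟨fun j => if j = p.1 then z • unitVec p.2 else 0, ?_⟩
    have h1 : cpoly (Finsupp.single p z) = fun lam => ee p.1 lam • z • unitVec p.2 := by
      ext1 lam
      rw [cpoly_apply, Finsupp.sum_single_index (by simp), smul_comm]
    have h2 := hasSeries_ee_smul_const (p.1 : ℤ) (z • unitVec p.2)
    rw [h1]
    convert h2 using 1
    ext1 n
    simp only [causal]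
    split_ifs <;> first | rfl | omega

lemma IsSpectralDensity.exists_approx_real {S : Density} (hS : IsSpectralDensity d τ S)
    {x : ℝ → Vec}
    (hxi : ∀ α, Integrable (fun lam => quad (weighted d τ S lam) (x lam - cpoly α lam)) band)
    (hxA : Approx d τ S x) {ε : ℝ} (hε : 0 < ε) :
    ∃ α, 1 / (2 * Real.pi) * ∫ lam, quad (weighted d τ S lam) (x lam - cpoly α lam) ∂band < ε := by
  obtain ⟨α, hα⟩ := hxA (ENNReal.ofReal (2 * Real.pi * ε)) (by simp; positivity)
  refine ⟨α, ?_⟩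
  rw [← ofReal_integral_eq_lintegral_ofReal (hxi α), ENNReal.ofReal_lt_ofReal_iff (by positivity)]
    at hα
  · rw [one_div, inv_mul_lt_iff₀ (by positivity)]
    exact hα
  · filter_upwards [hS.positive_weighted] with lam h using quad_nonneg h _

/-- The form of A + B at v equals Re⟨v, A y⟩; Cauchy–Schwarz for A together with A ≤ A + B lets one
factor be cancelled. It shows that v = (f + g)⁻¹ f B lies in L₂ with weight w(f + g), although the
inverse is unbounded. -/
lemma quad_le_quad_of_apply_eq {A B : Vec →L[ℂ] Vec} (hA : A.IsPositive) (hB : B.IsPositive)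
    {v y : Vec} (h : (A + B) v = A y) : quad (A + B) v ≤ quad A y := by
  have h1 : quad (A + B) v = (inner ℂ v (A y)).re := by rw [quad, h]
  have h2 := (Complex.re_le_norm _).trans (norm_inner_sq_le hA v y)
  rw [← h1] at h2
  have h3 : √(quad A v) ≤ √(quad (A + B) v) := Real.sqrt_le_sqrt (quad_le_of_add hB v)
  have h0 := quad_nonneg (hA.add hB) v
  have h0' := quad_nonneg hA y
  have h4 : √(quad (A + B) v) * √(quad (A + B) v) ≤ √(quad (A + B) v) * √(quad A y) := by
    rw [Real.mul_self_sqrt h0]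
    exact h2.trans (by gcongr)
  rcases (Real.sqrt_nonneg (quad (A + B) v)).eq_or_lt with h5 | h5
  · rw [← Real.mul_self_sqrt h0, ← h5, zero_mul]; exact h0'
  · have h6 := le_of_mul_le_mul_left h4 h5
    rwa [Real.sqrt_le_sqrt_iff h0'] at h6

lemma IsSpectralDensity.integrable_quad_of_le {S : Density} (hS : IsSpectralDensity d τ S)
    {x : ℝ → Vec} (hx : AEStronglyMeasurable x band) {G : ℝ → ℝ} (hG : Integrable G band)
    (h : ∀ᵐ lam ∂band, quad (weighted d τ S lam) (x lam) ≤ G lam) :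
    Integrable (fun lam => quad (weighted d τ S lam) (x lam)) band := by
  refine hG.mono' (aesm_quad hS.measurable_weighted hx) ?_
  filter_upwards [h, hS.positive_weighted] with lam h1 h2
  rwa [Real.norm_of_nonneg (quad_nonneg h2 _)]

lemma IsSpectralDensity.integrable_quad_sub {S : Density} (hS : IsSpectralDensity d τ S)
    {x y : ℝ → Vec} (hx : AEStronglyMeasurable x band) (hy : AEStronglyMeasurable y band)
    (hxi : Integrable (fun lam => quad (weighted d τ S lam) (x lam)) band)
    (hyi : Integrable (fun lam => quad (weighted d τ S lam) (y lam)) band) :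
    Integrable (fun lam => quad (weighted d τ S lam) (x lam - y lam)) band := by
  refine hS.integrable_quad_of_le (hx.sub hy)
    ((hxi.const_mul (1 + 1)).add (hyi.const_mul (1 + 1⁻¹))) ?_
  filter_upwards [hS.positive_weighted] with lam h
  have := quad_add_le h one_pos (x lam) (-y lam)
  rwa [quad_neg_right, ← sub_eq_add_neg] at this

/-- Write S = w(f + g) and ⟨x⟩_A for the form of A. As w f B = S v, the integrand for βp equals
⟨B⟩_{wf} - ⟨v⟩_S + ⟨v - p⟩_S. Splitting v - p = (v - u - p) + u gives ⟨v - u - p⟩_S + 2 Re⟨v - u -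
p, C⟩ + ⟨u⟩_S. The middle term integrates to zero, and the first is the remainder r(p). -/
lemma optMSE_of_solution (hf : IsSpectralDensity d τ f) (hg : IsSpectralDensity d τ g)
    (hb : Summable fun j => ‖b j‖) {v u C : ℝ → Vec} {c : ℕ → Vec} (hv : Integrable v band)
    (hvf : ∀ᵐ lam ∂band, weighted d τ (f + g) lam (v lam) = weighted d τ f lam (bFun b lam))
    (hC : HasSeries C (anticausal c)) (hu : Integrable u band)
    (huC : ∀ᵐ lam ∂band, weighted d τ (f + g) lam (u lam) = C lam)
    (huS : Integrable (fun lam => quad (weighted d τ (f + g) lam) (u lam)) band)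
    (he : ∀ n : ℤ, 1 ≤ n → fourierCo (fun lam => v lam - u lam) n = 0) :
    optMSE d τ b f g = ENNReal.ofReal (1 / (2 * Real.pi) * ∫ lam,
      (quad (weighted d τ f lam) (bFun b lam) - quad (weighted d τ (f + g) lam) (v lam) +
        quad (weighted d τ (f + g) lam) (u lam)) ∂band) ∧
    0 ≤ 1 / (2 * Real.pi) * ∫ lam,
      (quad (weighted d τ f lam) (bFun b lam) - quad (weighted d τ (f + g) lam) (v lam) +
        quad (weighted d τ (f + g) lam) (u lam)) ∂band := by
  have hS := hf.add hg
  have hB := hf.integrable_quad_of_bound (aesm_bFun hb) (norm_bFun_le hb)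
  have hvS : Integrable (fun lam => quad (weighted d τ (f + g) lam) (v lam)) band := by
    refine hS.integrable_quad_of_le hv.1 hB ?_
    filter_upwards [hvf, hf.positive_weighted, hg.positive_weighted] with lam h pf pg
    rw [weighted_add] at h ⊢
    exact quad_le_quad_of_apply_eq pf pg h
  have hea : Integrable (fun lam => v lam - u lam) band := hv.sub hu
  have heS := hS.integrable_quad_sub hv.1 hu.1 hvS huS
  have hpS : ∀ α, Integrable (fun lam => quad (weighted d τ (f + g) lam) (cpoly α lam)) band :=
    fun α => by
      obtain ⟨h1, K, hK⟩ := cpoly_continuous_bdd α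
      exact hS.integrable_quad_of_bound h1.aestronglyMeasurable hK
  have hpm : ∀ α, AEStronglyMeasurable (cpoly α) band :=
    fun α => (cpoly_continuous_bdd α).1.aestronglyMeasurable
  have hepS := fun α => hS.integrable_quad_sub hea.1 (hpm α) heS (hpS α)
  -- The target v - u has no positive frequencies, so causal polynomials approach it in the weighted
  -- space.
  have hA := approx_of_causal hS hea he heS
  have hpi : ∀ α, Integrable (cpoly α) band := fun α => by
    obtain ⟨h1, K, hK⟩ := cpoly_continuous_bdd α
    exact Integrable.of_bound h1.aestronglyMeasurable K (Eventually.of_forall hK)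
  have hp0 : ∀ α, ∀ n : ℤ, 1 ≤ n → fourierCo (cpoly α) n = 0 := by
    intro α n hn
    obtain ⟨a, ha⟩ := exists_hasSeries_cpoly α
    rw [ha.2, causal_of_pos _ hn]
  have hCi : ∀ α, Integrable (fun lam => inner ℂ (C lam) (v lam - u lam - cpoly α lam)) band :=
    fun α => by
      refine (huS.add (hepS α)).mono' (hC.1.1.inner (hea.1.sub (hpm α))) ?_
      filter_upwards [huC, hS.positive_weighted] with lam h hp
      have h1 := norm_inner_le_quad hp (v lam - u lam - cpoly α lam) (u lam)
      rw [h, norm_inner_symm] at h1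
      rw [Pi.add_apply]
      linarith
  -- C has only positive frequencies and v - u - p only nonpositive ones. Their product is
  -- integrable because its modulus is bounded by the forms of S at u and at v - u - p.
  have hC0 : ∀ α, ∫ lam, (inner ℂ (C lam) (v lam - u lam - cpoly α lam)).re ∂band = 0 := fun α => by
    have h1 := integral_inner_anticausal_causal hC (fun n hn => by
      rw [anticausal, if_neg (by omega)]) (hea.sub (hpi α)) (fun n hn => by
        have := fourierCo_sub hea (hpi α) n
        rw [he n hn, hp0 α n hn, sub_zero] at this
        exact this) (by exact hCi α)
    have h2 := integral_re (hCi α)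
    simp only [RCLike.re_eq_complex_re] at h2
    rw [h2]
    simp only [Pi.sub_apply] at h1
    rw [h1]
    simp
  set V := 1 / (2 * Real.pi) * ∫ lam,
      (quad (weighted d τ f lam) (bFun b lam) - quad (weighted d τ (f + g) lam) (v lam) +
        quad (weighted d τ (f + g) lam) (u lam)) ∂band with hV
  set r : (ℕ × ℕ →₀ ℂ) → ℝ := fun α => 1 / (2 * Real.pi) *
    ∫ lam, quad (weighted d τ (f + g) lam) (v lam - u lam - cpoly α lam) ∂band with hr
  have hkey : ∀ α, 1 / (2 * Real.pi) * ∫ lam, (quad (weighted d τ f lam) (bFun b lam - cpoly α lam) +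
        quad (weighted d τ g lam) (cpoly α lam)) ∂band = V + r α := by
    intro α
    have hD : Integrable (fun lam => quad (weighted d τ f lam) (bFun b lam) -
        quad (weighted d τ (f + g) lam) (v lam) + quad (weighted d τ (f + g) lam) (u lam)) band :=
      (hB.sub hvS).add huS
    have hE : Integrable (fun lam => quad (weighted d τ f lam) (bFun b lam) -
        quad (weighted d τ (f + g) lam) (v lam) + quad (weighted d τ (f + g) lam) (u lam) +
        quad (weighted d τ (f + g) lam) (v lam - u lam - cpoly α lam)) band := hD.add (hepS α)
    have hR : Integrable (fun lam => 2 * (inner ℂ (C lam) (v lam - u lam - cpoly α lam)).re) band :=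
      (hCi α).re.const_mul 2
    rw [hV, hr, ← mul_add, ← integral_add hD (hepS α)]
    have h1 : ∫ lam, (quad (weighted d τ f lam) (bFun b lam - cpoly α lam) +
        quad (weighted d τ g lam) (cpoly α lam)) ∂band =
        ∫ lam, ((quad (weighted d τ f lam) (bFun b lam) -
        quad (weighted d τ (f + g) lam) (v lam) + quad (weighted d τ (f + g) lam) (u lam) +
        quad (weighted d τ (f + g) lam) (v lam - u lam - cpoly α lam)) +
        2 * (inner ℂ (C lam) (v lam - u lam - cpoly α lam)).re) ∂band := by
      refine integral_congr_ae ?_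
      filter_upwards [hvf, huC, hf.positive_weighted, hg.positive_weighted, hS.positive_weighted]
        with lam hv hu pf pg pS
      have e1 : quad (weighted d τ (f + g) lam) (cpoly α lam) =
          quad (weighted d τ f lam) (cpoly α lam) + quad (weighted d τ g lam) (cpoly α lam) := by
        rw [weighted_add, quad_add_left]
      have e2 := quad_sub_right pf (cpoly α lam) (bFun b lam)
      rw [← hv] at e2
      have e3 := quad_sub_right pS (cpoly α lam) (v lam)
      have e4 := quad_add_right pS (v lam - u lam - cpoly α lam) (u lam)
      rw [hu] at e4
      have e5 : v lam - u lam - cpoly α lam + u lam = v lam - cpoly α lam := by abel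
      rw [e5, quad_sub_comm] at e4
      have e6 : (inner ℂ (v lam - u lam - cpoly α lam) (C lam)).re =
          (inner ℂ (C lam) (v lam - u lam - cpoly α lam)).re := by
        rw [← inner_conj_symm, Complex.conj_re]
      rw [e6] at e4
      rw [quad_sub_comm (weighted d τ f lam) (bFun b lam)]
      linarith
    rw [h1, integral_add hE hR, integral_const_mul, hC0 α, mul_zero, add_zero]
  have hmse := fun α => mse_beta_smul_eq_ofReal (b := b) hf hg (x := cpoly α)
    (hf.integrable_quad_sub (aesm_bFun hb) (hpm α) hB (by
      obtain ⟨h1, K, hK⟩ := cpoly_continuous_bdd α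
      exact hf.integrable_quad_of_bound h1.aestronglyMeasurable hK))
    (by
      obtain ⟨h1, K, hK⟩ := cpoly_continuous_bdd α
      exact hg.integrable_quad_of_bound h1.aestronglyMeasurable hK)
  simp only [hkey] at hmse
  refine optMSE_eq_ofReal hf hg hb (r := r) (fun α => ?_) (fun ε hε => ?_) (fun α => (hmse α).2)
    (fun α => by rw [trigPoly_eq_fun]; exact (hmse α).1)
  · refine mul_nonneg (by positivity) (integral_nonneg_of_ae ?_)
    filter_upwards [hS.positive_weighted] with lam h using quad_nonneg h _
  · exact hS.exists_approx_real hepS hA hε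

/-- `⟨c, y⟩` is the integral of the quadratic form of `u`. -/
lemma tsum_inner_anticausal {S : Density} (hS : IsSpectralDensity d τ S)
    {u C : ℝ → Vec} {c y : ℕ → Vec} (hy : Summable fun l => ‖y l‖ ^ 2)
    (hC : HasSeries C (anticausal c)) (hu : Integrable u band)
    (huC : ∀ᵐ lam ∂band, weighted d τ S lam (u lam) = C lam)
    (huS : Integrable (fun lam => quad (weighted d τ S lam) (u lam)) band)
    (hyu : ∀ l : ℕ, y l = fourierCo u (l + 1)) :
    (∑' l, inner ℂ (c l) (y l)).re =
      1 / (2 * Real.pi) * ∫ lam, quad (weighted d τ S lam) (u lam) ∂band := by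
  have hinj : Function.Injective fun l : ℕ => (l : ℤ) + 1 := fun i j h => by simpa using h
  have hanti : ∀ (z : ℕ → Vec) (l : ℕ), anticausal z ((l : ℤ) + 1) = z l := fun z l => by
    rw [anticausal, if_pos (by omega)]; simp
  have hanti0 : ∀ (z : ℕ → Vec) (n : ℤ), n ∉ Set.range (fun l : ℕ => (l : ℤ) + 1) →
      anticausal z n = 0 := fun z n hn => by
    rw [anticausal, if_neg]
    intro h
    exact hn ⟨(n - 1).toNat, by simp only; omega⟩
  have hys : Summable fun n => ‖anticausal y n‖ ^ 2 := by
    rw [← hinj.summable_iff (fun n hn => by rw [hanti0 y n hn]; simp)]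
    simpa [Function.comp_def, hanti] using hy
  obtain ⟨Y, hY⟩ := exists_hasSeries hys
  have h1 := hC.hasSum_inner hY
  rw [← hinj.hasSum_iff (fun n hn => by rw [hanti0 y n hn, inner_zero_right])] at h1
  simp only [Function.comp_def, hanti] at h1
  have hcu : Integrable (fun lam => inner ℂ (C lam) (u lam)) band := by
    refine (huS.add huS).mono' (hC.1.1.inner hu.1) ?_
    filter_upwards [huC, hS.positive_weighted] with lam h hp
    rw [← norm_inner_symm, ← h]
    exact norm_inner_le_quad hp _ _
  have hcY := integrable_inner_of_memLp hC.1 hY.1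
  -- Y is the square-integrable function with coefficients y. It agrees with u at all positive
  -- frequencies, so u - Y is causal and the pairing with C does not distinguish them.
  have h2 : ∫ lam, inner ℂ (C lam) (u lam - Y lam) ∂band = 0 := by
    refine integral_inner_anticausal_causal hC (fun n hn => by
      rw [anticausal, if_neg (by omega)]) (hu.sub hY.integrable) (fun n hn => ?_) ?_
    · have := fourierCo_sub hu hY.integrable n
      obtain ⟨l, rfl⟩ : ∃ l : ℕ, n = l + 1 := ⟨(n - 1).toNat, by omega⟩
      rw [hY.2, hanti, ← hyu, sub_self] at this
      exact this
    · simp only [inner_sub_right]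
      exact hcu.sub hcY
  simp only [inner_sub_right] at h2
  rw [integral_sub hcu hcY, sub_eq_zero] at h2
  rw [h1.tsum_eq, ← h2]
  have h3 : ∫ lam, quad (weighted d τ S lam) (u lam) ∂band =
      (∫ lam, inner ℂ (C lam) (u lam) ∂band).re := by
    have h4 := integral_re hcu
    simp only [RCLike.re_eq_complex_re] at h4
    rw [← h4]
    refine integral_congr_ae ?_
    filter_upwards [huC] with lam h
    rw [quad, h, ← inner_conj_symm, Complex.conj_re]
  rw [h3]
  have : (1 / (2 * Real.pi) : ℂ) = ((1 / (2 * Real.pi) : ℝ) : ℂ) := by push_cast; rfl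
  rw [this, Complex.re_ofReal_mul]

/-- `optMSE_of_solution` is applied to the witnesses of R and P. The term ⟨P c, c⟩ is the form of S
= w(f + g) at u, and ⟨Q b, b⟩ is the form of w f at B minus that of S at v, since w g v = w f B - w
f v. -/
lemma filterValue_eq (hf : IsSpectralDensity d τ f) (hg : IsSpectralDensity d τ g)
    (hb : Summable fun j => ‖b j‖) {fromNoise : Bool} {J : ℝ}
    (hJ : IsFilterValue d τ b fromNoise f g J) :
    optMSE d τ b f g = ENNReal.ofReal J ∧ 0 ≤ J := by
  obtain ⟨y, c, q, hR, ⟨hy, C, u, hC, hu, huC, huS, hyu⟩, hQ, rfl⟩ := hJ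
  have hS := hf.add hg
  have hBs := hasSeries_bFun hb
  have hv : ∃ v u' C' : ℝ → Vec, ∃ c' : ℕ → Vec, Integrable v band ∧
      (∀ᵐ lam ∂band, weighted d τ (f + g) lam (v lam) = weighted d τ f lam (bFun b lam)) ∧
      HasSeries C' (anticausal c') ∧ Integrable u' band ∧
      (∀ᵐ lam ∂band, weighted d τ (f + g) lam (u' lam) = C' lam) ∧
      (∀ lam, quad (weighted d τ (f + g) lam) (u' lam) =
        quad (weighted d τ (f + g) lam) (u lam)) ∧
      ∀ n : ℤ, 1 ≤ n → fourierCo (fun lam => v lam - u' lam) n = 0 := by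
    obtain ⟨-, X, v, hX, hv, hvX, hyv⟩ := hR
    have hXB := hX.ae_eq hBs
    cases fromNoise with
    | false =>
      refine ⟨v, u, C, c, hv, ?_, hC, hu, huC, fun _ => rfl, fun n hn => ?_⟩
      · filter_upwards [hvX, hXB] with lam h h'
        simpa [h'] using h
      · obtain ⟨l, rfl⟩ : ∃ l : ℕ, n = l + 1 := ⟨(n - 1).toNat, by omega⟩
        rw [fourierCo_sub hv hu, ← hyu, ← hyv, sub_self]
    | true =>
      -- Here v represents (f + g)⁻¹ g B, and (f + g)⁻¹ f B = B - v. Since B has no positive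
      -- frequencies, the coefficients in question change sign; so do u, C and c, which leaves the
      -- forms unchanged.
      refine ⟨fun lam => bFun b lam - v lam, fun lam => (-1 : ℂ) • u lam,
        fun lam => (-1 : ℂ) • C lam, fun l => (-1 : ℂ) • c l, hBs.integrable.sub hv, ?_, ?_,
        by exact hu.smul (-1 : ℂ), ?_, fun lam => by rw [quad_smul_right]; simp, fun n hn => ?_⟩
      · filter_upwards [hvX, hXB] with lam h h'
        rw [map_sub, h, h', weighted_add]
        simp
      · convert hC.smul (-1) using 1
        ext n
        simp only [anticausal]
        split_ifs <;> simp
      · filter_upwards [huC] with lam h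
        rw [map_smul, h]
      · obtain ⟨l, rfl⟩ : ∃ l : ℕ, n = l + 1 := ⟨(n - 1).toNat, by omega⟩
        have hBv : Integrable (fun lam => bFun b lam - v lam) band := hBs.integrable.sub hv
        have hun : Integrable (fun lam => (-1 : ℂ) • u lam) band := hu.smul (-1 : ℂ)
        rw [fourierCo_sub hBv hun, fourierCo_sub hBs.integrable hv, fourierCo_smul, ← hyu, ← hyv, hBs.2,
          causal_of_pos _ hn]
        simp
  obtain ⟨v, u', C', c', hv, hvf, hC', hu', huC', hqu, he⟩ := hv
  have hmain := optMSE_of_solution hf hg hb hv hvf hC' hu' huC' (by simpa only [hqu] using huS) he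
  simp only [hqu] at hmain
  suffices h : (∑' l, inner ℂ (c l) (y l)).re + (∑' l, inner ℂ (b l) (q l)).re =
      1 / (2 * Real.pi) * ∫ lam,
      (quad (weighted d τ f lam) (bFun b lam) - quad (weighted d τ (f + g) lam) (v lam) +
        quad (weighted d τ (f + g) lam) (u lam)) ∂band by
    rw [h]; exact hmain
  have hB := hf.integrable_quad_of_bound (aesm_bFun hb) (norm_bFun_le hb)
  have hvS : Integrable (fun lam => quad (weighted d τ (f + g) lam) (v lam)) band := by
    refine hS.integrable_quad_of_le hv.1 hB ?_
    filter_upwards [hvf, hf.positive_weighted, hg.positive_weighted] with lam h pf pg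
    rw [weighted_add] at h ⊢
    exact quad_le_quad_of_apply_eq pf pg h
  have hBv : Integrable (fun lam => quad (weighted d τ f lam) (bFun b lam) -
      quad (weighted d τ (f + g) lam) (v lam)) band := hB.sub hvS
  rw [integral_add hBv huS, mul_add, tsum_inner_anticausal hS hy hC hu huC huS hyu, add_comm]
  congr 1
  obtain ⟨X, v₁, hX, hv₁, hvX, hgv, hq⟩ := hQ
  have h1 := hasSum_inner_bFun hb hgv
  simp_rw [hq]
  rw [h1.tsum_eq]
  have h2 : Integrable (fun lam => inner ℂ (bFun b lam) (weighted d τ g lam (v₁ lam))) band := by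
    refine (hgv.norm.const_mul (∑' j, ‖b j‖)).mono' ((aesm_bFun hb).inner hgv.1)
      (Eventually.of_forall fun lam => (norm_inner_le_norm _ _).trans ?_)
    gcongr
    exact norm_bFun_le hb lam
  have h3 := integral_re h2
  simp only [RCLike.re_eq_complex_re] at h3
  have : (1 / (2 * Real.pi) : ℂ) = ((1 / (2 * Real.pi) : ℝ) : ℂ) := by push_cast; rfl
  rw [this, Complex.re_ofReal_mul, ← h3]
  congr 1
  refine integral_congr_ae ?_
  filter_upwards [hvX, hvf, hX.ae_eq hBs, hS.positive_weighted, hf.positive_weighted]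
    with lam h4 h5 h6 pS pf
  rw [h6] at h4
  have e1 : weighted d τ g lam (v₁ lam) =
      weighted d τ f lam (bFun b lam) - weighted d τ f lam (v₁ lam) := by
    rw [← h4, weighted_add]; simp
  have hsym : ∀ {A : Vec →L[ℂ] Vec}, A.IsPositive → ∀ x y : Vec,
      (inner ℂ x (A y)).re = (inner ℂ y (A x)).re := fun hA x y => by
    obtain ⟨L, hL⟩ := exists_sq_root hA
    rw [hL, hL, ← inner_conj_symm, Complex.conj_re]
  rw [e1, inner_sub_right, Complex.sub_re, hsym pf (bFun b lam) (v₁ lam), ← h4]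
  -- The witnesses v of R and v₁ of Q may differ by an element of the kernel of f + g; the symmetric
  -- form depends only on their common image.
  have e2 : (inner ℂ (v₁ lam) (weighted d τ (f + g) lam (v₁ lam))).re =
      quad (weighted d τ (f + g) lam) (v lam) := by
    rw [h4, ← h5, hsym pS, h4, ← h5]; rfl
  rw [e2, h4]
  rfl

end FilterValue

/-! ### Conjugation and coordinates -/

lemma star_vec_apply (x : Vec) (k : ℕ) : star x k = star (x k) := rfl

lemma inner_star_star (x y : Vec) : inner ℂ (star x) (star y) = inner ℂ y x := by
  rw [← (hasSum_inner_vec (star x) (star y)).tsum_eq, ← (hasSum_inner_vec y x).tsum_eq]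
  refine tsum_congr fun k => ?_
  simp [mul_comm]

lemma inner_star_left_eq_tsum (x y : Vec) : inner ℂ (star x) y = ∑' i, x i * y i := by
  rw [← (hasSum_inner_vec (star x) y).tsum_eq]
  refine tsum_congr fun k => ?_
  simp [mul_comm]

lemma fourierCo_coord {u : ℝ → Vec} (hu : Integrable u band) (n : ℤ) (k : ℕ) :
    fourierCo u n k = fourierCo (fun lam => u lam k) n := by
  have h := fourierCo_map (innerSL ℂ (unitVec k)) hu n
  simp only [innerSL_apply_apply, inner_unitVec] at h
  exact h.symm

lemma HasSeries.coord {u : ℝ → Vec} {a : ℤ → Vec} (hu : HasSeries u a) (k : ℕ) :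
    HasSeries (fun lam => u lam k) (fun n => a n k) := by
  have h := hu.map (innerSL ℂ (unitVec k))
  simpa only [innerSL_apply_apply, inner_unitVec] using h

lemma fourierCo_star {u : ℝ → ℂ} (n : ℤ) :
    fourierCo (fun lam => star (u lam)) n = star (fourierCo u (-n)) := by
  rw [fourierCo_eq, fourierCo_eq, smul_eq_mul, smul_eq_mul, star_mul', RCLike.star_def,
    ← integral_conj]
  congr 1
  · simp [map_ofNat]
  · congr 1
    ext lam
    simp [conj_ee]

lemma fourierCo_star_vec {u : ℝ → Vec} (hu : Integrable u band) (n : ℤ) :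
    fourierCo (fun lam => star (u lam)) n = star (fourierCo u (-n)) := by
  have hs : Integrable (fun lam => star (u lam)) band :=
    hu.mono (continuous_star.comp_aestronglyMeasurable hu.1)
      (Eventually.of_forall fun lam => by simp)
  ext k
  rw [fourierCo_coord hs, star_vec_apply, fourierCo_coord hu]
  exact fourierCo_star n

lemma integrable_star_vec {u : ℝ → Vec} (hu : Integrable u band) :
    Integrable (fun lam => star (u lam)) band :=
  hu.mono (continuous_star.comp_aestronglyMeasurable hu.1)
    (Eventually.of_forall fun lam => by simp)

lemma HasSeries.star_vec {u : ℝ → Vec} {a : ℤ → Vec} (hu : HasSeries u a) :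
    HasSeries (fun lam => star (u lam)) (fun n => star (a (-n))) :=
  ⟨hu.1.of_le (continuous_star.comp_aestronglyMeasurable hu.1.1)
    (Eventually.of_forall fun lam => by simp), fun n => by
      rw [fourierCo_star_vec hu.integrable, hu.2]⟩

lemma summable_norm_sq_iff_prod {a : ℕ → Vec} :
    (Summable fun p : ℕ × ℕ => ‖a p.1 p.2‖ ^ 2) ↔ Summable fun n => ‖a n‖ ^ 2 := by
  rw [summable_prod_of_nonneg (fun p => by positivity)]
  simp only [fun n => (hasSum_norm_sq (a n)).tsum_eq]
  exact and_iff_right fun n => (hasSum_norm_sq (a n)).summable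

lemma exists_vec_seq {z : ℕ → ℕ → ℂ} (hz : Summable fun p : ℕ × ℕ => ‖z p.1 p.2‖ ^ 2) :
    ∃ a : ℕ → Vec, (∀ n m, a n m = z n m) ∧ Summable fun n => ‖a n‖ ^ 2 := by
  have h1 : ∀ n, Memℓp (z n) 2 := fun n => memℓp_gen (by simpa using hz.prod_factor n)
  refine ⟨fun n => ⟨z n, h1 n⟩, fun n m => rfl, ?_⟩
  rw [← summable_norm_sq_iff_prod]
  exact hz

/-- The coefficient functionals are unconditional sums over pairs (frequency, component); absolute
summability of the products justifies summing the components first. -/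
lemma hasSum_prod_inner {a c : ℕ → Vec} (ha : Summable fun n => ‖a n‖ ^ 2)
    (hc : Summable fun n => ‖c n‖ ^ 2) {s : ℂ} (hs : HasSum (fun n => inner ℂ (a n) (c n)) s) :
    HasSum (fun p : ℕ × ℕ => star (a p.1 p.2) * c p.1 p.2) s := by
  have h1 : Summable fun p : ℕ × ℕ => star (a p.1 p.2) * c p.1 p.2 := by
    refine Summable.of_norm_bounded ((summable_norm_sq_iff_prod.2 ha).add
      (summable_norm_sq_iff_prod.2 hc)) fun p => ?_
    rw [norm_mul, norm_star]
    nlinarith [sq_nonneg (‖a p.1 p.2‖ - ‖c p.1 p.2‖), sq_nonneg ‖a p.1 p.2‖,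
      sq_nonneg ‖c p.1 p.2‖]
  have h2 := h1.hasSum.prod_fiberwise fun n => by
    have := hasSum_inner_vec (a n) (c n)
    simpa only [RCLike.inner_apply, mul_comm, RCLike.star_def] using this
  rw [← h2.unique hs]
  exact h1.hasSum

lemma sqSum_eq {a : ℕ → Vec} {z : ℕ → ℕ → ℂ} (h : ∀ n m, a n m = z n m) {s : ℝ}
    (hs : HasSum (fun n => ‖a n‖ ^ 2) s) : sqSum z = s := by
  simp only [sqSum, ← h]
  have h1 := (summable_norm_sq_iff_prod.2 hs.summable)
  exact (h1.hasSum.prod_fiberwise fun n => hasSum_norm_sq (a n)).unique hs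

/-- The Fourier coefficients of the product of causal functions. -/
lemma hasSum_inner_shift {u v : ℝ → Vec} {a c : ℕ → Vec} (hu : HasSeries u (causal a))
    (hv : HasSeries v (causal c)) (n : ℕ) :
    HasSum (fun l => inner ℂ (a l) (c (l + n)))
      (fourierCo (fun lam => inner ℂ (u lam) (v lam)) (-(n : ℤ))) := by
  have h := hu.hasSum_inner (hv.ee_smul (-(n : ℤ)))
  rw [hasSum_causal_iff (a := a) (G := fun k x => inner ℂ x (causal c (k + -(n : ℤ))))
    (fun n => inner_zero_left _)] at h
  have h2 : ∀ l : ℕ, causal c (-(l : ℤ) + -(n : ℤ)) = c (l + n) := fun l => by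
    rw [← neg_add, ← Nat.cast_add, causal_neg]
  simp only [h2, inner_smul_right] at h
  exact h

/-- A causal square-integrable function and a strictly anticausal integrable one. -/
lemma fourierCo_inner_eq_zero {u v : ℝ → Vec} {a : ℕ → Vec} (hu : HasSeries u (causal a))
    (hv : Integrable v band) (hv0 : ∀ k : ℤ, k ≤ 0 → fourierCo v k = 0)
    (huv : Integrable (fun lam => inner ℂ (u lam) (v lam)) band) (n : ℕ) :
    fourierCo (fun lam => inner ℂ (u lam) (v lam)) (-(n : ℤ)) = 0 := by
  -- Conjugation exchanges causal and anticausal. Shifting ū by n + 1 leaves only positive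
  -- frequencies; v̄ has only negative ones, since v has none at zero, so a shift by one still
  -- leaves it causal.
  have hC := hu.star_vec.ee_smul (-(n + 1 : ℤ))
  have key : ∀ lam, inner ℂ (ee (-(n + 1 : ℤ)) lam • star (u lam)) (ee (-1) lam • star (v lam)) =
      starRingEnd ℂ (ee (-(n : ℤ)) lam • inner ℂ (u lam) (v lam)) := fun lam => by
    rw [inner_smul_left, inner_smul_right, inner_star_star, conj_ee, ← mul_assoc, ← ee_add,
      smul_eq_mul, map_mul, conj_ee, inner_conj_symm]
    congr 2
    ring
  have h := integral_inner_anticausal_causal hC (fun k hk => by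
      rw [causal_of_pos _ (by omega), star_zero])
    (integrable_ee_smul (integrable_star_vec hv) (-1)) (fun k hk => by
      rw [fourierCo_ee_smul, fourierCo_star_vec hv, hv0 _ (by omega), star_zero])
    (by
      simp only [key]
      exact Complex.conjCLE.toContinuousLinearMap.integrable_comp (integrable_ee_smul huv _))
  simp only [key] at h
  rw [integral_conj, map_eq_zero] at h
  rw [fourierCo_eq, h, smul_zero]

/-! ### The operators `Φ^⊤` -/

lemma summable_rows {Φ : ℕ → Vec} (h : Summable fun m => ‖Φ m‖ ^ 2) (x : Vec) :
    Summable (fun m => ‖inner ℂ (star (Φ m)) x‖ ^ 2) ∧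
      ∑' m, ‖inner ℂ (star (Φ m)) x‖ ^ 2 ≤ (∑' m, ‖Φ m‖ ^ 2) * ‖x‖ ^ 2 := by
  have hb : ∀ m, ‖inner ℂ (star (Φ m)) x‖ ^ 2 ≤ ‖Φ m‖ ^ 2 * ‖x‖ ^ 2 := fun m => by
    rw [← mul_pow]
    gcongr
    simpa using norm_inner_le_norm (𝕜 := ℂ) (star (Φ m)) x
  have hs := Summable.of_nonneg_of_le (fun m => by positivity) hb (h.mul_right _)
  refine ⟨hs, ?_⟩
  rw [← tsum_mul_right]
  exact hs.tsum_le_tsum hb (h.mul_right _)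

open Classical in
/-- The operator `x ↦ Φ^⊤ x` with the rows `Φ m`; zero unless `Φ` is a Hilbert–Schmidt matrix. -/
def rowOp (Φ : ℕ → Vec) : Vec →L[ℂ] Vec :=
  if h : Summable fun m => ‖Φ m‖ ^ 2 then
    LinearMap.mkContinuous
      { toFun := fun x => ⟨fun m => inner ℂ (star (Φ m)) x,
          memℓp_gen (by simpa using (summable_rows h x).1)⟩
        map_add' := fun x y => by ext m; exact inner_add_right _ _ _
        map_smul' := fun z x => by ext m; exact inner_smul_right _ _ _ }
      √(∑' m, ‖Φ m‖ ^ 2) (fun x => by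
        rw [← Real.sqrt_sq (norm_nonneg x), ← Real.sqrt_mul (tsum_nonneg fun m => by positivity)]
        refine Real.le_sqrt_of_sq_le ?_
        rw [← (hasSum_norm_sq _).tsum_eq]
        exact (summable_rows h x).2)
  else 0

lemma rowOp_apply {Φ : ℕ → Vec} (h : Summable fun m => ‖Φ m‖ ^ 2) (x : Vec) (m : ℕ) :
    rowOp Φ x m = inner ℂ (star (Φ m)) x := by
  rw [rowOp, dif_pos h]; rfl

lemma inner_star_unitVec (x : Vec) (k : ℕ) : inner ℂ (star x) (unitVec k) = x k := by
  rw [← inner_conj_symm, inner_unitVec, star_vec_apply]; simp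

lemma rowOp_unitVec {Φ : ℕ → Vec} (h : Summable fun m => ‖Φ m‖ ^ 2) (k m : ℕ) :
    rowOp Φ (unitVec k) m = Φ m k := by
  rw [rowOp_apply h, inner_star_unitVec]

lemma norm_sq_sum_unitVec (s : Finset ℕ) (z : ℕ → ℂ) :
    ‖∑ m ∈ s, z m • unitVec m‖ ^ 2 = ∑ m ∈ s, ‖z m‖ ^ 2 := by
  have h1 : ∀ k, (∑ m ∈ s, z m • unitVec m) k = if k ∈ s then z k else 0 := fun k => by
    rw [← inner_unitVec, inner_sum]
    simp only [inner_smul_right, inner_unitVec, unitVec_apply]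
    simp
  have h2 := hasSum_norm_sq (∑ m ∈ s, z m • unitVec m)
  simp only [h1] at h2
  rw [← h2.tsum_eq, tsum_eq_sum (s := s) fun k hk => by simp [hk]]
  exact Finset.sum_congr rfl fun k hk => by rw [if_pos hk]

/-- If `A ≤ T* T` and the vectors `Ψ m` form a left inverse, then `A y` belongs to the range of
`T*`. -/
lemma exists_preimage {A T : Vec →L[ℂ] Vec} (hA : A.IsPositive)
    (hAT : ∀ x, quad A x ≤ ‖T x‖ ^ 2) {M : ℕ∞} {Ψ : ℕ → Vec}
    (hΨ : ∀ m : ℕ, M ≤ m → Ψ m = 0) (hT : ∀ x, ∀ m : ℕ, M ≤ m → T x m = 0)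
    (hTΨ : ∀ m : ℕ, (m : ℕ∞) < M → T (Ψ m) = unitVec m) (y : Vec) :
    ∃ Z : Vec, (∀ m, Z m = inner ℂ (Ψ m) (A y)) ∧ ‖Z‖ ^ 2 ≤ quad A y ∧
      ∀ x, inner ℂ x (A y) = inner ℂ (T x) Z := by
  have hcs : ∀ x, ‖inner ℂ x (A y)‖ ≤ ‖T x‖ * √(quad A y) := fun x => by
    refine (norm_inner_sq_le hA x y).trans ?_
    gcongr
    exact Real.sqrt_le_iff.2 ⟨norm_nonneg _, hAT x⟩
  set z : ℕ → ℂ := fun m => inner ℂ (Ψ m) (A y) with hz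
  have hz0 : ∀ m : ℕ, M ≤ m → z m = 0 := fun m hm => by rw [hz]; simp [hΨ m hm]
  -- Testing the bound |⟨x, A y⟩| ≤ ‖T x‖ √⟨A y, y⟩ on x = ∑ zₘ Ψₘ, where T x = ∑ zₘ δₘ, gives
  -- ∑|zₘ|² ≤ √(∑|zₘ|²) √⟨A y, y⟩.
  have hbessel : ∀ s : Finset ℕ, ∑ m ∈ s, ‖z m‖ ^ 2 ≤ quad A y := fun s => by
    have h1 : T (∑ m ∈ s, z m • Ψ m) = ∑ m ∈ s, z m • unitVec m := by
      rw [map_sum]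
      refine Finset.sum_congr rfl fun m _ => ?_
      rw [map_smul]
      rcases lt_or_ge (m : ℕ∞) M with h | h
      · rw [hTΨ m h]
      · rw [hz0 m h, zero_smul, zero_smul]
    have h2 : inner ℂ (∑ m ∈ s, z m • Ψ m) (A y) = ((∑ m ∈ s, ‖z m‖ ^ 2 : ℝ) : ℂ) := by
      rw [sum_inner]
      push_cast
      refine Finset.sum_congr rfl fun m _ => ?_
      rw [inner_smul_left]
      exact RCLike.conj_mul (z m)
    have h3 := hcs (∑ m ∈ s, z m • Ψ m)
    have h0 : 0 ≤ ∑ m ∈ s, ‖z m‖ ^ 2 := Finset.sum_nonneg fun m _ => by positivity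
    rw [h2, h1, Complex.norm_real, Real.norm_of_nonneg h0,
      ← Real.sqrt_sq (norm_nonneg (∑ m ∈ s, z m • unitVec m)), norm_sq_sum_unitVec] at h3
    rcases h0.eq_or_lt with h4 | h4
    · rw [← h4]; exact quad_nonneg hA y
    · have h5 : √(∑ m ∈ s, ‖z m‖ ^ 2) * √(∑ m ∈ s, ‖z m‖ ^ 2) ≤
          √(∑ m ∈ s, ‖z m‖ ^ 2) * √(quad A y) := by rwa [Real.mul_self_sqrt h0]
      exact (Real.sqrt_le_sqrt_iff (quad_nonneg hA y)).1
        (le_of_mul_le_mul_left h5 (Real.sqrt_pos.2 h4))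
  have hsum : Summable fun m => ‖z m‖ ^ 2 :=
    summable_of_sum_le (fun m => by positivity) hbessel
  refine ⟨⟨z, memℓp_gen (by simpa using hsum)⟩, fun m => rfl, ?_, fun x => ?_⟩
  · rw [← (hasSum_norm_sq _).tsum_eq]
    exact hsum.tsum_le_of_sum_le hbessel
  · set Z : Vec := ⟨z, memℓp_gen (by simpa using hsum)⟩ with hZ
    have h1 : ∀ N : ℕ, T (x - ∑ m ∈ Finset.range N, T x m • Ψ m) =
        T x - ∑ m ∈ Finset.range N, T x m • unitVec m := fun N => by
      rw [map_sub, map_sum]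
      congr 1
      refine Finset.sum_congr rfl fun m _ => ?_
      rw [map_smul]
      rcases lt_or_ge (m : ℕ∞) M with h | h
      · rw [hTΨ m h]
      · rw [hT x m h, zero_smul, zero_smul]
    -- The sums ∑ (T x)ₘ Ψₘ need not converge, but T maps the differences to null sequences, and the
    -- pairing with A y is controlled by T alone.
    have h2 : Tendsto (fun N : ℕ => inner ℂ (x - ∑ m ∈ Finset.range N, T x m • Ψ m) (A y)) atTop
        (𝓝 0) := by
      refine squeeze_zero_norm (fun N => hcs _) ?_
      simp only [h1]
      have h3 := ((hasSum_unitVec (T x)).tendsto_sum_nat.const_sub (T x)).norm.mul_const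
        (√(quad A y))
      simpa using h3
    have h4 : Tendsto (fun N : ℕ => inner ℂ (x - ∑ m ∈ Finset.range N, T x m • Ψ m) (A y)) atTop
        (𝓝 (inner ℂ x (A y) - inner ℂ (T x) Z)) := by
      have h5 := (hasSum_inner_vec (T x) Z).tendsto_sum_nat.const_sub (inner ℂ x (A y))
      convert h5 using 2 with N
      rw [inner_sub_left, sum_inner]
      congr 1
      refine Finset.sum_congr rfl fun m _ => ?_
      rw [inner_smul_left]
      simp [hZ, hz, mul_comm]
    exact sub_eq_zero.1 (tendsto_nhds_unique h4 h2)

/-! ### Canonical factorizations -/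

/-- The Fourier coefficients of the product of two causal functions. -/
lemma fourierCo_inner_star {u v : ℝ → Vec} {a c : ℕ → Vec} (hu : HasSeries u (causal a))
    (hv : HasSeries v (causal c)) (n : ℤ) :
    fourierCo (fun lam => inner ℂ (star (u lam)) (v lam)) n =
      causal (fun l => ∑ j ∈ Finset.range (l + 1), inner ℂ (star (a (l - j))) (c j)) n := by
  have h := hu.star_vec.hasSum_inner (hv.ee_smul n)
  simp only [inner_smul_right] at h
  have h0 : fourierCo (fun lam => inner ℂ (star (u lam)) (v lam)) n =
      1 / (2 * Real.pi) * ∫ lam, ee n lam * inner ℂ (star (u lam)) (v lam) ∂band := rfl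
  rw [h0, ← h.tsum_eq]
  rcases le_or_gt n 0 with hn | hn
  · obtain ⟨l, rfl⟩ : ∃ l : ℕ, n = -l := ⟨n.natAbs, by omega⟩
    rw [causal_neg]
    have hinj : Set.InjOn (fun j : ℕ => (l : ℤ) - j) (Finset.range (l + 1)) := fun i _ j _ hij => by
      simpa using hij
    rw [tsum_eq_sum (s := (Finset.range (l + 1)).image fun j : ℕ => (l : ℤ) - j),
      Finset.sum_image hinj]
    · refine Finset.sum_congr rfl fun j hj => ?_
      have hj' : j ≤ l := by simpa [Nat.lt_succ_iff] using hj
      have e1 : -((l : ℤ) - j) = -((l - j : ℕ) : ℤ) := by omega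
      have e2 : (l : ℤ) - j + -l = -(j : ℤ) := by omega
      rw [e1, e2, causal_neg, causal_neg]
    · intro k hk
      by_cases h1 : 1 ≤ -k
      · rw [causal_of_pos _ h1, star_zero, inner_zero_left]
      · by_cases h2 : 1 ≤ k + -(l : ℤ)
        · rw [causal_of_pos _ h2, inner_zero_right]
        · exfalso
          refine hk (Finset.mem_image.2 ⟨(l - k).toNat, ?_, ?_⟩)
          · rw [Finset.mem_range]; omega
          · omega
  · rw [causal_of_pos _ (by omega)]
    refine (tsum_congr fun k => ?_).trans tsum_zero
    by_cases h1 : 1 ≤ -k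
    · rw [causal_of_pos _ h1, star_zero, inner_zero_left]
    · rw [causal_of_pos _ (by omega : 1 ≤ k + n), inner_zero_right]

lemma clm_ext_unitVec {A B : Vec →L[ℂ] Vec} (h : ∀ k, A (unitVec k) = B (unitVec k)) : A = B := by
  ext1 x
  have h1 := (hasSum_unitVec x).mapL A
  have h2 := (hasSum_unitVec x).mapL B
  simp only [map_smul, h] at h1 h2
  exact h1.unique h2

lemma rowOp_eq_zero {Φ : ℕ → Vec} (h : Summable fun m => ‖Φ m‖ ^ 2) (x : Vec) {m : ℕ}
    (hm : Φ m = 0) : rowOp Φ x m = 0 := by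
  rw [rowOp_apply h, hm, star_zero, inner_zero_left]

section Factor

variable {d τ : ℕ} {M : ℕ∞} {F : Density} {φ : ℕ → ℕ → Vec} {Φ : ℝ → ℕ → Vec}

/-- Square summability of all coefficients makes the integral of ∑ₘ ‖Φₘ‖² finite. So Φ(lam) is
Hilbert–Schmidt almost everywhere, and `rowOp` does not take its default value zero there. -/
lemma IsCanonicalFactor.ae_summable (hΦ : IsCanonicalFactor d τ M F φ Φ) :
    ∀ᵐ lam ∂band, Summable fun m => ‖Φ lam m‖ ^ 2 := by
  have hm : ∀ m, AEMeasurable (fun lam => ENNReal.ofReal (‖Φ lam m‖ ^ 2)) band := fun m =>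
    ((hΦ.series m).1.1.norm.pow 2).aemeasurable.ennreal_ofReal
  have h1 : ∀ m, ∫⁻ lam, ENNReal.ofReal (‖Φ lam m‖ ^ 2) ∂band =
      ENNReal.ofReal (2 * Real.pi * ∑' k, ‖φ k m‖ ^ 2) := fun m => by
    have h2 := (hΦ.series m).hasSum_norm_sq_causal.tsum_eq
    rw [h2, ← mul_assoc, mul_one_div_cancel (by positivity), one_mul,
      ofReal_integral_eq_lintegral_ofReal]
    · exact (hΦ.series m).1.integrable_norm_pow (by norm_num)
    · exact Eventually.of_forall fun _ => by positivity
  have h2 : Summable fun m => ∑' k, ‖φ k m‖ ^ 2 := by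
    have := (hΦ.summable.prod_symm).prod
    simpa using this
  have h3 : ∫⁻ lam, ∑' m, ENNReal.ofReal (‖Φ lam m‖ ^ 2) ∂band ≠ ∞ := by
    rw [lintegral_tsum hm]
    simp_rw [h1]
    rw [← ENNReal.ofReal_tsum_of_nonneg (fun m => by positivity) (h2.mul_left _)]
    exact ENNReal.ofReal_ne_top
  filter_upwards [ae_lt_top' (AEMeasurable.tsum hm) h3] with lam h
  have := ENNReal.summable_toReal h.ne
  simpa [ENNReal.toReal_ofReal, sq_nonneg] using this

/-- The entries of ΦΦ* are the products ⟨Φ^⊤δₙ, Φ^⊤δₖ⟩, hence w F = T*T with T = Φ^⊤: a concrete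
square root for the form of w F. -/
lemma IsCanonicalFactor.inner_eq (hΦ : IsCanonicalFactor d τ M F φ Φ) :
    ∀ᵐ lam ∂band, ∀ x y, inner ℂ x (weighted d τ F lam y) =
      inner ℂ (rowOp (Φ lam) x) (rowOp (Φ lam) y) := by
  filter_upwards [hΦ.ae_summable, hΦ.factor] with lam hs hfac
  have h1 : weighted d τ F lam =
      (ContinuousLinearMap.adjoint (rowOp (Φ lam))).comp (rowOp (Φ lam)) := by
    refine clm_ext_unitVec fun k => ?_
    ext n
    rw [← inner_unitVec, ← inner_unitVec, ContinuousLinearMap.comp_apply,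
      ContinuousLinearMap.adjoint_inner_right]
    refine (hfac k n).unique ?_
    have h2 := hasSum_inner_vec (rowOp (Φ lam) (unitVec n)) (rowOp (Φ lam) (unitVec k))
    simpa only [rowOp_unitVec hs, RCLike.inner_apply, RCLike.star_def] using h2
  intro x y
  rw [h1, ContinuousLinearMap.comp_apply, ContinuousLinearMap.adjoint_inner_right]

lemma IsCanonicalFactor.quad_eq (hΦ : IsCanonicalFactor d τ M F φ Φ) :
    ∀ᵐ lam ∂band, ∀ x, quad (weighted d τ F lam) x = ‖rowOp (Φ lam) x‖ ^ 2 := by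
  filter_upwards [hΦ.inner_eq] with lam h using quad_eq_norm_sq h

lemma IsCanonicalFactor.apply_eq_zero (hΦ : IsCanonicalFactor d τ M F φ Φ) :
    ∀ᵐ lam ∂band, ∀ x, ∀ m : ℕ, M ≤ m → rowOp (Φ lam) x m = 0 := by
  have h1 : ∀ m : ℕ, ∀ᵐ lam ∂band, M ≤ m → Φ lam m = 0 := fun m => by
    by_cases hm : M ≤ m
    · refine (ae_eq_zero_of_fourierCo (hΦ.series m).integrable fun n => ?_).mono fun lam h _ => h
      rw [(hΦ.series m).2, causal]
      simp [hΦ.support _ m hm]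
    · exact Eventually.of_forall fun lam h => absurd h hm
  filter_upwards [hΦ.ae_summable, ae_all_iff.2 h1] with lam hs h x m hm
  exact rowOp_eq_zero hs x (h m hm)

lemma IsCanonicalFactor.aesm_apply (hΦ : IsCanonicalFactor d τ M F φ Φ) {x : ℝ → Vec}
    (hx : AEStronglyMeasurable x band) :
    AEStronglyMeasurable (fun lam => rowOp (Φ lam) (x lam)) band := by
  refine aesm_vec_of_coord fun m => ?_
  refine AEStronglyMeasurable.congr
    ((continuous_star.comp_aestronglyMeasurable (hΦ.series m).1.1).inner hx) ?_
  filter_upwards [hΦ.ae_summable] with lam hs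
  exact (rowOp_apply hs _ _).symm

lemma IsCanonicalFactor.memLp_apply (hΦ : IsCanonicalFactor d τ M F φ Φ) {x : ℝ → Vec}
    (hx : AEStronglyMeasurable x band)
    (hq : Integrable (fun lam => quad (weighted d τ F lam) (x lam)) band) :
    MemLp (fun lam => rowOp (Φ lam) (x lam)) 2 band := by
  rw [memLp_two_iff_integrable_sq_norm (hΦ.aesm_apply hx)]
  refine hq.congr ?_
  filter_upwards [hΦ.quad_eq] with lam h using h _

/-- Integrability of the form of w F at x is square-integrability of Φ^⊤ x, and each component is a
product of two causal functions, so its coefficients are finite convolutions. -/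
lemma IsCanonicalFactor.hasSeries_apply (hΦ : IsCanonicalFactor d τ M F φ Φ) {x : ℝ → Vec}
    {a : ℕ → Vec} (hx : HasSeries x (causal a))
    (hq : Integrable (fun lam => quad (weighted d τ F lam) (x lam)) band) :
    ∃ γ : ℕ → Vec, HasSeries (fun lam => rowOp (Φ lam) (x lam)) (causal γ) ∧
      ∀ l m, γ l m = ∑ j ∈ Finset.range (l + 1), inner ℂ (star (φ (l - j) m)) (a j) := by
  have hL := hΦ.memLp_apply hx.1.1 hq
  have hco : ∀ n m, fourierCo (fun lam => rowOp (Φ lam) (x lam)) n m =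
      causal (fun l => ∑ j ∈ Finset.range (l + 1), inner ℂ (star (φ (l - j) m)) (a j)) n :=
    fun n m => by
      rw [fourierCo_coord (hL.integrable (by norm_num)), ← fourierCo_inner_star (hΦ.series m) hx]
      refine fourierCo_congr ?_ n
      filter_upwards [hΦ.ae_summable] with lam hs using rowOp_apply hs _ _
  refine ⟨fun l => fourierCo (fun lam => rowOp (Φ lam) (x lam)) (-(l : ℤ)), ⟨hL, fun n => ?_⟩,
    fun l m => by rw [hco, causal_neg]⟩
  rcases le_or_gt n 0 with hn | hn
  · obtain ⟨l, rfl⟩ : ∃ l : ℕ, n = -l := ⟨n.natAbs, by omega⟩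
    rw [causal_neg]
  · rw [causal_of_pos _ (by omega)]
    ext m
    rw [hco, causal_of_pos _ (by omega)]
    rfl

lemma IsCanonicalFactor.hasSeries_unitVec (hΦ : IsCanonicalFactor d τ M F φ Φ)
    (hF : IsSpectralDensity d τ F) (i : ℕ) :
    ∃ κ : ℕ → Vec, HasSeries (fun lam => rowOp (Φ lam) (unitVec i)) (causal κ) ∧
      ∀ l m, κ l m = φ l m i := by
  have h0 : HasSeries (fun _ : ℝ => unitVec i) (causal fun j => if j = 0 then unitVec i else 0) := by
    have := hasSeries_ee_smul_const 0 (unitVec i)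
    simp only [ee_zero, one_smul, neg_zero] at this
    convert this using 1
    ext1 n
    rw [causal]
    split_ifs <;> first | rfl | omega
  obtain ⟨κ, h1, h2⟩ := hΦ.hasSeries_apply h0
    (hF.integrable_quad_of_bound aestronglyMeasurable_const fun _ => le_rfl)
  refine ⟨κ, h1, fun l m => ?_⟩
  rw [h2, Finset.sum_eq_single 0]
  · simp [inner_star_unitVec]
  · intro j _ hj; simp [hj]
  · simp

lemma IsCanonicalFactor.hasSeries_bFun (hΦ : IsCanonicalFactor d τ M F φ Φ)
    (hF : IsSpectralDensity d τ F) {b : ℕ → Vec} (hb : Summable fun j => ‖b j‖) :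
    ∃ γ : ℕ → Vec, HasSeries (fun lam => rowOp (Φ lam) (bFun b lam)) (causal γ) ∧
      ∀ l m, γ l m = tildeB φ b l m := by
  obtain ⟨γ, h1, h2⟩ := hΦ.hasSeries_apply (PCFilter.hasSeries_bFun hb)
    (hF.integrable_quad_of_bound (aesm_bFun hb) (norm_bFun_le hb))
  refine ⟨γ, h1, fun l m => ?_⟩
  rw [h2, tildeB]
  exact Finset.sum_congr rfl fun j _ => inner_star_left_eq_tsum _ _

lemma IsCanonicalFactor.sqSum_tildeB (hΦ : IsCanonicalFactor d τ M F φ Φ)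
    (hF : IsSpectralDensity d τ F) {b : ℕ → Vec} (hb : Summable fun j => ‖b j‖) :
    sqSum (tildeB φ b) =
      1 / (2 * Real.pi) * ∫ lam, quad (weighted d τ F lam) (bFun b lam) ∂band := by
  obtain ⟨γ, h1, h2⟩ := hΦ.hasSeries_bFun hF hb
  rw [sqSum_eq h2 h1.hasSum_norm_sq_causal]
  congr 1
  refine integral_congr_ae ?_
  filter_upwards [hΦ.quad_eq] with lam h using (h _).symm

lemma IsSpectralDensity.integrable_apply_bFun (hF : IsSpectralDensity d τ F) {b : ℕ → Vec}
    (hb : Summable fun j => ‖b j‖) :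
    Integrable (fun lam => weighted d τ F lam (bFun b lam)) band := by
  refine (hF.integrable_wtr.mul_const (∑' j, ‖b j‖)).mono'
    (PCFilter.aesm_apply hF.measurable_weighted (aesm_bFun hb)) ?_
  filter_upwards [hF.norm_apply_le] with lam h
  have := wtr_nonneg d τ F lam
  refine (h _).trans ?_
  gcongr
  exact norm_bFun_le hb lam

/-- The i-th component of w F B is ⟨Φ^⊤δᵢ, Φ^⊤B⟩, a product of causal functions. Thus `gramB` is the
nonpositive-frequency part of w F B and does not depend on the factor chosen. -/
lemma IsCanonicalFactor.fourierCo_apply_bFun (hΦ : IsCanonicalFactor d τ M F φ Φ)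
    (hF : IsSpectralDensity d τ F) {b : ℕ → Vec} (hb : Summable fun j => ‖b j‖) (n i : ℕ) :
    fourierCo (fun lam => weighted d τ F lam (bFun b lam)) (-(n : ℤ)) i = gramB φ b n i := by
  obtain ⟨γ, h1, h2⟩ := hΦ.hasSeries_bFun hF hb
  obtain ⟨κ, h3, h4⟩ := hΦ.hasSeries_unitVec hF i
  have h5 := hasSum_inner_shift h3 h1 n
  have h6 := hasSum_prod_inner (c := fun l => γ (l + n)) h3.hasSum_norm_sq_causal.summable
    ((summable_nat_add_iff n).2 h1.hasSum_norm_sq_causal.summable) h5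
  simp only [h2, h4] at h6
  rw [gramB, h6.tsum_eq, fourierCo_coord (hF.integrable_apply_bFun hb)]
  refine fourierCo_congr ?_ _
  filter_upwards [hΦ.inner_eq] with lam h
  rw [← inner_unitVec, h]

/-- The functions `Φ^⊤ p` with causal polynomials `p` are dense in the causal functions. -/
lemma IsCanonicalFactor.exists_cpoly_near (hΦ : IsCanonicalFactor d τ M F φ Φ)
    (hF : IsSpectralDensity d τ F) {E : ℝ → Vec} {ε : ℕ → Vec} (hE : HasSeries E (causal ε))
    (hε : ∀ n, ∀ m : ℕ, M ≤ m → ε n m = 0) {δ : ℝ} (hδ : 0 < δ) :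
    ∃ α, 1 / (2 * Real.pi) * ∫ lam, ‖rowOp (Φ lam) (cpoly α lam) - E lam‖ ^ 2 ∂band < δ := by
  choose κ hκ hκφ using hΦ.hasSeries_unitVec hF
  set t : ℕ × ℕ → ℕ → Vec := fun p n => if p.1 ≤ n then κ p.2 (n - p.1) else 0 with ht
  have hts : ∀ p, HasSeries (fun lam => rowOp (Φ lam) (cpoly (Finsupp.single p 1) lam))
      (causal (t p)) := fun p => by
    have h1 := (hκ p.2).ee_smul p.1
    have h2 : (fun n : ℤ => causal (κ p.2) (n + p.1)) = causal (t p) := by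
      ext1 n
      simp only [causal, ht]
      split_ifs <;> first | rfl | omega | (congr 1; omega)
    rw [h2] at h1
    have h3 : ∀ lam, rowOp (Φ lam) (cpoly (Finsupp.single p 1) lam) =
        ee p.1 lam • rowOp (Φ lam) (unitVec p.2) := fun lam => by
      rw [cpoly_apply, Finsupp.sum_single_index (by simp), one_smul, map_smul]
    simpa only [h3] using h1
  have hmem : ∀ {u : ℝ → Vec} {a : ℕ → Vec}, HasSeries u (causal a) → Memℓp a 2 := fun h =>
    memℓp_gen (by simpa using h.hasSum_norm_sq_causal.summable)
  set tt : ℕ × ℕ → lp (fun _ : ℕ => Vec) 2 := fun p => ⟨t p, hmem (hts p)⟩ with htt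
  set e : lp (fun _ : ℕ => Vec) 2 := ⟨ε, hmem hE⟩ with he
  set K := Submodule.span ℂ (Set.range tt) with hK
  -- The closure is the double orthogonal complement. Orthogonality of w to every shifted row is, up
  -- to conjugation, the condition in `canonical`.
  have hcl : e ∈ K.topologicalClosure := by
    rw [← Submodule.orthogonal_orthogonal_eq_closure, Submodule.mem_orthogonal']
    intro w hw
    have hwsum : Summable fun n => ‖w n‖ ^ 2 := by
      simpa using (lp.hasSum_norm (E := fun _ : ℕ => Vec) (p := 2) (by norm_num) w).summable
    classical
    -- Components with index at least M are cut off, as `canonical` requires; both the rows and ε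
    -- vanish there, so no inner product changes.
    set v : ℕ → ℕ → ℂ := fun n m => if M ≤ (m : ℕ∞) then 0 else w n m with hv
    have hv0 : v = 0 := by
      refine hΦ.canonical v ?_ (fun n m hm => by simp [hv, hm]) fun j i => ?_
      · refine Summable.of_nonneg_of_le (fun p => by positivity) (fun p => ?_)
          (summable_norm_sq_iff_prod.2 hwsum)
        simp only [hv]
        split_ifs
        · simp
        · exact le_rfl
      · have h1 : inner ℂ (tt (j, i)) w = 0 :=
          (Submodule.mem_orthogonal _ _).1 hw _ (Submodule.subset_span ⟨_, rfl⟩)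
        have h2 := lp.hasSum_inner (𝕜 := ℂ) (G := fun _ : ℕ => Vec) (tt (j, i)) w
        have hinj : Function.Injective fun l : ℕ => l + j := add_left_injective j
        rw [h1, ← hinj.hasSum_iff] at h2
        · have h3 : ∀ l, inner ℂ (tt (j, i) (l + j)) (w (l + j)) =
              inner ℂ (κ i l) (w (l + j)) := fun l => by
            simp [htt, ht]
          simp only [Function.comp_def, h3] at h2
          have h4 := hasSum_prod_inner (c := fun l => w (l + j))
            (hκ i).hasSum_norm_sq_causal.summable ((summable_nat_add_iff j).2 hwsum) h2
          have h5 := h4.star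
          simp only [star_mul', star_star, star_zero, hκφ] at h5
          rw [← h5.tsum_eq]
          refine tsum_congr fun p => ?_
          by_cases hm : M ≤ (p.2 : ℕ∞)
          · rw [hΦ.support _ _ hm]; simp
          · simp [hv, hm]
        · intro n hn
          have : ¬ j ≤ n := fun h => hn ⟨n - j, by simp only; omega⟩
          simp [htt, ht, this]
    have h1 := lp.hasSum_inner (𝕜 := ℂ) (G := fun _ : ℕ => Vec) e w
    refine h1.unique ?_
    have h2 : ∀ n, inner ℂ (e n) (w n) = 0 := fun n => by
      rw [← (hasSum_inner_vec (e n) (w n)).tsum_eq]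
      refine (tsum_congr fun m => ?_).trans tsum_zero
      by_cases hm : M ≤ (m : ℕ∞)
      · have : e n m = 0 := hε n m hm
        rw [this, inner_zero_left]
      · have : w n m = 0 := by
          have := congrFun (congrFun hv0 n) m
          simpa [hv, hm] using this
        rw [this, inner_zero_right]
    simp only [h2]
    exact hasSum_zero
  obtain ⟨y, hyK, hy⟩ := Metric.mem_closure_iff.1 hcl (√δ) (Real.sqrt_pos.2 hδ)
  -- Elements of the span are exactly coefficient sequences of Φ^⊤ p with p a causal polynomial.
  have hyα : ∃ α, HasSeries (fun lam => rowOp (Φ lam) (cpoly α lam)) (causal y) := by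
    clear hy
    induction hyK using Submodule.span_induction with
    | mem y hy =>
      obtain ⟨p, rfl⟩ := hy
      exact ⟨_, hts p⟩
    | zero =>
      refine ⟨0, by simp, fun n => ?_⟩
      simp [fourierCo, causal]
    | add y z _ _ hy hz =>
      obtain ⟨α, hα⟩ := hy
      obtain ⟨β, hβ⟩ := hz
      refine ⟨α + β, ?_⟩
      have h := hα.add hβ
      have h1 : (fun n : ℤ => causal y n + causal z n) = causal ⇑(y + z) := by
        ext1 n
        simp only [causal]
        split_ifs <;> simp
      simpa only [map_add, Pi.add_apply, h1] using h
    | smul c y _ hy =>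
      obtain ⟨α, hα⟩ := hy
      refine ⟨c • α, ?_⟩
      have h := hα.smul c
      have h1 : (fun n : ℤ => c • causal y n) = causal ⇑(c • y) := by
        ext1 n
        simp only [causal]
        split_ifs <;> simp
      simpa only [map_smul, Pi.smul_apply, h1] using h
  obtain ⟨α, hα⟩ := hyα
  refine ⟨α, ?_⟩
  have h1 := hα.sub hE
  have h2 : (fun n : ℤ => causal y n - causal ε n) = causal ⇑(y - e) := by
    ext1 n
    simp only [causal]
    split_ifs
    · rfl
    · simp
  rw [h2] at h1
  have h3 := lp.hasSum_norm (E := fun _ : ℕ => Vec) (p := 2) (by norm_num) (y - e)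
  simp only [ENNReal.toReal_ofNat, Real.rpow_ofNat] at h3
  rw [← h3.unique h1.hasSum_norm_sq_causal, ← dist_eq_norm, dist_comm]
  calc dist e y ^ 2 < √δ ^ 2 := by gcongr
    _ = δ := Real.sq_sqrt hδ.le

end Factor

/-! ### The optimal error and the optimal characteristic from a canonical factorization. -/

section Projection

variable {d τ : ℕ} {b : ℕ → Vec} {f g : Density} {M : ℕ∞} {θ ψ φ : ℕ → ℕ → Vec}
  {Θ Ψ : ℝ → ℕ → Vec}

/-- ΨΘ = E_M read by rows: Θ^⊤ sends the m-th row of Ψ to δₘ, the form in which `exists_preimage`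
needs it. -/
lemma IsLeftInverse.ae_apply_eq (hΨ : IsLeftInverse M Θ ψ Ψ) {F : Density}
    (hΘ : IsCanonicalFactor d τ M F θ Θ) :
    ∀ᵐ lam ∂band, ∀ m : ℕ, (m : ℕ∞) < M → rowOp (Θ lam) (Ψ lam m) = unitVec m := by
  filter_upwards [hΨ.leftInv, hΘ.ae_summable] with lam h hs m hm
  ext n
  rw [rowOp_apply hs, inner_star_left_eq_tsum, unitVec_apply]
  have h1 := (h m n).tsum_eq
  simp only [mul_comm (Ψ lam m _)] at h1
  rw [h1]
  simp [hm, eq_comm]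

lemma IsLeftInverse.ae_eq_zero (hΨ : IsLeftInverse M Θ ψ Ψ) :
    ∀ᵐ lam ∂band, ∀ m : ℕ, M ≤ m → Ψ lam m = 0 := by
  refine ae_all_iff.2 fun m => ?_
  by_cases hm : M ≤ m
  · refine (ae_eq_zero_of_fourierCo (hΨ.series m).integrable fun n => ?_).mono fun lam h _ => h
    rw [(hΨ.series m).2, causal]
    simp [hΨ.support _ m hm]
  · exact Eventually.of_forall fun lam h => absurd h hm

/-- The function `E = Ψ̄ w f B`, with its causal part `∑ (ψ̄ C)_m e^{-im lam}`. -/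
lemma exists_innovation (hf : IsSpectralDensity d τ f) (hg : IsSpectralDensity d τ g)
    (hb : Summable fun j => ‖b j‖) (hΘ : IsCanonicalFactor d τ M (f + g) θ Θ)
    (hΨ : IsLeftInverse M Θ ψ Ψ) (hφ : CanonicalCoeffs d τ b f φ) :
    ∃ Z E : ℝ → Vec, ∃ ε : ℕ → Vec, MemLp Z 2 band ∧ HasSeries E (causal ε) ∧
      (∀ᵐ lam ∂band, ∀ x, inner ℂ x (weighted d τ f lam (bFun b lam)) =
        inner ℂ (rowOp (Θ lam) x) (Z lam)) ∧
      (∀ n : ℤ, n ≤ 0 → fourierCo Z n = causal ε n) ∧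
      ∀ n m, ε n m = psiC ψ (gramB φ b) n m := by
  obtain ⟨⟨M', Φ, hΦ⟩, hgram⟩ := hφ
  have hZ : ∀ᵐ lam ∂band, ∃ Z : Vec,
      (∀ m, Z m = inner ℂ (Ψ lam m) (weighted d τ f lam (bFun b lam))) ∧
      ‖Z‖ ^ 2 ≤ quad (weighted d τ f lam) (bFun b lam) ∧
      ∀ x, inner ℂ x (weighted d τ f lam (bFun b lam)) = inner ℂ (rowOp (Θ lam) x) Z := by
    filter_upwards [hf.positive_weighted, hg.positive_weighted, hΘ.quad_eq, hΘ.apply_eq_zero,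
      hΨ.ae_apply_eq hΘ, hΨ.ae_eq_zero] with lam pf pg h1 h2 h3 h4
    refine exists_preimage pf (fun x => ?_) h4 h2 h3 _
    rw [← h1, weighted_add]
    exact quad_le_of_add pg x
  have : (ae band).NeBot := by
    rw [band, ae_restrict_neBot, Real.volume_Ico]
    simp [Real.pi_pos]
  -- A pointwise choice carries no measurability, but the components of Z are the explicit functions
  -- ⟨Ψₘ, w f B⟩.
  obtain ⟨Z, hZ⟩ := hZ.choice
  have hUi := hf.integrable_apply_bFun hb
  have hZm : AEStronglyMeasurable Z band := by
    refine aesm_vec_of_coord fun m => ?_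
    refine ((hΨ.series m).1.1.inner hUi.1).congr ?_
    filter_upwards [hZ] with lam h using (h.1 m).symm
  have hZL : MemLp Z 2 band := by
    rw [memLp_two_iff_integrable_sq_norm hZm]
    refine (hf.integrable_quad_of_bound (aesm_bFun hb) (norm_bFun_le hb)).mono'
      (hZm.norm.pow 2) ?_
    filter_upwards [hZ] with lam h
    rw [Real.norm_of_nonneg (by positivity)]
    exact h.2.1
  have hZi : Integrable Z band := hZL.integrable (by norm_num)
  have hco : ∀ n m : ℕ, fourierCo Z (-(n : ℤ)) m = psiC ψ (gramB φ b) n m := by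
    intro n m
    obtain ⟨c, hc, hcs⟩ := exists_vec_seq hgram
    obtain ⟨C, hC⟩ : ∃ C : ℝ → Vec, HasSeries C (causal c) := by
      refine exists_hasSeries ?_
      exact ((hasSum_causal_iff (a := c) (G := fun _ x => ‖x‖ ^ 2) (by simp)).2 hcs.hasSum).summable
    have hVi : Integrable (fun lam => weighted d τ f lam (bFun b lam) - C lam) band :=
      hUi.sub hC.integrable
    -- The assumption c ∈ ℓ² makes the causal part C of w f B square-integrable. The rest has only
    -- positive frequencies and is merely integrable; paired with the causal Ψₘ it contributes
    -- nothing at the frequency -n.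
    have hV0 : ∀ k : ℤ, k ≤ 0 →
        fourierCo (fun lam => weighted d τ f lam (bFun b lam) - C lam) k = 0 := fun k hk => by
      obtain ⟨l, rfl⟩ : ∃ l : ℕ, k = -l := ⟨k.natAbs, by omega⟩
      rw [fourierCo_sub hUi hC.integrable, hC.2, causal_neg, sub_eq_zero]
      ext i
      rw [hΦ.fourierCo_apply_bFun hf hb, hc]
    have hΨC := integrable_inner_of_memLp (hΨ.series m).1 hC.1
    have hΨU : Integrable (fun lam => inner ℂ (Ψ lam m) (weighted d τ f lam (bFun b lam))) band := by
      refine ((innerSL ℂ (unitVec m)).integrable_comp hZi).congr ?_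
      filter_upwards [hZ] with lam h
      rw [innerSL_apply_apply, inner_unitVec, h.1]
    have hΨV : Integrable (fun lam => inner ℂ (Ψ lam m)
        (weighted d τ f lam (bFun b lam) - C lam)) band := by
      simp only [inner_sub_right]
      exact hΨU.sub hΨC
    have h1 := fourierCo_inner_eq_zero (hΨ.series m) hVi hV0 hΨV n
    simp only [inner_sub_right] at h1
    rw [fourierCo_sub hΨU hΨC, sub_eq_zero] at h1
    have h2 := hasSum_prod_inner (c := fun l => c (l + n))
      (hΨ.series m).hasSum_norm_sq_causal.summable ((summable_nat_add_iff n).2 hcs)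
      (hasSum_inner_shift (hΨ.series m) hC n)
    simp only [hc] at h2
    rw [psiC, h2.tsum_eq, ← h1, fourierCo_coord hZi]
    refine fourierCo_congr ?_ _
    filter_upwards [hZ] with lam h using h.1 m
  set ε : ℕ → Vec := fun n => fourierCo Z (-(n : ℤ)) with hε
  have hεs : Summable fun n => ‖ε n‖ ^ 2 := by
    have h1 : HasSeries Z (fun n => fourierCo Z n) := ⟨hZL, fun _ => rfl⟩
    exact h1.hasSum_norm_sq.summable.comp_injective (i := fun n : ℕ => -(n : ℤ)) fun i j h => by
      simpa using h
  obtain ⟨E, hE⟩ : ∃ E : ℝ → Vec, HasSeries E (causal ε) := by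
    refine exists_hasSeries ?_
    exact ((hasSum_causal_iff (a := ε) (G := fun _ x => ‖x‖ ^ 2) (by simp)).2 hεs.hasSum).summable
  refine ⟨Z, E, ε, hZL, hE, ?_, fun n hn => ?_, hco⟩
  · filter_upwards [hZ] with lam h using h.2.2
  · obtain ⟨l, rfl⟩ : ∃ l : ℕ, n = -l := ⟨n.natAbs, by omega⟩
    rw [causal_neg]

/-- The mean square error in terms of the causal part of the innovation. -/
lemma mse_eq_of_innovation (hf : IsSpectralDensity d τ f) (hg : IsSpectralDensity d τ g)
    (hb : Summable fun j => ‖b j‖) (hΘ : IsCanonicalFactor d τ M (f + g) θ Θ)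
    {Z E : ℝ → Vec} {ε : ℕ → Vec} (hZ : MemLp Z 2 band) (hE : HasSeries E (causal ε))
    (hZU : ∀ᵐ lam ∂band, ∀ x, inner ℂ x (weighted d τ f lam (bFun b lam)) =
        inner ℂ (rowOp (Θ lam) x) (Z lam))
    (hZE : ∀ n : ℤ, n ≤ 0 → fourierCo Z n = causal ε n) {x : ℝ → Vec} {y : ℕ → Vec}
    (hx : AEStronglyMeasurable x band)
    (hxS : Integrable (fun lam => quad (weighted d τ (f + g) lam) (x lam)) band)
    (hxy : HasSeries (fun lam => rowOp (Θ lam) (x lam)) (causal y)) :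
    mse d τ b (fun lam => beta d τ lam • x lam) f g = ENNReal.ofReal
      (1 / (2 * Real.pi) * ∫ lam, quad (weighted d τ f lam) (bFun b lam) ∂band - ∑' n, ‖ε n‖ ^ 2 +
        1 / (2 * Real.pi) * ∫ lam, ‖rowOp (Θ lam) (x lam) - E lam‖ ^ 2 ∂band) ∧
    0 ≤ 1 / (2 * Real.pi) * ∫ lam, quad (weighted d τ f lam) (bFun b lam) ∂band - ∑' n, ‖ε n‖ ^ 2 +
        1 / (2 * Real.pi) * ∫ lam, ‖rowOp (Θ lam) (x lam) - E lam‖ ^ 2 ∂band := by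
  have hB := hf.integrable_quad_of_bound (aesm_bFun hb) (norm_bFun_le hb)
  have hxf : Integrable (fun lam => quad (weighted d τ f lam) (x lam)) band := by
    refine hf.integrable_quad_of_le hx hxS ?_
    filter_upwards [hg.positive_weighted] with lam pg
    rw [weighted_add]
    exact quad_le_of_add pg _
  have hxg : Integrable (fun lam => quad (weighted d τ g lam) (x lam)) band := by
    refine hg.integrable_quad_of_le hx hxS ?_
    filter_upwards [hf.positive_weighted] with lam pf
    rw [weighted_add, add_comm]
    exact quad_le_of_add pf _
  have hm := mse_beta_smul_eq_ofReal (b := b) hf hg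
    (hf.integrable_quad_sub (aesm_bFun hb) hx hB hxf) hxg
  have hZs : HasSeries Z (fun n => fourierCo Z n) := ⟨hZ, fun _ => rfl⟩
  -- Θ^⊤ x is causal, whereas Z - E has only positive frequencies.
  have hcross : ∫ lam, inner ℂ (rowOp (Θ lam) (x lam)) (Z lam - E lam) ∂band = 0 := by
    have h1 := hxy.hasSum_inner (hZs.sub hE)
    have h2 : ∀ n : ℤ, inner ℂ (causal y n) (fourierCo Z n - causal ε n) = 0 := fun n => by
      rcases le_or_gt n 0 with hn | hn
      · rw [hZE n hn, sub_self, inner_zero_right]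
      · rw [causal_of_pos y (by omega), inner_zero_left]
    simp only [h2] at h1
    have h3 := h1.unique hasSum_zero
    simpa [Real.pi_ne_zero] using h3
  have hTZ := integrable_inner_of_memLp hxy.1 hZ
  have hTE := integrable_inner_of_memLp hxy.1 hE.1
  have hTZE : Integrable (fun lam => inner ℂ (rowOp (Θ lam) (x lam)) (Z lam - E lam)) band := by
    simp only [inner_sub_right]
    exact hTZ.sub hTE
  have hre : ∫ lam, (inner ℂ (rowOp (Θ lam) (x lam)) (Z lam - E lam)).re ∂band = 0 := by
    have h1 := integral_re hTZE
    simp only [RCLike.re_eq_complex_re] at h1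
    rw [h1, hcross, Complex.zero_re]
  suffices h : 1 / (2 * Real.pi) * ∫ lam, (quad (weighted d τ f lam) (bFun b lam - x lam) +
      quad (weighted d τ g lam) (x lam)) ∂band =
      1 / (2 * Real.pi) * ∫ lam, quad (weighted d τ f lam) (bFun b lam) ∂band - ∑' n, ‖ε n‖ ^ 2 +
        1 / (2 * Real.pi) * ∫ lam, ‖rowOp (Θ lam) (x lam) - E lam‖ ^ 2 ∂band by
    rw [← h]; exact hm
  rw [hE.hasSum_norm_sq_causal.tsum_eq, ← mul_sub, ← mul_add]
  congr 1
  have hE2 : Integrable (fun lam => ‖E lam‖ ^ 2) band := hE.1.integrable_norm_pow (by norm_num)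
  have hD2 : Integrable (fun lam => ‖rowOp (Θ lam) (x lam) - E lam‖ ^ 2) band :=
    (hxy.1.sub hE.1).integrable_norm_pow (by norm_num)
  have hBE : Integrable (fun lam => quad (weighted d τ f lam) (bFun b lam) - ‖E lam‖ ^ 2) band :=
    hB.sub hE2
  have hBED : Integrable (fun lam => quad (weighted d τ f lam) (bFun b lam) - ‖E lam‖ ^ 2 +
      ‖rowOp (Θ lam) (x lam) - E lam‖ ^ 2) band := hBE.add hD2
  have hR : Integrable
      (fun lam => 2 * (inner ℂ (rowOp (Θ lam) (x lam)) (Z lam - E lam)).re) band :=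
    hTZE.re.const_mul 2
  rw [← integral_sub hB hE2, ← integral_add hBE hD2]
  have h1 : ∫ lam, (quad (weighted d τ f lam) (bFun b lam - x lam) +
      quad (weighted d τ g lam) (x lam)) ∂band = ∫ lam, ((quad (weighted d τ f lam) (bFun b lam) -
        ‖E lam‖ ^ 2 + ‖rowOp (Θ lam) (x lam) - E lam‖ ^ 2) -
        2 * (inner ℂ (rowOp (Θ lam) (x lam)) (Z lam - E lam)).re) ∂band := by
    refine integral_congr_ae ?_
    filter_upwards [hZU, hΘ.quad_eq, hf.positive_weighted] with lam h1 h2 pf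
    have e1 := h2 (x lam)
    rw [weighted_add, quad_add_left] at e1
    have e2 := quad_sub_right pf (x lam) (bFun b lam)
    rw [h1] at e2
    have e3 := norm_sub_sq (𝕜 := ℂ) (rowOp (Θ lam) (x lam)) (E lam)
    rw [RCLike.re_eq_complex_re] at e3
    rw [inner_sub_right, Complex.sub_re, quad_sub_comm, e2, e3]
    linarith
  rw [h1, integral_sub hBED hR, integral_const_mul, hre, mul_zero, sub_zero]

lemma L20_congr {S : Density} {h h' : ℝ → Vec} (hh : h =ᵐ[band] h') (hm : h ∈ L20 d τ S) :
    h' ∈ L20 d τ S := by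
  have hs : ∀ k k' : ℝ → Vec, k =ᵐ[band] k' → sqNorm S k = sqNorm S k' := fun k k' hk => by
    rw [sqNorm, sqNorm]
    congr 1
    refine lintegral_congr_ae ?_
    filter_upwards [hk] with lam e
    rw [e]
  refine ⟨hm.1.congr hh, by rw [← hs _ _ hh]; exact hm.2.1, fun ε hε => ?_⟩
  obtain ⟨α, hα⟩ := hm.2.2 ε hε
  refine ⟨α, ?_⟩
  rwa [← hs _ _ (hh.sub (EventuallyEq.refl _ (trigPoly d τ α)))]

lemma mse_congr {h h' : ℝ → Vec} (hh : h =ᵐ[band] h') : mse d τ b h f g = mse d τ b h' f g := by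
  rw [mse, mse]
  congr 1
  refine lintegral_congr_ae ?_
  filter_upwards [hh] with lam e
  rw [e]

/-- The remainder in `mse_eq_of_innovation` is ‖Θ^⊤ x - E‖². Canonicity makes it arbitrarily small
over causal polynomials, which gives the value; the explicit h satisfies Θ^⊤(β⁻¹h) = E, so its
remainder is zero. -/
theorem optMSE_of_factorization (hτ : 0 < τ) (hf : IsSpectralDensity d τ f)
    (hg : IsSpectralDensity d τ g)
    (hb : Summable fun j => ‖b j‖) (hψ : InverseFactor d τ (f + g) ψ)
    (hφ : CanonicalCoeffs d τ b f φ) :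
    (optMSE d τ b f g = ENNReal.ofReal (sqSum (tildeB φ b) - sqSum (psiC ψ (gramB φ b))) ∧
      0 ≤ sqSum (tildeB φ b) - sqSum (psiC ψ (gramB φ b))) ∧
    ∀ h, IsSignalChar d τ b ψ φ h → IsOptimal d τ b f g h := by
  obtain ⟨M, θ, Θ, Ψ, hΘ, hΨ⟩ := hψ
  have hS := hf.add hg
  obtain ⟨Z, E, ε, hZ, hE, hZU, hZE, hε⟩ := exists_innovation hf hg hb hΘ hΨ hφ
  have hε0 : ∀ n, ∀ m : ℕ, M ≤ m → ε n m = 0 := fun n m hm => by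
    rw [hε, psiC]
    simp [hΨ.support _ m hm]
  obtain ⟨⟨M', Φ, hΦ⟩, -⟩ := hφ
  have hV : 1 / (2 * Real.pi) * ∫ lam, quad (weighted d τ f lam) (bFun b lam) ∂band -
      ∑' n, ‖ε n‖ ^ 2 = sqSum (tildeB φ b) - sqSum (psiC ψ (gramB φ b)) := by
    rw [hΦ.sqSum_tildeB hf hb, sqSum_eq hε hE.hasSum_norm_sq_causal.summable.hasSum]
  have hmse := fun {x : ℝ → Vec} {y : ℕ → Vec} => mse_eq_of_innovation (x := x) (y := y)
    hf hg hb hΘ hZ hE hZU hZE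
  rw [hV] at hmse
  have hcp : ∀ α, AEStronglyMeasurable (cpoly α) band ∧
      Integrable (fun lam => quad (weighted d τ (f + g) lam) (cpoly α lam)) band := fun α => by
    obtain ⟨h1, K, hK⟩ := cpoly_continuous_bdd α
    exact ⟨h1.aestronglyMeasurable, hS.integrable_quad_of_bound h1.aestronglyMeasurable hK⟩
  have hcs : ∀ α, ∃ y, HasSeries (fun lam => rowOp (Θ lam) (cpoly α lam)) (causal y) := fun α => by
    obtain ⟨a, ha⟩ := exists_hasSeries_cpoly α
    obtain ⟨y, hy, -⟩ := hΘ.hasSeries_apply ha (hcp α).2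
    exact ⟨y, hy⟩
  have hopt := optMSE_eq_ofReal hf hg hb
    (V := sqSum (tildeB φ b) - sqSum (psiC ψ (gramB φ b)))
    (r := fun α => 1 / (2 * Real.pi) * ∫ lam, ‖rowOp (Θ lam) (cpoly α lam) - E lam‖ ^ 2 ∂band)
    (fun α => by positivity) (fun δ hδ => hΘ.exists_cpoly_near hS hE hε0 hδ)
    (fun α => by
      obtain ⟨y, hy⟩ := hcs α
      exact (hmse (hcp α).1 (hcp α).2 hy).2)
    (fun α => by
      obtain ⟨y, hy⟩ := hcs α
      rw [trigPoly_eq_fun]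
      exact (hmse (hcp α).1 (hcp α).2 hy).1)
  refine ⟨hopt, ?_⟩
  rintro h ⟨Ψ', e, hΨ', he, hh⟩
  have hΨΨ : ∀ᵐ lam ∂band, ∀ m, Ψ' lam m = Ψ lam m :=
    ae_all_iff.2 fun m => (hΨ' m).ae_eq (hΨ.series m)
  have heE : ∀ᵐ lam ∂band, ∀ m, e lam m = E lam m := ae_all_iff.2 fun m => by
    refine (he m).ae_eq ?_
    convert hE.coord m using 1
    ext1 n
    simp only [causal]
    split_ifs
    · rw [hε]
    · rfl
  have hE0 : ∀ᵐ lam ∂band, ∀ m : ℕ, M ≤ m → E lam m = 0 := ae_all_iff.2 fun m => by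
    by_cases hm : M ≤ m
    · refine (ae_eq_zero_of_fourierCo (hE.coord m).integrable fun n => ?_).mono fun lam h _ => h
      rw [(hE.coord m).2]
      simp only [causal]
      split_ifs
      · exact hε0 _ m hm
      · rfl
    · exact Eventually.of_forall fun lam h => absurd h hm
  have hψm : ∀ m, AEStronglyMeasurable (fun lam => (beta d τ lam * e lam m) • Ψ' lam m) band :=
    fun m => ((measurable_beta d τ).aestronglyMeasurable.mul (he m).1.1).smul (hΨ' m).1.1
  have hhm : AEStronglyMeasurable h band := by
    refine aestronglyMeasurable_of_tendsto_ae atTop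
      (f := fun (N : ℕ) lam => ∑ m ∈ Finset.range N, (beta d τ lam * e lam m) • Ψ' lam m)
      (fun N => Finset.aestronglyMeasurable_fun_sum _ fun m _ => hψm m) ?_
    filter_upwards [hh] with lam h using h.tendsto_sum_nat
  -- β vanishes only on a null set, so h = βx almost everywhere.
  set x : ℝ → Vec := fun lam => (beta d τ lam)⁻¹ • h lam with hx
  have hxm : AEStronglyMeasurable x band :=
    (measurable_beta d τ).inv.aestronglyMeasurable.smul hhm
  have hxh : (fun lam => beta d τ lam • x lam) =ᵐ[band] h := by
    filter_upwards [ae_beta_ne_zero d τ hτ] with lam h0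
    rw [hx, smul_smul, mul_inv_cancel₀ h0, one_smul]
  -- Θ^⊤ is bounded, so it may be applied term by term; it turns ∑ eₘ Ψₘ into ∑ Eₘ δₘ.
  have hTx : (fun lam => rowOp (Θ lam) (x lam)) =ᵐ[band] E := by
    filter_upwards [hh, hΨΨ, heE, hE0, ae_beta_ne_zero d τ hτ, hΨ.ae_apply_eq hΘ]
      with lam h1 h2 h3 h4 h5 h6
    have h7 := (h1.const_smul (beta d τ lam)⁻¹).mapL (rowOp (Θ lam))
    refine h7.unique ?_
    have h8 : ∀ m, rowOp (Θ lam) ((beta d τ lam)⁻¹ • (beta d τ lam * e lam m) • Ψ' lam m) =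
        E lam m • unitVec m := fun m => by
      rw [smul_smul, inv_mul_cancel_left₀ h5, map_smul, h2, h3]
      rcases lt_or_ge (m : ℕ∞) M with hm | hm
      · rw [h6 m hm]
      · rw [h4 m hm, zero_smul, zero_smul]
    simp only [h8]
    exact hasSum_unitVec _
  have hTxs : HasSeries (fun lam => rowOp (Θ lam) (x lam)) (causal ε) := hE.congr hTx.symm
  have hxS : Integrable (fun lam => quad (weighted d τ (f + g) lam) (x lam)) band := by
    refine (hTxs.1.integrable_norm_pow (p := 2) (by norm_num)).congr ?_
    filter_upwards [hΘ.quad_eq] with lam h1 using (h1 _).symm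
  have hxA : Approx d τ (f + g) x := fun η hη => by
    obtain ⟨δ, hδ, hδη⟩ := exists_ofReal_lt hη
    obtain ⟨α, hα⟩ := hΘ.exists_cpoly_near hS hE hε0 (δ := 1 / (2 * Real.pi) * δ) (by positivity)
    refine ⟨α, lt_of_le_of_lt ?_ hδη⟩
    obtain ⟨y, hy⟩ := hcs α
    have h1 : Integrable (fun lam => ‖rowOp (Θ lam) (cpoly α lam) - E lam‖ ^ 2) band :=
      (hy.1.sub hE.1).integrable_norm_pow (by norm_num)
    have h2 := lt_of_mul_lt_mul_left hα (by positivity)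
    refine le_trans (le_of_eq ?_) (ENNReal.ofReal_le_ofReal h2.le)
    rw [ofReal_integral_eq_lintegral_ofReal h1 (Eventually.of_forall fun _ => by positivity)]
    refine lintegral_congr_ae ?_
    filter_upwards [hΘ.quad_eq, hTx] with lam h3 h4
    rw [h3, map_sub, h4, norm_sub_rev]
  have hxL := beta_smul_mem_L20 hxm hxS hxA
  refine ⟨L20_congr hxh hxL, fun h' hh' => ?_⟩
  have h1 : mse d τ b h f g = optMSE d τ b f g := by
    rw [← mse_congr hxh, (hmse hxm hxS hTxs).1, hopt.1]
    have : ∫ lam, ‖rowOp (Θ lam) (x lam) - E lam‖ ^ 2 ∂band = 0 := by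
      refine integral_eq_zero_of_ae ?_
      filter_upwards [hTx] with lam h2
      rw [h2]; simp
    rw [this, mul_zero, add_zero]
  rw [h1]
  exact iInf₂_le h' hh'

end Projection

/-! ### Exchanging signal and noise -/

section Swap

variable {d τ : ℕ} {b : ℕ → Vec} {f g S : Density}

lemma sqNorm_sub_le (hS : IsSpectralDensity d τ S) {h h' : ℝ → Vec}
    (hh : AEStronglyMeasurable h band) :
    sqNorm S (h - h') ≤ 2 * sqNorm S h + 2 * sqNorm S h' := by
  simp only [sqNorm]
  rw [mul_left_comm, mul_left_comm 2, ← mul_add]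
  refine mul_le_mul_right ?_ _
  rw [← lintegral_const_mul' _ _ (by simp), ← lintegral_const_mul' _ _ (by simp),
    ← lintegral_add_left' ((aesm_quad hS.measurable hh).aemeasurable.ennreal_ofReal.const_mul _)]
  refine lintegral_mono_ae ?_
  filter_upwards [hS.positive] with lam pS
  have h1 := quad_add_le pS one_pos (h lam) (-h' lam)
  rw [quad_neg_right, ← sub_eq_add_neg, inv_one, one_add_one_eq_two] at h1
  have e1 := quad_nonneg pS (h lam)
  have e2 := quad_nonneg pS (h' lam)
  have h2 : ∀ r : ℝ, 2 * ENNReal.ofReal r = ENNReal.ofReal (2 * r) := fun r => by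
    rw [ENNReal.ofReal_mul zero_le_two, ENNReal.ofReal_ofNat]
  rw [h2, h2, ← ENNReal.ofReal_add (by positivity) (by positivity)]
  exact ENNReal.ofReal_le_ofReal h1

lemma trigPoly_sub (α α' : ℕ × ℕ →₀ ℂ) :
    trigPoly d τ (α - α') = trigPoly d τ α - trigPoly d τ α' := by
  ext1 lam
  rw [Pi.sub_apply, trigPoly_eq, trigPoly_eq, trigPoly_eq, map_sub, Pi.sub_apply, smul_sub]

lemma L20_sub (hS : IsSpectralDensity d τ S) {h h' : ℝ → Vec} (hh : h ∈ L20 d τ S)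
    (hh' : h' ∈ L20 d τ S) : h - h' ∈ L20 d τ S := by
  refine ⟨hh.1.sub hh'.1, (sqNorm_sub_le hS hh.1).trans_lt (ENNReal.add_lt_top.2
    ⟨ENNReal.mul_lt_top (by simp) hh.2.1, ENNReal.mul_lt_top (by simp) hh'.2.1⟩), fun ε hε => ?_⟩
  have hε' : ε / 4 ≠ 0 := (ENNReal.div_pos hε (by simp)).ne'
  obtain ⟨α, hα⟩ := hh.2.2 _ hε'
  obtain ⟨α', hα'⟩ := hh'.2.2 _ hε'
  refine ⟨α - α', ?_⟩
  rw [trigPoly_sub, sub_sub_sub_comm]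
  refine (sqNorm_sub_le hS (hh.1.sub (aesm_trigPoly α))).trans_lt ?_
  have h1 : ∀ x : ℝ≥0∞, x < ε / 4 → 2 * x < ε / 2 := fun x hx => by
    rw [ENNReal.lt_div_iff_mul_lt (by simp) (by simp)] at hx ⊢
    calc 2 * x * 2 = x * 4 := by ring
      _ < ε := hx
  exact (ENNReal.add_lt_add (h1 _ hα) (h1 _ hα')).trans_eq (ENNReal.add_halves ε)

/-- B is causal and bounded, so βB is itself an admissible characteristic. Hence h ↦ βB - h
preserves L₂⁰(f + g). -/
lemma beta_smul_bFun_mem_L20 (hS : IsSpectralDensity d τ S) (hb : Summable fun j => ‖b j‖) :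
    (fun lam => beta d τ lam • bFun b lam) ∈ L20 d τ S := by
  have h1 := hasSeries_bFun hb
  have h2 := hS.integrable_quad_of_bound (aesm_bFun hb) (norm_bFun_le hb)
  refine beta_smul_mem_L20 h1.1.1 h2 (approx_of_causal hS h1.integrable (fun n hn => ?_) h2)
  rw [h1.2, causal_of_pos _ hn]

/-- Estimating the signal by h leaves the same residual pair as estimating the noise by βB - h, in
the opposite order. -/
lemma mse_swap (h : ℝ → Vec) :
    mse d τ b ((fun lam => beta d τ lam • bFun b lam) - h) g f = mse d τ b h f g := by
  simp only [mse, Pi.sub_apply, sub_sub_cancel, add_comm]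

lemma optMSE_swap (hf : IsSpectralDensity d τ f) (hg : IsSpectralDensity d τ g)
    (hb : Summable fun j => ‖b j‖) : optMSE d τ b f g = optMSE d τ b g f := by
  have key : ∀ {f g : Density}, IsSpectralDensity d τ f → IsSpectralDensity d τ g →
      optMSE d τ b f g ≤ optMSE d τ b g f := fun {f g} hf hg => by
    refine le_iInf₂ fun h hh => ?_
    rw [add_comm] at hh
    rw [← mse_swap h]
    exact iInf₂_le _ (L20_sub (hf.add hg) (beta_smul_bFun_mem_L20 (hf.add hg) hb) hh)
  exact le_antisymm (key hf hg) (key hg hf)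

lemma IsOptimal.mse_eq {h : ℝ → Vec} (hh : IsOptimal d τ b f g h) :
    mse d τ b h f g = optMSE d τ b f g :=
  le_antisymm (le_iInf₂ hh.2) (iInf₂_le h hh.1)

lemma isOptimal_of_mse_le {h : ℝ → Vec} (h1 : h ∈ L20 d τ (f + g))
    (h2 : mse d τ b h f g ≤ optMSE d τ b f g) : IsOptimal d τ b f g h :=
  ⟨h1, fun h' hh' => h2.trans (iInf₂_le h' hh')⟩

lemma IsOptimal.swap (hf : IsSpectralDensity d τ f) (hg : IsSpectralDensity d τ g)
    (hb : Summable fun j => ‖b j‖) {h : ℝ → Vec} (hh : IsOptimal d τ b g f h) :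
    IsOptimal d τ b f g ((fun lam => beta d τ lam • bFun b lam) - h) := by
  refine isOptimal_of_mse_le (L20_sub (hf.add hg) (beta_smul_bFun_mem_L20 (hf.add hg) hb) ?_) ?_
  · rw [add_comm]; exact hh.1
  · rw [mse_swap, hh.mse_eq, optMSE_swap hf hg hb]

lemma IsOptimal.congr {h h' : ℝ → Vec} (hh : IsOptimal d τ b f g h) (e : h =ᵐ[band] h') :
    IsOptimal d τ b f g h' :=
  ⟨L20_congr e hh.1, fun k hk => by rw [← mse_congr e]; exact hh.2 k hk⟩

theorem optMSE_of_noise_factorization (hτ : 0 < τ) (hf : IsSpectralDensity d τ f)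
    (hg : IsSpectralDensity d τ g) (hb : Summable fun j => ‖b j‖) {ψ ω : ℕ → ℕ → Vec}
    (hψ : InverseFactor d τ (f + g) ψ) (hω : CanonicalCoeffs d τ b g ω) :
    (optMSE d τ b f g = ENNReal.ofReal (sqSum (tildeB ω b) - sqSum (psiC ψ (gramB ω b))) ∧
      0 ≤ sqSum (tildeB ω b) - sqSum (psiC ψ (gramB ω b))) ∧
    ∀ h, IsNoiseChar d τ b ψ ω h → IsOptimal d τ b f g h := by
  rw [add_comm] at hψ
  obtain ⟨h1, h2⟩ := optMSE_of_factorization hτ hg hf hb hψ hω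
  refine ⟨by rw [optMSE_swap hf hg hb]; exact h1, ?_⟩
  rintro h ⟨x, hx, hh⟩
  exact ((h2 x hx).swap hf hg hb).congr (by filter_upwards [hh] with lam e using e.symm)

end Swap

/-! ### Minimax spectral characteristics -/

lemma liminf_add_liminf_le (F G : ℕ → ℝ≥0∞) :
    liminf F atTop + liminf G atTop ≤ liminf (fun n => F n + G n) atTop := by
  simp only [liminf_eq_iSup_iInf_of_nat]
  have hm : ∀ H : ℕ → ℝ≥0∞, Monotone fun n => ⨅ i, ⨅ (_ : i ≥ n), H i := fun H m n hmn =>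
    le_iInf₂ fun i hi => iInf₂_le i (hmn.trans hi)
  rw [ENNReal.iSup_add_iSup_of_monotone (hm F) (hm G)]
  exact iSup_mono fun n => le_iInf₂ fun i hi => add_le_add (iInf₂_le i hi) (iInf₂_le i hi)

/-- Values below a level infinitely often give a subsequence below it; seminorm convergence passes
to the subsequence, so `FormLSC` bounds the limit by the level. -/
lemma FormLSC.ofReal_le_liminf {A S : Vec →L[ℂ] Vec} (h : FormLSC A S)
    {x : ℕ → Vec} {y : Vec} (hx : Tendsto (fun n => quad S (x n - y)) atTop (𝓝 0)) :
    ENNReal.ofReal (quad A y) ≤ liminf (fun n => ENNReal.ofReal (quad A (x n))) atTop := by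
  refine le_of_forall_gt fun c hc => ?_
  obtain ⟨r, hr, hrc⟩ := exists_between hc
  have hf := frequently_lt_of_liminf_lt (h := hr)
  obtain ⟨ns, hns, hlt⟩ := extraction_of_frequently_atTop hf
  have hrt : r ≠ ∞ := (hrc.trans_le le_top).ne
  have h1 := h (x ∘ ns) y r.toReal (hx.comp hns.tendsto_atTop) fun n =>
    (ENNReal.ofReal_le_iff_le_toReal hrt).1 (hlt n).le
  exact ((ENNReal.ofReal_le_iff_le_toReal hrt).2 h1).trans_lt hrc

section Minimax

variable {d τ : ℕ} {b : ℕ → Vec} {f g f₀ g₀ S : Density}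

lemma quad_convex (f f₀ : Density) (s t : ℝ) (lam : ℝ) (x : Vec) :
    quad ((s • f₀ + t • f) lam) x = s * quad (f₀ lam) x + t * quad (f lam) x := by
  have h : ∀ (r : ℝ) (A : Vec →L[ℂ] Vec), quad (r • A) x = r * quad A x := fun r A => by
    rw [← quad_smul_left]
    rfl
  rw [Pi.add_apply, Pi.smul_apply, Pi.smul_apply, quad_add_left, h, h]

lemma mse_convex (hf : IsSpectralDensity d τ f) (hg : IsSpectralDensity d τ g)
    (hf₀ : IsSpectralDensity d τ f₀) (hg₀ : IsSpectralDensity d τ g₀)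
    (hb : Summable fun j => ‖b j‖) {h : ℝ → Vec} (hh : AEStronglyMeasurable h band)
    {s t : ℝ} (hs : 0 ≤ s) (ht : 0 ≤ t) :
    mse d τ b h (s • f₀ + t • f) (s • g₀ + t • g) =
      ENNReal.ofReal s * mse d τ b h f₀ g₀ + ENNReal.ofReal t * mse d τ b h f g := by
  simp only [mse]
  rw [mul_left_comm, mul_left_comm (ENNReal.ofReal t), ← mul_add]
  congr 1
  rw [← lintegral_const_mul' _ _ ENNReal.ofReal_ne_top,
    ← lintegral_const_mul' _ _ ENNReal.ofReal_ne_top, ← lintegral_add_left']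
  swap
  · refine AEMeasurable.const_mul (AEStronglyMeasurable.aemeasurable ?_).ennreal_ofReal _
    exact (aesm_quad hf₀.measurable ((aesm_beta_smul (aesm_bFun hb)).sub hh)).add
      (aesm_quad hg₀.measurable hh)
  refine lintegral_congr_ae ?_
  filter_upwards [hf.positive, hg.positive, hf₀.positive, hg₀.positive] with lam pf pg pf₀ pg₀
  have e1 := quad_nonneg pf (beta d τ lam • bFun b lam - h lam)
  have e2 := quad_nonneg pg (h lam)
  have e3 := quad_nonneg pf₀ (beta d τ lam • bFun b lam - h lam)
  have e4 := quad_nonneg pg₀ (h lam)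
  rw [quad_convex, quad_convex, ← ENNReal.ofReal_mul hs, ← ENNReal.ofReal_mul ht,
    ← ENNReal.ofReal_add (by positivity) (by positivity)]
  congr 1
  ring

/-- Parallelogram identity for the error: if h is optimal, the midpoint is no better, so the squared
distance from h to h' is at most twice the excess of h'. The midpoint is written as h - (h - h')/2
so that closure under differences and multiples suffices. -/
lemma mse_midpoint (hf : IsSpectralDensity d τ f) (hg : IsSpectralDensity d τ g)
    (hb : Summable fun j => ‖b j‖) {h h' : ℝ → Vec} (hh : AEStronglyMeasurable h band)
    (hh' : AEStronglyMeasurable h' band) :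
    4 * mse d τ b (h - (2⁻¹ : ℂ) • (h - h')) f g + sqNorm (f + g) (h - h') =
      2 * mse d τ b h f g + 2 * mse d τ b h' f g := by
  have hm : ∀ {k : ℝ → Vec}, AEStronglyMeasurable k band → AEMeasurable (fun lam =>
      ENNReal.ofReal (quad (f lam) (beta d τ lam • bFun b lam - k lam) + quad (g lam) (k lam)))
      band := fun hk => by
    refine (AEStronglyMeasurable.aemeasurable ?_).ennreal_ofReal
    exact (aesm_quad hf.measurable ((aesm_beta_smul (aesm_bFun hb)).sub hk)).add
      (aesm_quad hg.measurable hk)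
  simp only [mse, sqNorm]
  rw [mul_left_comm 4, mul_left_comm 2, mul_left_comm 2, ← mul_add, ← mul_add]
  congr 1
  rw [← lintegral_const_mul' _ _ (by simp), ← lintegral_const_mul' _ _ (by simp),
    ← lintegral_const_mul' _ _ (by simp),
    ← lintegral_add_left' ((hm (hh.sub ((hh.sub hh').const_smul _))).const_mul _),
    ← lintegral_add_left' ((hm hh).const_mul _)]
  refine lintegral_congr_ae ?_
  filter_upwards [hf.positive, hg.positive] with lam pf pg
  have n1 := fun x => quad_nonneg pf x
  have n2 := fun x => quad_nonneg pg x
  have k2 : ∀ r : ℝ, 2 * ENNReal.ofReal r = ENNReal.ofReal (2 * r) := fun r => by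
    rw [ENNReal.ofReal_mul zero_le_two, ENNReal.ofReal_ofNat]
  have k4 : ∀ r : ℝ, 4 * ENNReal.ofReal r = ENNReal.ofReal (4 * r) := fun r => by
    rw [ENNReal.ofReal_mul zero_le_four, ENNReal.ofReal_ofNat]
  have e1 := quad_parallelogram pf (beta d τ lam • bFun b lam - h lam)
    (beta d τ lam • bFun b lam - h' lam)
  have e2 := quad_parallelogram pg (h lam) (h' lam)
  have e3 : (2⁻¹ : ℂ) • (beta d τ lam • bFun b lam - h lam + (beta d τ lam • bFun b lam - h' lam)) =
      beta d τ lam • bFun b lam - (h lam - (2⁻¹ : ℂ) • (h lam - h' lam)) := by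
    module
  have e4 : (2⁻¹ : ℂ) • (h lam + h' lam) = h lam - (2⁻¹ : ℂ) • (h lam - h' lam) := by module
  rw [e3, sub_sub_sub_cancel_left, quad_sub_comm _ (h' lam) (h lam)] at e1
  rw [e4] at e2
  have e5 : quad ((f + g) lam) (h lam - h' lam) = quad (f lam) (h lam - h' lam) +
    quad (g lam) (h lam - h' lam) := quad_add_left _ _ _
  simp only [Pi.sub_apply, Pi.smul_apply, e5]
  rw [k2, k2, k4, ← ENNReal.ofReal_add (mul_nonneg zero_le_four (add_nonneg (n1 _) (n2 _)))
      (add_nonneg (n1 _) (n2 _)),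
    ← ENNReal.ofReal_add (mul_nonneg zero_le_two (add_nonneg (n1 _) (n2 _)))
      (mul_nonneg zero_le_two (add_nonneg (n1 _) (n2 _)))]
  congr 1
  linarith

lemma L20_smul {h : ℝ → Vec} (hh : h ∈ L20 d τ S) (z : ℂ) : z • h ∈ L20 d τ S := by
  have h1 : ∀ k : ℝ → Vec, sqNorm S (z • k) = ENNReal.ofReal (‖z‖ ^ 2) * sqNorm S k := fun k => by
    simp only [sqNorm, Pi.smul_apply, quad_smul_right]
    rw [mul_left_comm, ← lintegral_const_mul' (ENNReal.ofReal (‖z‖ ^ 2)) _ ENNReal.ofReal_ne_top]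
    simp only [ENNReal.ofReal_mul (sq_nonneg ‖z‖)]
  refine ⟨hh.1.const_smul z, ?_, fun ε hε => ?_⟩
  · rw [h1]
    exact ENNReal.mul_lt_top ENNReal.ofReal_lt_top hh.2.1
  · obtain ⟨α, hα⟩ := hh.2.2 (ε / (ENNReal.ofReal (‖z‖ ^ 2) + 1))
      (ENNReal.div_pos hε (by simp)).ne'
    refine ⟨z • α, ?_⟩
    have h2 : z • h - trigPoly d τ (z • α) = z • (h - trigPoly d τ α) := by
      ext1 lam
      simp only [Pi.sub_apply, Pi.smul_apply, trigPoly_eq, map_smul, smul_sub]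
      rw [smul_comm]
    rw [h2, h1]
    rw [ENNReal.lt_div_iff_mul_lt (by simp) (by simp)] at hα
    refine lt_of_le_of_lt ?_ hα
    rw [mul_comm]
    gcongr
    exact le_self_add

/-- Write V = Δ(f⁰, g⁰), and m₀, m₁ for the errors of a polynomial for (f⁰, g⁰) and (f, g). The
error is affine in the densities, so near-optimality for the mixture reads (1 - ε)m₀ + εm₁ < V + ε².
Then m₀ ≥ V gives m₁ < V + ε, while m₁ ≥ 0 bounds m₀ - V, and the parallelogram identity turns this
into closeness to h₀. -/
lemma exists_near_optimal (hf : IsSpectralDensity d τ f) (hg : IsSpectralDensity d τ g)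
    (hf₀ : IsSpectralDensity d τ f₀) (hg₀ : IsSpectralDensity d τ g₀)
    (hb : Summable fun j => ‖b j‖) {h₀ : ℝ → Vec} (hopt : IsOptimal d τ b f₀ g₀ h₀)
    {ε : ℝ} (hε : 0 < ε) (hε1 : ε ≤ 1 / 2)
    (hfε : IsSpectralDensity d τ ((1 - ε) • f₀ + ε • f))
    (hgε : IsSpectralDensity d τ ((1 - ε) • g₀ + ε • g))
    (hle : optMSE d τ b ((1 - ε) • f₀ + ε • f) ((1 - ε) • g₀ + ε • g) ≤ optMSE d τ b f₀ g₀) :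
    ∃ α, mse d τ b (trigPoly d τ α) f g ≤ optMSE d τ b f₀ g₀ + ENNReal.ofReal ε ∧
      sqNorm (f₀ + g₀) (h₀ - trigPoly d τ α) ≤
        ENNReal.ofReal (4 * ε * ((optMSE d τ b f₀ g₀).toReal + 1)) := by
  have hV : optMSE d τ b f₀ g₀ ≠ ∞ := by
    rw [← hopt.mse_eq]
    exact (mse_lt_top hf₀ hg₀ hb hopt.1).ne
  -- The tolerance is ε² because the bound for m₁ is obtained after division by ε.
  obtain ⟨α, hα⟩ : ∃ α, mse d τ b (trigPoly d τ α) ((1 - ε) • f₀ + ε • f)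
      ((1 - ε) • g₀ + ε • g) < optMSE d τ b f₀ g₀ + ENNReal.ofReal (ε ^ 2) := by
    rw [← iInf_lt_iff, ← optMSE_eq_iInf hfε hgε hb]
    refine hle.trans_lt (ENNReal.lt_add_right hV ?_)
    simpa using by positivity
  rw [mse_convex hf hg hf₀ hg₀ hb (aesm_trigPoly α) (by linarith) hε.le] at hα
  have h0 := trigPoly_mem_L20 (hf₀.add hg₀) α
  have hm0 := (mse_lt_top hf₀ hg₀ hb h0).ne
  have hm1 := (mse_lt_top hf hg hb (trigPoly_mem_L20 (hf.add hg) α)).ne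
  have hge : optMSE d τ b f₀ g₀ ≤ mse d τ b (trigPoly d τ α) f₀ g₀ := iInf₂_le _ h0
  have hmid : optMSE d τ b f₀ g₀ ≤
      mse d τ b (h₀ - (2⁻¹ : ℂ) • (h₀ - trigPoly d τ α)) f₀ g₀ :=
    iInf₂_le _ (L20_sub (hf₀.add hg₀) hopt.1 (L20_smul (L20_sub (hf₀.add hg₀) hopt.1 h0) _))
  have hpar := mse_midpoint hf₀ hg₀ hb hopt.1.1 (aesm_trigPoly (d := d) (τ := τ) α)
  rw [hopt.mse_eq] at hpar
  have hpar' : 4 * optMSE d τ b f₀ g₀ + sqNorm (f₀ + g₀) (h₀ - trigPoly d τ α) ≤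
      2 * optMSE d τ b f₀ g₀ + 2 * mse d τ b (trigPoly d τ α) f₀ g₀ := by
    rw [← hpar]
    gcongr
  have hN : sqNorm (f₀ + g₀) (h₀ - trigPoly d τ α) ≠ ∞ :=
    (L20_sub (hf₀.add hg₀) hopt.1 h0).2.1.ne
  refine ⟨α, ?_⟩
  set V := optMSE d τ b f₀ g₀
  set m0 := mse d τ b (trigPoly d τ α) f₀ g₀
  set m1 := mse d τ b (trigPoly d τ α) f g
  set N := sqNorm (f₀ + g₀) (h₀ - trigPoly d τ α)
  clear_value V m0 m1 N
  lift V to NNReal using hV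
  lift m0 to NNReal using hm0
  lift m1 to NNReal using hm1
  lift N to NNReal using hN
  simp only [ENNReal.coe_toReal]
  have c : ∀ x : NNReal, (x : ℝ≥0∞) = ENNReal.ofReal x := fun x =>
    (ENNReal.ofReal_coe_nnreal).symm
  have hN0 := N.coe_nonneg
  have hV0 := V.coe_nonneg
  have hm00 := m0.coe_nonneg
  have hm10 := m1.coe_nonneg
  have r1 : (1 - ε) * (m0 : ℝ) + ε * m1 < V + ε ^ 2 := by
    have h1ε : 0 ≤ 1 - ε := by linarith
    rw [c, c, c, ← ENNReal.ofReal_mul h1ε, ← ENNReal.ofReal_mul hε.le,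
      ← ENNReal.ofReal_add (mul_nonneg h1ε hm00) (mul_nonneg hε.le hm10),
      ← ENNReal.ofReal_add hV0 (sq_nonneg ε)] at hα
    exact (ENNReal.ofReal_lt_ofReal_iff_of_nonneg (add_nonneg (mul_nonneg h1ε hm00)
      (mul_nonneg hε.le hm10))).1 hα
  have r2 : (V : ℝ) ≤ m0 := by exact_mod_cast hge
  have r3 : 4 * (V : ℝ) + N ≤ 2 * V + 2 * m0 := by exact_mod_cast hpar'
  have r4 : (m1 : ℝ) < V + ε := by nlinarith
  refine ⟨?_, ?_⟩
  · rw [c, c, ← ENNReal.ofReal_add hV0 hε.le]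
    exact ENNReal.ofReal_le_ofReal r4.le
  · rw [c]
    refine ENNReal.ofReal_le_ofReal ?_
    -- From (1 - ε)(m₀ - V) ≤ εV + ε² and 1 - ε ≥ 1/2.
    have r5 : (m0 : ℝ) - V ≤ 2 * ε * (V + 1) := by
      have : (1 - ε) * ((m0 : ℝ) - V) ≤ ε * V + ε ^ 2 := by
        nlinarith [mul_nonneg hε.le hm10]
      nlinarith
    linarith

/-- The optimal characteristic for least favourable densities is optimal for all densities. -/
lemma mse_le_of_leastFavourable (hf : IsSpectralDensity d τ f) (hg : IsSpectralDensity d τ g)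
    (hf₀ : IsSpectralDensity d τ f₀) (hg₀ : IsSpectralDensity d τ g₀)
    (hb : Summable fun j => ‖b j‖) {h₀ : ℝ → Vec} (hopt : IsOptimal d τ b f₀ g₀ h₀)
    (hε : ∀ ε : ℝ, 0 < ε → ε ≤ 1 / 2 → IsSpectralDensity d τ ((1 - ε) • f₀ + ε • f) ∧
      IsSpectralDensity d τ ((1 - ε) • g₀ + ε • g) ∧
      optMSE d τ b ((1 - ε) • f₀ + ε • f) ((1 - ε) • g₀ + ε • g) ≤ optMSE d τ b f₀ g₀)
    (hLf : ∀ᵐ lam ∂band, FormLSC (f lam) (f₀ lam + g₀ lam))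
    (hLg : ∀ᵐ lam ∂band, FormLSC (g lam) (f₀ lam + g₀ lam)) :
    mse d τ b h₀ f g ≤ optMSE d τ b f₀ g₀ := by
  have hS := hf₀.add hg₀
  have he0 : ∀ n : ℕ, (0 : ℝ) < 1 / (n + 2) := fun n => by positivity
  have he1 : ∀ n : ℕ, (1 : ℝ) / (n + 2) ≤ 1 / 2 := fun n => by gcongr; linarith [n.cast_nonneg (α := ℝ)]
  have het : Tendsto (fun n : ℕ => (1 : ℝ) / (n + 2)) atTop (𝓝 0) := by
    have := (tendsto_const_div_atTop_nhds_zero_nat (1 : ℝ)).comp (tendsto_add_atTop_nat 2)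
    simpa [Function.comp_def] using this
  choose α hα1 hα2 using fun n : ℕ => exists_near_optimal hf hg hf₀ hg₀ hb hopt (he0 n) (he1 n)
    (hε _ (he0 n) (he1 n)).1 (hε _ (he0 n) (he1 n)).2.1 (hε _ (he0 n) (he1 n)).2.2
  have hN : Tendsto (fun n => ∫⁻ lam, ENNReal.ofReal
      (quad ((f₀ + g₀) lam) (h₀ lam - trigPoly d τ (α n) lam)) ∂band) atTop (𝓝 0) := by
    have h1 : Tendsto (fun n => sqNorm (f₀ + g₀) (h₀ - trigPoly d τ (α n))) atTop (𝓝 0) := by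
      refine tendsto_of_tendsto_of_tendsto_of_le_of_le tendsto_const_nhds ?_ (fun _ => bot_le) hα2
      have := ENNReal.tendsto_ofReal
        ((het.const_mul 4).mul_const ((optMSE d τ b f₀ g₀).toReal + 1))
      simpa using this
    have h2 := ENNReal.Tendsto.const_mul (a := (ENNReal.ofReal (1 / (2 * Real.pi)))⁻¹) h1
      (Or.inr (ENNReal.inv_ne_top.2 ofReal_two_pi_ne_zero))
    simp only [sqNorm, Pi.sub_apply, mul_zero] at h2
    simpa only [← mul_assoc, ENNReal.inv_mul_cancel ofReal_two_pi_ne_zero ENNReal.ofReal_ne_top,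
      one_mul] using h2
  obtain ⟨ns, hns, hae⟩ := exists_subseq_tendsto_zero_ae (fun n => (aesm_quad hS.measurable
    (hopt.1.1.sub (aesm_trigPoly (α n)))).aemeasurable.ennreal_ofReal) hN
  set c := ENNReal.ofReal (1 / (2 * Real.pi)) with hc
  set F : ℕ → ℝ → ℝ≥0∞ := fun n lam => ENNReal.ofReal
    (quad (f lam) (beta d τ lam • bFun b lam - trigPoly d τ (α (ns n)) lam) +
      quad (g lam) (trigPoly d τ (α (ns n)) lam)) with hF
  have hFm : ∀ n, AEMeasurable (F n) band := fun n => by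
    refine (AEStronglyMeasurable.aemeasurable ?_).ennreal_ofReal
    exact (aesm_quad hf.measurable ((aesm_beta_smul (aesm_bFun hb)).sub (aesm_trigPoly _))).add
      (aesm_quad hg.measurable (aesm_trigPoly _))
  -- The convergence to h₀ is known only in the seminorm of f₀ + g₀, which need not control f and g.
  -- Lower semicontinuity supplies the inequality in the direction needed for Fatou's lemma.
  have h1 : ∫⁻ lam, ENNReal.ofReal (quad (f lam) (beta d τ lam • bFun b lam - h₀ lam) +
      quad (g lam) (h₀ lam)) ∂band ≤ ∫⁻ lam, liminf (fun n => F n lam) atTop ∂band := by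
    refine lintegral_mono_ae ?_
    filter_upwards [hae, hLf, hLg, hf.positive, hg.positive, hS.positive]
      with lam ht lf lg pf pg pS
    have ht' : Tendsto (fun n => quad (f₀ lam + g₀ lam)
        (h₀ lam - trigPoly d τ (α (ns n)) lam)) atTop (𝓝 0) := by
      have := (ENNReal.tendsto_toReal ENNReal.zero_ne_top).comp ht
      simp only [Function.comp_def, ENNReal.toReal_ofReal (quad_nonneg pS _),
        ENNReal.toReal_zero] at this
      exact this
    have l1 := lf.ofReal_le_liminf (y := beta d τ lam • bFun b lam - h₀ lam)
      (x := fun n => beta d τ lam • bFun b lam - trigPoly d τ (α (ns n)) lam)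
      (by simpa only [sub_sub_sub_cancel_left] using ht')
    have l2 := lg.ofReal_le_liminf (y := h₀ lam) (x := fun n => trigPoly d τ (α (ns n)) lam)
      (by simpa only [quad_sub_comm _ (trigPoly d τ _ lam)] using ht')
    rw [ENNReal.ofReal_add (quad_nonneg pf _) (quad_nonneg pg _)]
    refine (add_le_add l1 l2).trans ((liminf_add_liminf_le _ _).trans (le_of_eq ?_))
    congr 1
    ext1 n
    exact (ENNReal.ofReal_add (quad_nonneg pf _) (quad_nonneg pg _)).symm
  have h2 := h1.trans (lintegral_liminf_le' hFm)
  have h3 : ∀ n, ∫⁻ lam, F n lam ∂band ≤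
      c⁻¹ * (optMSE d τ b f₀ g₀ + ENNReal.ofReal (1 / ((ns n : ℕ) + 2))) := fun n => by
    have h4 : c * ∫⁻ lam, F n lam ∂band ≤ _ := hα1 (ns n)
    calc ∫⁻ lam, F n lam ∂band = c⁻¹ * (c * ∫⁻ lam, F n lam ∂band) := by
          rw [← mul_assoc, ENNReal.inv_mul_cancel ofReal_two_pi_ne_zero ENNReal.ofReal_ne_top,
            one_mul]
      _ ≤ _ := by gcongr
  have h4 : Tendsto (fun n => c⁻¹ * (optMSE d τ b f₀ g₀ +
      ENNReal.ofReal (1 / ((ns n : ℕ) + 2)))) atTop (𝓝 (c⁻¹ * optMSE d τ b f₀ g₀)) := by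
    refine ENNReal.Tendsto.const_mul ?_ (Or.inr (ENNReal.inv_ne_top.2 ofReal_two_pi_ne_zero))
    have := (ENNReal.tendsto_ofReal (het.comp hns.tendsto_atTop)).const_add (optMSE d τ b f₀ g₀)
    simpa [Function.comp_def] using this
  have h5 := h2.trans ((liminf_le_liminf (Eventually.of_forall h3)).trans_eq h4.liminf_eq)
  calc mse d τ b h₀ f g ≤ c * (c⁻¹ * optMSE d τ b f₀ g₀) := by rw [mse]; gcongr
    _ = _ := by
      rw [← mul_assoc, ENNReal.mul_inv_cancel ofReal_two_pi_ne_zero ENNReal.ofReal_ne_top, one_mul]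

/-- Saddle point: sup Δ(h₀; ·) ≤ Δ(f₀, g₀) ≤ Δ(h; f₀, g₀) ≤ sup Δ(h; ·). Only the first inequality
uses convexity and semicontinuity. -/
theorem isMinimax_of_leastFavourable {Df Dg : Set Density}
    (hDf : ∀ f ∈ Df, IsSpectralDensity d τ f) (hDg : ∀ g ∈ Dg, IsSpectralDensity d τ g)
    (hb : Summable fun j => ‖b j‖) (hreg : MinimaxRegular Df Dg f₀ g₀)
    (hLF : LeastFavourable d τ b Df Dg f₀ g₀) {h₀ : ℝ → Vec} (hopt : IsOptimal d τ b f₀ g₀ h₀)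
    (hHD : h₀ ∈ HD d τ Df Dg) : IsMinimax d τ b Df Dg h₀ := by
  obtain ⟨hcf, hcg, hLf, hLg⟩ := hreg
  obtain ⟨hf₀, hg₀, hmax⟩ := hLF
  refine ⟨hHD, fun h hh => ?_⟩
  have h1 : optMSE d τ b f₀ g₀ ≤ ⨆ f ∈ Df, ⨆ g ∈ Dg, mse d τ b h f g :=
    (iInf₂_le h (hh f₀ hf₀ g₀ hg₀)).trans (le_iSup₂_of_le f₀ hf₀ (le_iSup₂_of_le g₀ hg₀ le_rfl))
  refine le_trans (iSup₂_le fun f hf => iSup₂_le fun g hg => ?_) h1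
  refine mse_le_of_leastFavourable (hDf f hf) (hDg g hg) (hDf _ hf₀) (hDg _ hg₀) hb hopt
    (fun ε hε hε1 => ?_) (hLf f hf) (hLg g hg)
  have h2 := hcf hf₀ hf (a := 1 - ε) (b := ε) (by linarith) hε.le (by ring)
  have h3 := hcg hg₀ hg (a := 1 - ε) (b := ε) (by linarith) hε.le (by ring)
  exact ⟨hDf _ h2, hDg _ h3, hmax _ h2 _ h3⟩

end Minimax

/-! ### The stochastic meaning of the mean square errors -/

section Stochastic

variable {d τ : ℕ} {b : ℕ → Vec} {f g : Density}

lemma IsSpectralDensity.integrable_inner_of_bound (hf : IsSpectralDensity d τ f) {x y : ℝ → Vec}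
    (hx : AEStronglyMeasurable x band) (hy : AEStronglyMeasurable y band) {C D : ℝ}
    (hC : ∀ lam, ‖x lam‖ ≤ C) (hD : ∀ lam, ‖y lam‖ ≤ D) :
    Integrable (fun lam => inner ℂ (x lam) (weighted d τ f lam (y lam))) band := by
  refine (hf.integrable_wtr.const_mul (C * D)).mono'
    (hx.inner (aesm_apply hf.measurable_weighted hy)) ?_
  filter_upwards [hf.norm_apply_le] with lam h
  have h0 := wtr_nonneg d τ f lam
  calc ‖inner ℂ (x lam) (weighted d τ f lam (y lam))‖ ≤ ‖x lam‖ * ‖weighted d τ f lam (y lam)‖ :=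
        norm_inner_le_norm _ _
    _ ≤ C * (wtr d τ f lam * D) := by
        gcongr
        · exact (norm_nonneg _).trans (hC lam)
        · exact hC lam
        · refine (h _).trans ?_
          gcongr
          exact hD lam
    _ = _ := by ring

lemma IsSpectralDensity.integrable_inner_cpoly (hf : IsSpectralDensity d τ f)
    (α β : ℕ × ℕ →₀ ℂ) :
    Integrable (fun lam => inner ℂ (cpoly α lam) (weighted d τ f lam (cpoly β lam))) band := by
  obtain ⟨h1, C, hC⟩ := cpoly_continuous_bdd α
  obtain ⟨h2, D, hD⟩ := cpoly_continuous_bdd β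
  exact hf.integrable_inner_of_bound h1.aestronglyMeasurable h2.aestronglyMeasurable hC hD

/-- The combinations `∑ α_{jk} ζ_{k,-j}` of a sequence. -/
def seqPoly {H : Type} [AddCommGroup H] [Module ℂ H] (ζ : ℕ → ℤ → H) : (ℕ × ℕ →₀ ℂ) →ₗ[ℂ] H :=
  Finsupp.linearCombination ℂ fun p => ζ p.2 (-(p.1 : ℤ))

lemma seqPoly_single {H : Type} [AddCommGroup H] [Module ℂ H] (ζ : ℕ → ℤ → H) (p : ℕ × ℕ) (z : ℂ) :
    seqPoly ζ (Finsupp.single p z) = z • ζ p.2 (-(p.1 : ℤ)) := by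
  simp [seqPoly]

variable {H : Type} [NormedAddCommGroup H] [InnerProductSpace ℂ H]

/-- The spectral isometry on finite combinations: both sides are sesquilinear, and on single terms
the equality is the definition of the spectral density. -/
lemma inner_seqPoly (hf : IsSpectralDensity d τ f) {ζ : ℕ → ℤ → H}
    (hζ : ∀ (k n : ℕ) (l j : ℤ), inner ℂ (ζ n j) (ζ k l) =
      fourierCo (fun lam => (weight d τ lam : ℂ) * entry (f lam) k n) (j - l))
    (α β : ℕ × ℕ →₀ ℂ) :
    inner ℂ (seqPoly ζ α) (seqPoly ζ β) = (1 / (2 * Real.pi) : ℂ) *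
      ∫ lam, inner ℂ (cpoly α lam) (weighted d τ f lam (cpoly β lam)) ∂band := by
  induction α using Finsupp.induction_linear with
  | zero => simp
  | add α α' h1 h2 =>
    simp only [map_add, Pi.add_apply, inner_add_left]
    rw [integral_add (hf.integrable_inner_cpoly _ _) (hf.integrable_inner_cpoly _ _), mul_add,
      h1, h2]
  | single p z =>
    induction β using Finsupp.induction_linear with
    | zero => simp
    | add α α' h1 h2 =>
      simp only [map_add, Pi.add_apply, inner_add_right]
      rw [integral_add (hf.integrable_inner_cpoly _ _) (hf.integrable_inner_cpoly _ _), mul_add,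
        h1, h2]
    | single q w =>
      have h1 : ∀ (p : ℕ × ℕ) (z : ℂ) (lam : ℝ),
          cpoly (Finsupp.single p z) lam = z • ee p.1 lam • unitVec p.2 := fun p z lam => by
        rw [cpoly_apply, Finsupp.sum_single_index (by simp)]
      have h2 : ∀ lam, inner ℂ (cpoly (Finsupp.single p z) lam)
          (weighted d τ f lam (cpoly (Finsupp.single q w) lam)) =
          (starRingEnd ℂ z * w) * (ee (-(p.1 : ℤ) - -(q.1 : ℤ)) lam •
            ((weight d τ lam : ℂ) * entry (f lam) q.2 p.2)) := fun lam => by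
        rw [h1, h1, inner_smul_left, inner_smul_left, map_smul, map_smul, inner_smul_right,
          inner_smul_right, conj_ee, weighted, smul_apply, inner_smul_right, smul_eq_mul, entry,
          show -(p.1 : ℤ) - -(q.1 : ℤ) = -(p.1 : ℤ) + q.1 by ring, ee_add]
        ring
      simp only [h2]
      rw [seqPoly_single, seqPoly_single, inner_smul_left, inner_smul_right, hζ, fourierCo_eq,
        integral_const_mul, smul_eq_mul]
      ring

lemma norm_sq_seqPoly (hf : IsSpectralDensity d τ f) {ζ : ℕ → ℤ → H}
    (hζ : ∀ (k n : ℕ) (l j : ℤ), inner ℂ (ζ n j) (ζ k l) =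
      fourierCo (fun lam => (weight d τ lam : ℂ) * entry (f lam) k n) (j - l))
    (α : ℕ × ℕ →₀ ℂ) :
    ‖seqPoly ζ α‖ ^ 2 = 1 / (2 * Real.pi) *
      ∫ lam, quad (weighted d τ f lam) (cpoly α lam) ∂band := by
  have h1 := congrArg Complex.re (inner_seqPoly hf hζ α α)
  rw [inner_self_eq_norm_sq_to_K] at h1
  have h2 : (1 / (2 * Real.pi) : ℂ) = ((1 / (2 * Real.pi) : ℝ) : ℂ) := by push_cast; rfl
  have h3 := integral_re (hf.integrable_inner_cpoly α α)
  simp only [RCLike.re_eq_complex_re] at h3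
  rw [h2, Complex.re_ofReal_mul, ← h3] at h1
  unfold quad
  rw [← h1]
  norm_cast

/-- The square truncations of the series `∑ b_j e^{-ij lam}`. -/
def truncation (b : ℕ → Vec) (N : ℕ) : ℕ × ℕ →₀ ℂ :=
  ∑ j ∈ Finset.range N, ∑ k ∈ Finset.range N, Finsupp.single (j, k) (b j k)

lemma sum_range_eq_tsum {E : Type} [NormedAddCommGroup E] (u : ℕ → E) (N : ℕ) :
    ∑ j ∈ Finset.range N, u j = ∑' j, if j < N then u j else 0 := by
  rw [tsum_eq_sum (s := Finset.range N) fun j hj => if_neg (by simpa using hj)]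
  exact Finset.sum_congr rfl fun j hj => by rw [if_pos (Finset.mem_range.1 hj)]

/-- Square partial sums of a double series. -/
lemma tendsto_square_sums {E : Type} [NormedAddCommGroup E] [CompleteSpace E]
    {u : ℕ → ℕ → E} {s : ℕ → E}
    (hu : ∀ j, Tendsto (fun N => ∑ k ∈ Finset.range N, u j k) atTop (𝓝 (s j))) {B : ℕ → ℝ}
    (hB : Summable B) (huB : ∀ j N, ‖∑ k ∈ Finset.range N, u j k‖ ≤ B j) :
    Tendsto (fun N => ∑ j ∈ Finset.range N, ∑ k ∈ Finset.range N, u j k) atTop (𝓝 (∑' j, s j)) := by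
  simp_rw [sum_range_eq_tsum (fun j => ∑ k ∈ Finset.range _, u j k)]
  refine tendsto_tsum_of_dominated_convergence hB (fun j => ?_)
    (Eventually.of_forall fun N j => ?_)
  · refine (hu j).congr' ?_
    filter_upwards [eventually_gt_atTop j] with N hN
    rw [if_pos hN]
  · split_ifs
    · exact huB j N
    · rw [norm_zero]
      exact (norm_nonneg _).trans (huB j N)

lemma norm_partialSum_le (x : Vec) (N : ℕ) : ‖∑ k ∈ Finset.range N, x k • unitVec k‖ ≤ ‖x‖ := by
  refine (sq_le_sq₀ (norm_nonneg _) (norm_nonneg _)).1 ?_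
  rw [norm_sq_sum_unitVec]
  exact sum_le_hasSum _ (fun _ _ => by positivity) (hasSum_norm_sq x)

lemma cpoly_truncation (b : ℕ → Vec) (N : ℕ) (lam : ℝ) :
    cpoly (truncation b N) lam =
      ∑ j ∈ Finset.range N, ∑ k ∈ Finset.range N, ee j lam • b j k • unitVec k := by
  rw [truncation, map_sum, Finset.sum_apply]
  refine Finset.sum_congr rfl fun j _ => ?_
  rw [map_sum, Finset.sum_apply]
  refine Finset.sum_congr rfl fun k _ => ?_
  rw [cpoly_apply, Finsupp.sum_single_index (by simp), smul_comm]

lemma norm_cpoly_truncation_le (hb : Summable fun j => ‖b j‖) (N : ℕ) (lam : ℝ) :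
    ‖cpoly (truncation b N) lam‖ ≤ ∑' j, ‖b j‖ := by
  rw [cpoly_truncation]
  refine (norm_sum_le _ _).trans (le_trans (Finset.sum_le_sum fun j _ => ?_)
    (hb.sum_le_tsum (Finset.range N) fun _ _ => norm_nonneg _))
  rw [← Finset.smul_sum, norm_smul, norm_ee, one_mul]
  exact norm_partialSum_le _ _

lemma tendsto_cpoly_truncation (hb : Summable fun j => ‖b j‖) (lam : ℝ) :
    Tendsto (fun N => cpoly (truncation b N) lam) atTop (𝓝 (bFun b lam)) := by
  simp_rw [cpoly_truncation, bFun_eq]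
  refine tendsto_square_sums (fun j => ?_) hb fun j N => ?_
  · simp_rw [← Finset.smul_sum]
    exact (hasSum_unitVec (b j)).tendsto_sum_nat.const_smul _
  · rw [← Finset.smul_sum, norm_smul, norm_ee, one_mul]
    exact norm_partialSum_le _ _

/-- The total variance of the components at one time is bounded by the integral of the trace,
uniformly in the time index. This is what makes the inner series of `functionalB` converge. -/
lemma summable_norm_sq_seq (hf : IsSpectralDensity d τ f) {ζ : ℕ → ℤ → H}
    (hζ : ∀ (k n : ℕ) (l j : ℤ), inner ℂ (ζ n j) (ζ k l) =
      fourierCo (fun lam => (weight d τ lam : ℂ) * entry (f lam) k n) (j - l)) :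
    ∃ K, ∀ j : ℕ, ∀ s : Finset ℕ, ∑ k ∈ s, ‖ζ k (-(j : ℤ))‖ ^ 2 ≤ K := by
  refine ⟨1 / (2 * Real.pi) * ∫ lam, wtr d τ f lam ∂band, fun j s => ?_⟩
  have h1 : ∀ k, ‖ζ k (-(j : ℤ))‖ ^ 2 = 1 / (2 * Real.pi) *
      ∫ lam, quad (weighted d τ f lam) (cpoly (Finsupp.single (j, k) 1) lam) ∂band := fun k => by
    rw [← norm_sq_seqPoly hf hζ, seqPoly_single, one_smul]
  have h2 : ∀ k lam, quad (weighted d τ f lam) (cpoly (Finsupp.single (j, k) 1) lam) =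
      (entry (weighted d τ f lam) k k).re := fun k lam => by
    rw [cpoly_apply, Finsupp.sum_single_index (by simp), one_smul, quad_smul_right, norm_ee,
      entry_self_re]
    ring
  have h3 : ∀ k, Integrable (fun lam => (entry (weighted d τ f lam) k k).re) band := fun k =>
    hf.integrable_quad_of_bound (x := fun _ => unitVec k) aestronglyMeasurable_const
      fun _ => le_rfl
  simp_rw [h1, h2]
  rw [← Finset.mul_sum, ← integral_finsetSum _ fun k _ => h3 k]
  refine mul_le_mul_of_nonneg_left (integral_mono_ae (integrable_finsetSum _ fun k _ => h3 k)
    hf.integrable_wtr ?_) (by positivity)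
  filter_upwards [hf.hasSum_wtr, hf.positive_weighted] with lam h4 h5
  exact sum_le_hasSum _ (fun k _ => quad_nonneg h5 _) h4

/-- Cauchy–Schwarz in the components bounds the j-th inner sum by √K ‖b_j‖, a summable majorant. It
guarantees that the iterated `tsum` is a genuine limit and not a default value. -/
lemma tendsto_seqPoly_truncation [CompleteSpace H] (hf : IsSpectralDensity d τ f) {ζ : ℕ → ℤ → H}
    (hζ : ∀ (k n : ℕ) (l j : ℤ), inner ℂ (ζ n j) (ζ k l) =
      fourierCo (fun lam => (weight d τ lam : ℂ) * entry (f lam) k n) (j - l))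
    (hb : Summable fun j => ‖b j‖) :
    Tendsto (fun N => seqPoly ζ (truncation b N)) atTop
      (𝓝 (∑' j : ℕ, ∑' k : ℕ, b j k • ζ k (-(j : ℤ)))) := by
  obtain ⟨K, hK⟩ := summable_norm_sq_seq hf hζ
  have hfin : ∀ j : ℕ, ∀ s : Finset ℕ, ∑ k ∈ s, ‖b j k • ζ k (-(j : ℤ))‖ ≤ ‖b j‖ * √K :=
    fun j s => by
      simp only [norm_smul]
      refine (Real.sum_mul_le_sqrt_mul_sqrt s _ _).trans ?_
      gcongr
      · refine Real.sqrt_le_iff.2 ⟨norm_nonneg _, ?_⟩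
        exact sum_le_hasSum _ (fun _ _ => by positivity) (hasSum_norm_sq (b j))
      · exact hK j s
  have hs : ∀ j : ℕ, Summable fun k => b j k • ζ k (-(j : ℤ)) := fun j =>
    Summable.of_norm (summable_of_sum_le (fun _ => norm_nonneg _) (hfin j))
  have h1 : ∀ N, seqPoly ζ (truncation b N) =
      ∑ j ∈ Finset.range N, ∑ k ∈ Finset.range N, b j k • ζ k (-(j : ℤ)) := fun N => by
    simp only [truncation, map_sum, seqPoly_single]
  simp_rw [h1]
  exact tendsto_square_sums (fun j => (hs j).hasSum.tendsto_sum_nat) (hb.mul_right (√K))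
    fun j N => (norm_sum_le _ _).trans (hfin j _)

lemma continuous_increment {E : Type} [NormedAddCommGroup E] [NormedSpace ℂ E] {X : ℝ → E}
    (hX : Continuous X) (d : ℕ) (s : ℝ) : Continuous (increment d X s) := by
  unfold increment
  fun_prop

lemma inner_intervalIntegral_eq_zero [CompleteSpace H] {F : ℝ → H} (hF : Continuous F) {y : H}
    (h : ∀ v, inner ℂ y (F v) = 0) (s t : ℝ) : inner ℂ y (∫ v in s..t, F v) = 0 := by
  have := (innerSL ℂ y).intervalIntegral_comp_comm (μ := volume) (hF.intervalIntegrable s t)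
  simpa [h] using this.symm

/-- Orthogonality of increments, taken with the step τT, passes through both integrals over a period
because the processes are continuous. -/
lemma inner_genSeq_eq_zero [CompleteSpace H] {X Y : ℝ → H} (hX : Continuous X) (hY : Continuous Y)
    {T : ℝ} (h : ∀ (s₁ s₂ : ℤ) (t₁ t₂ : ℝ),
      inner ℂ (increment d Y (s₂ * T) t₂) (increment d X (s₁ * T) t₁) = 0) (k n : ℕ) (l j : ℤ) :
    inner ℂ (genSeq T d τ Y n j) (genSeq T d τ X k l) = 0 := by
  have hc : ∀ {X : ℝ → H}, Continuous X → ∀ (k : ℕ) (l : ℤ), Continuous fun v : ℝ =>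
      Complex.exp (-(2 * Real.pi * Complex.I * freq k * v / T)) •
        increment d X (τ * T) (v + l * T) := fun hX k l => by
    have := continuous_increment hX d (τ * T)
    fun_prop
  rw [genSeq, genSeq, inner_smul_left, inner_smul_right]
  have h1 := inner_intervalIntegral_eq_zero (hc hX k l)
    (y := ∫ v in (0 : ℝ)..T, Complex.exp (-(2 * Real.pi * Complex.I * freq n * v / T)) •
        increment d Y (τ * T) (v + j * T)) (fun v => by
      rw [inner_smul_right, ← inner_conj_symm, inner_intervalIntegral_eq_zero (hc hY n j) fun u => ?_]
      · simp
      · have h2 := h τ τ (v + l * T) (u + j * T)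
        rw [← inner_conj_symm, map_eq_zero, inner_smul_left]
        simp only [Int.cast_natCast] at h2
        rw [h2, mul_zero]) 0 T
  rw [h1]
  simp

lemma obsPoly_eq (T : ℝ) (ξ η : ℝ → H) (α : ℕ × ℕ →₀ ℂ) :
    obsPoly T d τ ξ η α = seqPoly (genSeq T d τ ξ) α + seqPoly (genSeq T d τ η) α := by
  simp only [obsPoly, seqPoly, Finsupp.linearCombination_apply, smul_add, Finsupp.sum_add]

lemma inner_seqPoly_eq_zero {ζ ζ' : ℕ → ℤ → H}
    (h : ∀ (k n : ℕ) (l j : ℤ), inner ℂ (ζ' n j) (ζ k l) = 0) (α β : ℕ × ℕ →₀ ℂ) :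
    inner ℂ (seqPoly ζ' α) (seqPoly ζ β) = 0 := by
  simp only [seqPoly, Finsupp.linearCombination_apply, Finsupp.sum, sum_inner, inner_sum,
    inner_smul_left, inner_smul_right, h, mul_zero, Finset.sum_const_zero]

end Stochastic

/-! ### Errors of estimates and projections for concrete processes. -/

section SignalNoise

variable {d τ : ℕ} {b : ℕ → Vec} {f g : Density} {Ω : Type} [MeasurableSpace Ω] {P : Measure Ω}
  {T : ℝ} {ξ η : ℝ → Lp ℂ 2 P}

/-- The isometry covers finite combinations only, so b is truncated. The truncations converge to A ξ
in the space of random variables and, boundedly, to B pointwise in frequency. Signal and noise terms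
separate because they are uncorrelated. -/
lemma norm_sq_sub_obsPoly (hf : IsSpectralDensity d τ f) (hg : IsSpectralDensity d τ g)
    (hb : Summable fun j => ‖b j‖) (h : IsSignalNoise P T d τ f g ξ η) (α : ℕ × ℕ →₀ ℂ) :
    ENNReal.ofReal (‖functionalB T d τ b ξ - obsPoly T d τ ξ η α‖ ^ 2) =
      mse d τ b (trigPoly d τ α) f g := by
  obtain ⟨hαc, D, hD⟩ := cpoly_continuous_bdd α
  have hB := hf.integrable_quad_of_bound (aesm_bFun hb) (norm_bFun_le hb)
  have hBα := hf.integrable_quad_sub (aesm_bFun hb) hαc.aestronglyMeasurable hB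
    (hf.integrable_quad_of_bound hαc.aestronglyMeasurable hD)
  have hgα := hg.integrable_quad_of_bound hαc.aestronglyMeasurable hD
  rw [trigPoly_eq_fun, (mse_beta_smul_eq_ofReal hf hg hBα hgα).1]
  congr 1
  have h1 : Tendsto (fun N => ‖seqPoly (genSeq T d τ ξ) (truncation b N) -
      obsPoly T d τ ξ η α‖ ^ 2) atTop
      (𝓝 (‖functionalB T d τ b ξ - obsPoly T d τ ξ η α‖ ^ 2)) :=
    ((tendsto_seqPoly_truncation hf h.signal.density hb).sub_const _).norm.pow 2
  refine tendsto_nhds_unique h1 ?_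
  have h2 : ∀ N, ‖seqPoly (genSeq T d τ ξ) (truncation b N) - obsPoly T d τ ξ η α‖ ^ 2 =
      1 / (2 * Real.pi) *
        ∫ lam, quad (weighted d τ f lam) (cpoly (truncation b N) lam - cpoly α lam) ∂band +
      1 / (2 * Real.pi) * ∫ lam, quad (weighted d τ g lam) (cpoly α lam) ∂band := fun N => by
    have h3 := norm_sq_seqPoly hf h.signal.density (truncation b N - α)
    simp only [map_sub, Pi.sub_apply] at h3
    rw [← h3, ← norm_sq_seqPoly hg h.noise.density, obsPoly_eq, ← sub_sub, ← map_sub,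
      norm_sub_sq (𝕜 := ℂ), ← inner_conj_symm, inner_seqPoly_eq_zero
        (inner_genSeq_eq_zero h.signal.cont h.noise.cont h.uncorrelated)]
    simp
  simp_rw [h2]
  rw [integral_add hBα hgα, mul_add]
  refine (Tendsto.const_mul _ ?_).add_const _
  refine tendsto_integral_of_dominated_convergence
    (fun lam => wtr d τ f lam * ((∑' j, ‖b j‖) + D) ^ 2) (fun N => ?_)
    (hf.integrable_wtr.mul_const _) (fun N => ?_) (Eventually.of_forall fun lam => ?_)
  · exact aesm_quad hf.measurable_weighted
      (((cpoly_continuous_bdd _).1.sub hαc).aestronglyMeasurable)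
  · filter_upwards [hf.quad_le, hf.positive_weighted] with lam h3 h4
    rw [Real.norm_of_nonneg (quad_nonneg h4 _)]
    refine (h3 _).trans ?_
    have := wtr_nonneg d τ f lam
    gcongr
    exact (norm_sub_le _ _).trans (add_le_add (norm_cpoly_truncation_le hb N lam) (hD lam))
  · have hc : Continuous fun x : Vec => quad (weighted d τ f lam) x := by
      unfold quad
      fun_prop
    exact (hc.tendsto _).comp ((tendsto_cpoly_truncation hb lam).sub_const _)

/-- One sequence of polynomials approaches h in L₂(f + g) and its observations approach X; both
sides of the identity for polynomials then pass to the limit. -/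
theorem norm_sq_sub_estimate (hf : IsSpectralDensity d τ f) (hg : IsSpectralDensity d τ g)
    (hb : Summable fun j => ‖b j‖) (h : IsSignalNoise P T d τ f g ξ η) {k : ℝ → Vec}
    {X : Lp ℂ 2 P} (hX : IsEstimate T d τ f g ξ η k X) :
    ENNReal.ofReal (‖functionalB T d τ b ξ - X‖ ^ 2) = mse d τ b k f g := by
  have h0 : ∀ n : ℕ, (0 : ℝ) < 1 / (n + 1) := fun n => by positivity
  have ht := tendsto_one_div_add_atTop_nhds_zero_nat (𝕜 := ℝ)
  choose α hα1 hα2 using fun n : ℕ => hX.2 _ (h0 n)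
  have h1 : Tendsto (fun n => sqNorm (f + g) (k - trigPoly d τ (α n))) atTop (𝓝 0) := by
    refine tendsto_of_tendsto_of_tendsto_of_le_of_le tendsto_const_nhds ?_ (fun _ => bot_le)
      fun n => (hα1 n).le
    simpa using ENNReal.tendsto_ofReal ht
  have h2 : Tendsto (fun n => obsPoly T d τ ξ η (α n)) atTop (𝓝 X) := by
    rw [tendsto_iff_norm_sub_tendsto_zero]
    refine squeeze_zero (fun _ => norm_nonneg _) (fun n => ?_) ht
    rw [norm_sub_rev]
    exact (hα2 n).le
  have h3 := mse_tendsto hf hg hb hX.1 h1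
  simp_rw [← norm_sq_sub_obsPoly hf hg hb h] at h3
  exact tendsto_nhds_unique
    (ENNReal.tendsto_ofReal ((h2.const_sub (functionalB T d τ b ξ)).norm.pow 2)) h3

/-- Pythagoras shows that no combination of observations does better than X, and approximation of X
by such combinations shows that the infimum is attained at X. -/
theorem norm_sq_sub_projection (hf : IsSpectralDensity d τ f) (hg : IsSpectralDensity d τ g)
    (hb : Summable fun j => ‖b j‖) (h : IsSignalNoise P T d τ f g ξ η)
    {X : Lp ℂ 2 P} (hX : IsProjection T d τ b ξ η X) :
    ENNReal.ofReal (‖functionalB T d τ b ξ - X‖ ^ 2) = optMSE d τ b f g := by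
  rw [optMSE_eq_iInf hf hg hb]
  simp_rw [← norm_sq_sub_obsPoly hf hg hb h]
  have hcl : IsClosed {Y : Lp ℂ 2 P | inner ℂ Y (functionalB T d τ b ξ - X) = 0} :=
    isClosed_eq (by fun_prop) continuous_const
  have hX0 : inner ℂ X (functionalB T d τ b ξ - X) = 0 := closure_minimal hX.2 hcl hX.1
  refine le_antisymm (le_iInf fun α => ENNReal.ofReal_le_ofReal ?_) ?_
  · have h1 : functionalB T d τ b ξ - obsPoly T d τ ξ η α =
        (X - obsPoly T d τ ξ η α) + (functionalB T d τ b ξ - X) := by abel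
    have h2 : inner ℂ (X - obsPoly T d τ ξ η α) (functionalB T d τ b ξ - X) = 0 := by
      rw [inner_sub_left, hX0, hX.2 _ ⟨α, rfl⟩, sub_zero]
    rw [h1, norm_add_sq (𝕜 := ℂ), h2]
    simp only [map_zero, mul_zero, add_zero]
    exact le_add_of_nonneg_left (sq_nonneg _)
  · obtain ⟨Y, hY, hYX⟩ := mem_closure_iff_seq_limit.1 hX.1
    refine ge_of_tendsto' (ENNReal.tendsto_ofReal
      ((hYX.const_sub (functionalB T d τ b ξ)).norm.pow 2)) fun n => ?_
    obtain ⟨α, hα⟩ := hY n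
    rw [← hα]
    exact iInf_le _ α

end SignalNoise

/-! ### Least favourable densities -/

section LeastFavourable

variable {d τ : ℕ} {b : ℕ → Vec} {Df Dg : Set Density} {f₀ g₀ : Density}

/-- The condition 0 ≤ J makes the comparison of extended nonnegative errors equivalent to that of
the real functionals. R is a relation since the functional is given through witnesses that need not
be unique. -/
lemma leastFavourable_iff_isGreatest {R : Density → Density → ℝ → Prop}
    (hR : ∀ f ∈ Df, ∀ g ∈ Dg, ∀ J, R f g J → optMSE d τ b f g = ENNReal.ofReal J ∧ 0 ≤ J)
    (hex : ∀ f ∈ Df, ∀ g ∈ Dg, ∃ J, R f g J) (hf₀ : f₀ ∈ Df) (hg₀ : g₀ ∈ Dg) {J₀ : ℝ}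
    (hJ₀ : R f₀ g₀ J₀) :
    LeastFavourable d τ b Df Dg f₀ g₀ ↔ IsGreatest {J | ∃ f ∈ Df, ∃ g ∈ Dg, R f g J} J₀ := by
  obtain ⟨e₀, p₀⟩ := hR f₀ hf₀ g₀ hg₀ J₀ hJ₀
  constructor
  · rintro ⟨-, -, h⟩
    refine ⟨⟨f₀, hf₀, g₀, hg₀, hJ₀⟩, ?_⟩
    rintro J ⟨f, hf, g, hg, hJ⟩
    have h1 := h f hf g hg
    rwa [(hR f hf g hg J hJ).1, e₀, ENNReal.ofReal_le_ofReal_iff p₀] at h1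
  · rintro ⟨-, h⟩
    refine ⟨hf₀, hg₀, fun f hf g hg => ?_⟩
    obtain ⟨J, hJ⟩ := hex f hf g hg
    rw [(hR f hf g hg J hJ).1, e₀]
    exact ENNReal.ofReal_le_ofReal (h ⟨f, hf, g, hg, hJ⟩)

/-- If the error is K - s with K common to the whole class, a largest error is a smallest s. -/
lemma forall_le_iff_isLeast {D : Set Density} {v : Density → ℝ≥0∞} {R : Density → ℝ → Prop} {K : ℝ}
    (hR : ∀ f ∈ D, ∀ s, R f s → v f = ENNReal.ofReal (K - s) ∧ 0 ≤ K - s)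
    (hex : ∀ f ∈ D, ∃ s, R f s) (hf₀ : f₀ ∈ D) {s₀ : ℝ} (hs₀ : R f₀ s₀) :
    (∀ f ∈ D, v f ≤ v f₀) ↔ IsLeast {s | ∃ f ∈ D, R f s} s₀ := by
  obtain ⟨e₀, p₀⟩ := hR f₀ hf₀ s₀ hs₀
  constructor
  · intro h
    refine ⟨⟨f₀, hf₀, hs₀⟩, ?_⟩
    rintro s ⟨f, hf, hs⟩
    have h1 := h f hf
    rw [(hR f hf s hs).1, e₀, ENNReal.ofReal_le_ofReal_iff p₀] at h1
    linarith
  · rintro ⟨-, h⟩ f hf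
    obtain ⟨s, hs⟩ := hex f hf
    rw [(hR f hf s hs).1, e₀]
    exact ENNReal.ofReal_le_ofReal (sub_le_sub_left (h ⟨f, hf, hs⟩) K)

lemma leastFavourable_singleton_right (hf₀ : f₀ ∈ Df) {g : Density} :
    LeastFavourable d τ b Df {g} f₀ g ↔ ∀ f ∈ Df, optMSE d τ b f g ≤ optMSE d τ b f₀ g :=
  ⟨fun h f hf => h.2.2 f hf g rfl, fun h => ⟨hf₀, rfl, by
    rintro f hf _ rfl
    exact h f hf⟩⟩

lemma leastFavourable_singleton_left (hg₀ : g₀ ∈ Dg) {f : Density} :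
    LeastFavourable d τ b {f} Dg f g₀ ↔ ∀ g ∈ Dg, optMSE d τ b f g ≤ optMSE d τ b f g₀ :=
  ⟨fun h g hg => h.2.2 f rfl g hg, fun h => ⟨rfl, hg₀, by
    rintro _ rfl g hg
    exact h g hg⟩⟩

end LeastFavourable

end

end PCFilter

/-! ### The theorem, assembled from the evaluations of Δ(f, g) and the saddle-point argument. -/

theorem mainTheorem8 (d τ : ℕ) (hτ : 0 < τ) (T : ℝ) (hT : 0 < T)
    (a : ℝ → ℂ)
    (ha : ∀ j : ℕ, MemLp (fun v => a (v + j * T)) 2 (volume.restrict (Set.Ico 0 T)))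
    (b : ℕ → Vec) (hb : ∀ j k, b j k = bCoeff T d τ a j k)
    (hbs : Summable fun j : ℕ => ((j : ℝ) + 1) * ‖b j‖)
    (Df Dg : Set Density)
    (hDf : ∀ f ∈ Df, IsSpectralDensity d τ f) (hDg : ∀ g ∈ Dg, IsSpectralDensity d τ g)
    (f₀ g₀ : Density) (hf₀ : f₀ ∈ Df) (hg₀ : g₀ ∈ Dg) :
    -- the stochastic meaning of `Δ(h; f, g)` and `Δ(f, g)`
    (∀ f ∈ Df, ∀ g ∈ Dg, ∀ (Ω : Type) (_ : MeasurableSpace Ω) (P : Measure Ω)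
      (_ : IsProbabilityMeasure P) (ξ η : ℝ → Lp ℂ 2 P), IsSignalNoise P T d τ f g ξ η →
        (∀ h X, IsEstimate T d τ f g ξ η h X →
          ENNReal.ofReal (‖functionalB T d τ b ξ - X‖ ^ 2) = mse d τ b h f g) ∧
        ∀ X, IsProjection T d τ b ξ η X →
          ENNReal.ofReal (‖functionalB T d τ b ξ - X‖ ^ 2) = optMSE d τ b f g) ∧
    -- the operators `P`, `R`, `Q`
    (∀ fromNoise : Bool, Minimality d τ f₀ g₀ →
      (∀ f ∈ Df, ∀ g ∈ Dg, ∃ J, IsFilterValue d τ b fromNoise f g J) →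
      (LeastFavourable d τ b Df Dg f₀ g₀ ↔
        ∃ J₀, IsFilterValue d τ b fromNoise f₀ g₀ J₀ ∧
          IsGreatest {J | ∃ f ∈ Df, ∃ g ∈ Dg, IsFilterValue d τ b fromNoise f g J} J₀)) ∧
    -- factorizations of `f + g` and `f`
    (∀ ψ₀ φ₀, InverseFactor d τ (f₀ + g₀) ψ₀ → CanonicalCoeffs d τ b f₀ φ₀ →
      ((∀ f ∈ Df, ∀ g ∈ Dg, ∃ ψ φ, InverseFactor d τ (f + g) ψ ∧ CanonicalCoeffs d τ b f φ) →
        (LeastFavourable d τ b Df Dg f₀ g₀ ↔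
          IsGreatest {J | ∃ f ∈ Df, ∃ g ∈ Dg, ∃ ψ φ, InverseFactor d τ (f + g) ψ ∧
              CanonicalCoeffs d τ b f φ ∧
              J = sqSum (tildeB φ b) - sqSum (psiC ψ (gramB φ b))}
            (sqSum (tildeB φ₀ b) - sqSum (psiC ψ₀ (gramB φ₀ b))))) ∧
      ∀ h, IsSignalChar d τ b ψ₀ φ₀ h →
        IsOptimal d τ b f₀ g₀ h ∧
        (MinimaxRegular Df Dg f₀ g₀ → LeastFavourable d τ b Df Dg f₀ g₀ →
          h ∈ HD d τ Df Dg → IsMinimax d τ b Df Dg h)) ∧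
    -- factorizations of `f + g` and `g`
    (∀ ψ₀ ω₀, InverseFactor d τ (f₀ + g₀) ψ₀ → CanonicalCoeffs d τ b g₀ ω₀ →
      ((∀ f ∈ Df, ∀ g ∈ Dg, ∃ ψ ω, InverseFactor d τ (f + g) ψ ∧ CanonicalCoeffs d τ b g ω) →
        (LeastFavourable d τ b Df Dg f₀ g₀ ↔
          IsGreatest {J | ∃ f ∈ Df, ∃ g ∈ Dg, ∃ ψ ω, InverseFactor d τ (f + g) ψ ∧
              CanonicalCoeffs d τ b g ω ∧
              J = sqSum (tildeB ω b) - sqSum (psiC ψ (gramB ω b))}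
            (sqSum (tildeB ω₀ b) - sqSum (psiC ψ₀ (gramB ω₀ b))))) ∧
      ∀ h, IsNoiseChar d τ b ψ₀ ω₀ h →
        IsOptimal d τ b f₀ g₀ h ∧
        (MinimaxRegular Df Dg f₀ g₀ → LeastFavourable d τ b Df Dg f₀ g₀ →
          h ∈ HD d τ Df Dg → IsMinimax d τ b Df Dg h)) ∧
    -- `g` known
    (∀ g, IsSpectralDensity d τ g → ∀ ω, CanonicalCoeffs d τ b g ω →
      ∀ ψ₀, InverseFactor d τ (f₀ + g) ψ₀ →
        ((∀ f ∈ Df, ∃ ψ, InverseFactor d τ (f + g) ψ) →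
          (LeastFavourable d τ b Df {g} f₀ g ↔
            IsLeast {J | ∃ f ∈ Df, ∃ ψ, InverseFactor d τ (f + g) ψ ∧
              J = sqSum (psiC ψ (gramB ω b))} (sqSum (psiC ψ₀ (gramB ω b))))) ∧
        ∀ h, IsNoiseChar d τ b ψ₀ ω h →
          IsOptimal d τ b f₀ g h ∧
          (MinimaxRegular Df {g} f₀ g → LeastFavourable d τ b Df {g} f₀ g →
            h ∈ HD d τ Df {g} → IsMinimax d τ b Df {g} h)) ∧
    -- `f` known
    (∀ f, IsSpectralDensity d τ f → ∀ φ, CanonicalCoeffs d τ b f φ →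
      ∀ ψ₀, InverseFactor d τ (f + g₀) ψ₀ →
        ((∀ g ∈ Dg, ∃ ψ, InverseFactor d τ (f + g) ψ) →
          (LeastFavourable d τ b {f} Dg f g₀ ↔
            IsLeast {J | ∃ g ∈ Dg, ∃ ψ, InverseFactor d τ (f + g) ψ ∧
              J = sqSum (psiC ψ (gramB φ b))} (sqSum (psiC ψ₀ (gramB φ b))))) ∧
        ∀ h, IsSignalChar d τ b ψ₀ φ h →
          IsOptimal d τ b f g₀ h ∧
          (MinimaxRegular {f} Dg f g₀ → LeastFavourable d τ b {f} Dg f g₀ →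
            h ∈ HD d τ {f} Dg → IsMinimax d τ b {f} Dg h)) ∧
    -- the minimax spectral characteristic
    (MinimaxRegular Df Dg f₀ g₀ → LeastFavourable d τ b Df Dg f₀ g₀ →
      ∀ h, IsOptimal d τ b f₀ g₀ h → h ∈ HD d τ Df Dg → IsMinimax d τ b Df Dg h) := by
  have hb1 : Summable fun j => ‖b j‖ := by
    refine Summable.of_nonneg_of_le (fun _ => norm_nonneg _) (fun j => ?_) hbs
    exact le_mul_of_one_le_left (norm_nonneg _) (by linarith [j.cast_nonneg (α := ℝ)])
  have hf₀' := hDf f₀ hf₀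
  have hg₀' := hDg g₀ hg₀
  refine ⟨?_, ?_, ?_, ?_, ?_, ?_, ?_⟩
  · intro f hf g hg Ω _ P _ ξ η hsn
    exact ⟨fun h X hX => norm_sq_sub_estimate (hDf f hf) (hDg g hg) hb1 hsn hX,
      fun X hX => norm_sq_sub_projection (hDf f hf) (hDg g hg) hb1 hsn hX⟩
  · intro fromNoise _ hex
    have key := fun {J₀} => leastFavourable_iff_isGreatest (J₀ := J₀)
      (fun f hf g hg J hJ => filterValue_eq (hDf f hf) (hDg g hg) hb1 hJ) hex hf₀ hg₀
    obtain ⟨J₀, hJ₀⟩ := hex f₀ hf₀ g₀ hg₀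
    exact ⟨fun h => ⟨J₀, hJ₀, (key hJ₀).1 h⟩, fun ⟨J, hJ, hgr⟩ => (key hJ).2 hgr⟩
  · intro ψ₀ φ₀ hψ₀ hφ₀
    refine ⟨fun hex => ?_, fun h hh => ?_⟩
    · refine leastFavourable_iff_isGreatest (R := fun f g J => ∃ ψ φ, InverseFactor d τ (f + g) ψ ∧
        CanonicalCoeffs d τ b f φ ∧ J = sqSum (tildeB φ b) - sqSum (psiC ψ (gramB φ b))) ?_ ?_
        hf₀ hg₀ ⟨ψ₀, φ₀, hψ₀, hφ₀, rfl⟩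
      · rintro f hf g hg _ ⟨ψ, φ, hψ, hφ, rfl⟩
        exact (optMSE_of_factorization hτ (hDf f hf) (hDg g hg) hb1 hψ hφ).1
      · intro f hf g hg
        obtain ⟨ψ, φ, hψ, hφ⟩ := hex f hf g hg
        exact ⟨_, ψ, φ, hψ, hφ, rfl⟩
    · have hopt := (optMSE_of_factorization hτ hf₀' hg₀' hb1 hψ₀ hφ₀).2 h hh
      exact ⟨hopt, fun hreg hLF hHD => isMinimax_of_leastFavourable hDf hDg hb1 hreg hLF hopt hHD⟩
  · intro ψ₀ ω₀ hψ₀ hω₀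
    refine ⟨fun hex => ?_, fun h hh => ?_⟩
    · refine leastFavourable_iff_isGreatest (R := fun f g J => ∃ ψ ω, InverseFactor d τ (f + g) ψ ∧
        CanonicalCoeffs d τ b g ω ∧ J = sqSum (tildeB ω b) - sqSum (psiC ψ (gramB ω b))) ?_ ?_
        hf₀ hg₀ ⟨ψ₀, ω₀, hψ₀, hω₀, rfl⟩
      · rintro f hf g hg _ ⟨ψ, ω, hψ, hω, rfl⟩
        exact (optMSE_of_noise_factorization hτ (hDf f hf) (hDg g hg) hb1 hψ hω).1
      · intro f hf g hg
        obtain ⟨ψ, ω, hψ, hω⟩ := hex f hf g hg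
        exact ⟨_, ψ, ω, hψ, hω, rfl⟩
    · have hopt := (optMSE_of_noise_factorization hτ hf₀' hg₀' hb1 hψ₀ hω₀).2 h hh
      exact ⟨hopt, fun hreg hLF hHD => isMinimax_of_leastFavourable hDf hDg hb1 hreg hLF hopt hHD⟩
  · intro g hg ω hω ψ₀ hψ₀
    have hsing : ∀ g' ∈ ({g} : Set Density), IsSpectralDensity d τ g' := by
      rintro _ rfl
      exact hg
    refine ⟨fun hex => ?_, fun h hh => ?_⟩
    · rw [leastFavourable_singleton_right hf₀]
      -- With g known, ‖Ω̃ b‖² is the same for all f in the class, so only the subtracted term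
      -- varies.
      refine forall_le_iff_isLeast (K := sqSum (tildeB ω b)) (v := fun f => optMSE d τ b f g)
        (R := fun f J => ∃ ψ, InverseFactor d τ (f + g) ψ ∧ J = sqSum (psiC ψ (gramB ω b)))
        ?_ ?_ hf₀ ⟨ψ₀, hψ₀, rfl⟩
      · rintro f hf _ ⟨ψ, hψ, rfl⟩
        exact (optMSE_of_noise_factorization hτ (hDf f hf) hg hb1 hψ hω).1
      · intro f hf
        obtain ⟨ψ, hψ⟩ := hex f hf
        exact ⟨_, ψ, hψ, rfl⟩
    · have hopt := (optMSE_of_noise_factorization hτ hf₀' hg hb1 hψ₀ hω).2 h hh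
      exact ⟨hopt, fun hreg hLF hHD => isMinimax_of_leastFavourable hDf hsing hb1 hreg hLF hopt hHD⟩
  · intro f hf φ hφ ψ₀ hψ₀
    have hsing : ∀ f' ∈ ({f} : Set Density), IsSpectralDensity d τ f' := by
      rintro _ rfl
      exact hf
    refine ⟨fun hex => ?_, fun h hh => ?_⟩
    · rw [leastFavourable_singleton_left hg₀]
      refine forall_le_iff_isLeast (K := sqSum (tildeB φ b)) (v := fun g => optMSE d τ b f g)
        (R := fun g J => ∃ ψ, InverseFactor d τ (f + g) ψ ∧ J = sqSum (psiC ψ (gramB φ b)))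
        ?_ ?_ hg₀ ⟨ψ₀, hψ₀, rfl⟩
      · rintro g hg _ ⟨ψ, hψ, rfl⟩
        exact (optMSE_of_factorization hτ hf (hDg g hg) hb1 hψ hφ).1
      · intro g hg
        obtain ⟨ψ, hψ⟩ := hex g hg
        exact ⟨_, ψ, hψ, rfl⟩
    · have hopt := (optMSE_of_factorization hτ hf hg₀' hb1 hψ₀ hφ).2 h hh
      exact ⟨hopt, fun hreg hLF hHD => isMinimax_of_leastFavourable hsing hDg hb1 hreg hLF hopt hHD⟩
  · intro hreg hLF h hopt hHD
    exact isMinimax_of_leastFavourable hDf hDg hb1 hreg hLF hopt hHD
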